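/- Let $M$ be a compact connected smooth Riemannian manifold without boundary, with Riemannian distance $d$, and let $H:T^*M\to\mathbb{R}$ be continuous, convex in $p\in T_x^*M$ for every $x$, and superlinear: $\lim_{|p|\to\infty}H(x,p)/|p|=+\infty$ for every $x\in M$. Let $$L(x,v)=\max_{p\in T_x^*M}\{\langle p,v\rangle-H(x,p)\},\qquad \widehat L(x,v)=L(x,-v),\qquad \widehat H(x,p)=\max_{v\in T_xM}\{\langle p,v\rangle-\widehat L(x,v)\},$$ and let $$c(H)=\inf\{c\in\mathbb{R}:\ \text{there is a Lipschitz } \omega:M\to\mathbb{R}\text{ with } H(x,d_x\omega)\le c\text{ for a.e. }x\in M\}$$ be the Mañé critical value. For $\lambda>0$ and $x\in M$ put $$u_\lambda^+(x)=-\inf_{\gamma}\int_0^{+\infty}e^{-\lambda t}\big(L(\gamma(t),\dot\gamma(t))+c(H)\big)\,dt,$$ where the infimum is over the curves $\gamma:[0,+\infty)\to M$ with $\gamma(0)=x$ that are absolutely continuous on every compact interval; as $L$ is bounded below, each of these integrals is well defined in $(-\infty,+\infty]$. Then: 1. There are constants $K,C\ge 0$ (depending, on the given $M$, only on $L$, and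 not on $\lambda$) such that for all $\lambda\in(0,1]$ and $x,y\in M$, $|u_\lambda^+(x)-u_\lambda^+(y)|\le K\,d(x,y)$ and $|u_\lambda^+(x)|\le C$. Moreover, for every $\lambda>0$: 2. For every $x\in M$ there is a curve $\gamma_{\lambda,x}^+:[0,+\infty)\to M$ that attains the infimum (which is finite) in the definition of $u_\lambda^+(x)$. 3. (Domination) For all $x,y\in M$, all reals $a\le b$ and every absolutely continuous curve $\gamma:[a,b]\to M$ with $\gamma(a)=x$, $\gamma(b)=y$, $$e^{-\lambda b}u_\lambda^+(y)-e^{-\lambda a}u_\lambda^+(x)\le\int_a^b e^{-\lambda s}\big(L(\gamma(s),\dot\gamma(s))+c(H)\big)\,ds.$$ 4. (Calibration) For every $x\in M$, every minimizing curve $\gamma_{\lambda,x}^+$ as in 2 and every $t\ge0$, $$u_\lambda^+(x)=e^{-\lambda t}u_\lambda^+(\gamma_{\lambda,x}^+(t))+\int_t^0e^{-\lambda s}\big(L(\gamma_{\lambda,x}^+(s),\dot\gamma_{\lambda,x}^+(s))+c(H)\big)\,ds.$$ 5. $-u_\lambda^+$ is a viscosity solution of $\lambda u+\widehat H(x,d_xu)=c(H)$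 on $M$, and it is the only continuous viscosity solution of this equation. -/

import Mathlib

open Set Filter Topology MeasureTheory Bundle Manifold
open scoped ContDiff NNReal

noncomputable section

namespace DiscountedHJ

/-- The cotangent space `T_x^* M`. -/
abbrev Cotangent (n : ℕ) {M : Type*} [TopologicalSpace M]
    [ChartedSpace (EuclideanSpace ℝ (Fin n)) M] (x : M) : Type :=
  TangentSpace (𝓡 n) x →L[ℝ] ℝ

/-- A fibrewise function on the cotangent bundle is continuous if it is continuous on the total
space of `T^* M`, the bundle of continuous linear maps from `TM` to the trivial line bundle. -/
def ContinuousOnCotangentBundle {n : ℕ} {M : Type*} [TopologicalSpace M]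
    [ChartedSpace (EuclideanSpace ℝ (Fin n)) M] [IsManifold (𝓡 n) ∞ M]
    (H : ∀ x : M, Cotangent n x → ℝ) : Prop :=
  Continuous (fun q : TotalSpace (EuclideanSpace ℝ (Fin n) →L[ℝ] ℝ)
    (fun x : M => TangentSpace (𝓡 n) x →L[ℝ] Bundle.Trivial M ℝ x) => H q.proj q.snd)

/-- Superlinearity: `H(x,p) / |p| → +∞` as `|p| → +∞` in `T_x^* M`, for every `x`; here `|p|` is the
dual norm of the Riemannian norm on `T_x M`. -/
def IsSuperlinear {n : ℕ} {M : Type*} [TopologicalSpace M]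
    [ChartedSpace (EuclideanSpace ℝ (Fin n)) M]
    [RiemannianBundle (fun x : M => TangentSpace (𝓡 n) x)]
    (H : ∀ x : M, Cotangent n x → ℝ) : Prop :=
  ∀ (x : M) (A : ℝ), ∃ R : ℝ, 0 < R ∧ ∀ p : Cotangent n x, R ≤ ‖p‖ → A ≤ H x p / ‖p‖

section Basic

variable {n : ℕ} {M : Type*} [MetricSpace M] [ChartedSpace (EuclideanSpace ℝ (Fin n)) M]

/-- The differential `d_x u ∈ T_x^* M`. -/
def differential (n : ℕ) {M : Type*} [MetricSpace M] [ChartedSpace (EuclideanSpace ℝ (Fin n)) M]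
    (u : M → ℝ) (x : M) : Cotangent n x :=
  mfderiv (𝓡 n) 𝓘(ℝ, ℝ) u x

/-- The velocity of a curve (with the value `0` at times of nondifferentiability). -/
def velocity (n : ℕ) {M : Type*} [MetricSpace M] [ChartedSpace (EuclideanSpace ℝ (Fin n)) M]
    (γ : ℝ → M) (t : ℝ) : TangentSpace (𝓡 n) (γ t) :=
  mfderiv 𝓘(ℝ, ℝ) (𝓡 n) γ t (1 : ℝ)

/-- A property holds at almost every point of the manifold: in every preferred chart, it holds at
Lebesgue-almost every point of the chart's target. -/
def AlmostEverywhere (n : ℕ) {M : Type*} [MetricSpace M]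
    [ChartedSpace (EuclideanSpace ℝ (Fin n)) M] (P : M → Prop) : Prop :=
  ∀ x₀ : M, ∀ᵐ y ∂(volume : Measure (EuclideanSpace ℝ (Fin n))),
    y ∈ (chartAt (EuclideanSpace ℝ (Fin n)) x₀).target →
      P ((chartAt (EuclideanSpace ℝ (Fin n)) x₀).symm y)

/-- The associated Lagrangian `L(x,v) = max_p (⟨p,v⟩ - H(x,p))`. -/
def lagrangian (H : ∀ x : M, Cotangent n x → ℝ) (x : M) (v : TangentSpace (𝓡 n) x) : ℝ :=
  ⨆ p : Cotangent n x, (p v - H x p)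

/-- The symmetrical Lagrangian `L̂(x,v) = L(x,-v)`. -/
def symLagrangian (H : ∀ x : M, Cotangent n x → ℝ) (x : M) (v : TangentSpace (𝓡 n) x) : ℝ :=
  lagrangian H x (-v)

/-- The conjugated Hamiltonian `Ĥ(x,p) = max_v (⟨p,v⟩ - L̂(x,v))` of the symmetrical Lagrangian. -/
def symHamiltonian (H : ∀ x : M, Cotangent n x → ℝ) (x : M) (p : Cotangent n x) : ℝ :=
  ⨆ v : TangentSpace (𝓡 n) x, (p v - symLagrangian H x v)

/-- The Mañé critical value: the infimum of the `c` for which there is a Lipschitz `w` with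
`H(x, d_x w) ≤ c` almost everywhere. -/
def criticalValue (H : ∀ x : M, Cotangent n x → ℝ) : ℝ :=
  sInf {c : ℝ | ∃ w : M → ℝ, (∃ K : ℝ≥0, LipschitzWith K w) ∧
    AlmostEverywhere n (fun x => MDifferentiableAt (𝓡 n) 𝓘(ℝ, ℝ) w x ∧
      H x (differential n w x) ≤ c)}

/-- The discounted running cost `e^{-λ t} (L(γ(t), γ'(t)) + c(H))` along a curve. -/
def runningCost (H : ∀ x : M, Cotangent n x → ℝ) (lam : ℝ) (γ : ℝ → M) (t : ℝ) : ℝ :=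
  Real.exp (-lam * t) * (lagrangian H (γ t) (velocity n γ t) + criticalValue H)

/-- `γ` restricts to an element of `C^{ac}([0,+∞), M)` with `γ(0) = x`; the values of `γ` at negative
times are irrelevant. -/
def IsForwardCurve (x : M) (γ : ℝ → M) : Prop :=
  γ 0 = x ∧ ∀ T : ℝ, 0 ≤ T → AbsolutelyContinuousOnInterval γ 0 T

/-- The discounted action `∫_0^∞ e^{-λ t} (L(γ, γ') + c(H)) dt`. -/
def discountedAction (H : ∀ x : M, Cotangent n x → ℝ) (lam : ℝ) (γ : ℝ → M) : ℝ :=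
  ∫ t in Ioi (0 : ℝ), runningCost H lam γ t

/-- The finite values of the discounted action on curves starting from `x`. As `L` is bounded below,
the action of a curve with nonintegrable running cost is `+∞`, so that such a curve does not
contribute to the infimum. -/
def actionValues (H : ∀ x : M, Cotangent n x → ℝ) (lam : ℝ) (x : M) : Set ℝ :=
  {A : ℝ | ∃ γ : ℝ → M, IsForwardCurve x γ ∧
    IntegrableOn (runningCost H lam γ) (Ioi 0) ∧ A = discountedAction H lam γ}

/-- `u_λ^+(x) = - inf_γ ∫_0^∞ e^{-λ t} (L(γ, γ') + c(H)) dt`. -/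
def uPlus (H : ∀ x : M, Cotangent n x → ℝ) (lam : ℝ) (x : M) : ℝ :=
  - sInf (actionValues H lam x)

/-- `γ` starts from `x` and achieves the minimum of the discounted action. -/
def IsForwardMinimizer (H : ∀ x : M, Cotangent n x → ℝ) (lam : ℝ) (x : M) (γ : ℝ → M) : Prop :=
  IsForwardCurve x γ ∧ IntegrableOn (runningCost H lam γ) (Ioi 0) ∧
    IsLeast (actionValues H lam x) (discountedAction H lam γ)

/-- Domination `u ≺_{-λ} L + c(H)`. Curves of infinite action impose no condition. -/
def IsDominated (H : ∀ x : M, Cotangent n x → ℝ) (lam : ℝ) (u : M → ℝ) : Prop :=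
  ∀ (a b : ℝ), a ≤ b → ∀ (x y : M) (γ : ℝ → M), AbsolutelyContinuousOnInterval γ a b →
    γ a = x → γ b = y → IntervalIntegrable (runningCost H lam γ) volume a b →
      Real.exp (-lam * b) * u y - Real.exp (-lam * a) * u x ≤ ∫ s in a..b, runningCost H lam γ s

/-- `u` is calibrated along `γ`, which starts from `x`. -/
def IsCalibrated (H : ∀ x : M, Cotangent n x → ℝ) (lam : ℝ) (u : M → ℝ) (x : M) (γ : ℝ → M) :
    Prop :=
  ∀ t : ℝ, 0 ≤ t →
    u x = Real.exp (-lam * t) * u (γ t) + ∫ s in t..(0 : ℝ), runningCost H lam γ s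

/-- `u` is a (continuous) viscosity solution of `λ u + F(x, d_x u) = c` on `M`. -/
structure IsViscositySolution (F : ∀ x : M, Cotangent n x → ℝ) (lam c : ℝ) (u : M → ℝ) :
    Prop where
  continuous : Continuous u
  subsolution : ∀ (φ : M → ℝ) (x : M), ContMDiff (𝓡 n) 𝓘(ℝ, ℝ) 1 φ →
    IsLocalMax (fun y => u y - φ y) x → lam * u x + F x (differential n φ x) ≤ c
  supersolution : ∀ (φ : M → ℝ) (x : M), ContMDiff (𝓡 n) 𝓘(ℝ, ℝ) 1 φ →
    IsLocalMin (fun y => u y - φ y) x → c ≤ lam * u x + F x (differential n φ x)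

end Basic

end DiscountedHJ

end

/-! Everything is read on the value function V = -u_λ^+ (`valueFunction`), an infimum of discounted
actions. Since H is only continuous, convex and superlinear, no Hamiltonian flow or regularity of
minimizers is available. The arguments rest on Fenchel's inequality p(v) ≤ L(x,v) + H(x,p), on the
duality Ĥ(x,p) = H(x,-p) (`symHamiltonian_eq`), and on a C¹ immersion f of M into a Euclidean space
that is bi-Lipschitz for the Riemannian distance. Through f, curves become vector-valued, and the
Lagrangian along a curve becomes a supremum over covectors q of one fixed vector space.

Existence of minimizers is the direct method (`exists_limit_curve`). Testing with large constant
covectors turns superlinearity into a common modulus of absolute continuity for curves of bounded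
action. A minimizing sequence and its cumulative costs therefore converge together, and Fenchel's
inequality shows that the derivative of the limit cost dominates the integrand of the limit curve.

Concatenating a curve with a minimizer, or cutting the beginning off a minimizer, yields dynamic
programming (`valueFunction_sub_le`, `IsForwardMinimizer.valueFunction_eq`); these are domination
and calibration.

The bounds are uniform in λ for the following reasons. Constant curves and the lower bound on L
bound λV, so a short connecting curve changes V by at most a constant times its duration, and V is
Lipschitz uniformly in λ. Almost critical subsolutions have bounded oscillation and, normalized to
be nonnegative, bound V from below. If V were positive everywhere, -V would be a subsolution
strictly below the critical level; hence V ≤ 0 somewhere, and the Lipschitz bound gives the upper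
estimate.

Dynamic programming along chart lines gives the viscosity subsolution property, and along minimizers
the supersolution property. Uniqueness is a doubling of variables penalized by |f(x) - f(y)|²; the
Lipschitz bound on V keeps the resulting covectors in a fixed compact set, so comparison holds
against any continuous solution. -/

set_option linter.unusedSectionVars false

namespace DiscountedHJ

/-! ### Differentials read in charts -/

section Geometry

variable {n : ℕ} {M : Type*} [MetricSpace M] [ChartedSpace (EuclideanSpace ℝ (Fin n)) M]
  [IsManifold (𝓡 n) ∞ M]
  {F : Type*} [NormedAddCommGroup F] [NormedSpace ℝ F]

/-- The differential of a map into a vector space, as a linear map on the tangent space. -/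
noncomputable def mdiff (n : ℕ) {M : Type*} [MetricSpace M]
    [ChartedSpace (EuclideanSpace ℝ (Fin n)) M] {F : Type*} [NormedAddCommGroup F] [NormedSpace ℝ F]
    (f : M → F) (x : M) : TangentSpace (𝓡 n) x →L[ℝ] F :=
  mfderiv (𝓡 n) 𝓘(ℝ, F) f x

theorem mdifferentiableAt_extChartAt_of_mem {x₀ y : M} (hy : y ∈ (extChartAt (𝓡 n) x₀).source) :
    MDifferentiableAt (𝓡 n) 𝓘(ℝ, EuclideanSpace ℝ (Fin n)) (extChartAt (𝓡 n) x₀) y :=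
  mdifferentiableAt_extChartAt (by simpa using hy)

theorem mdifferentiableAt_extChartAt_symm_of_mem {x₀ : M} {z : EuclideanSpace ℝ (Fin n)}
    (hz : z ∈ (extChartAt (𝓡 n) x₀).target) :
    MDifferentiableAt 𝓘(ℝ, EuclideanSpace ℝ (Fin n)) (𝓡 n) (extChartAt (𝓡 n) x₀).symm z := by
  have := mdifferentiableWithinAt_extChartAt_symm (I := 𝓡 n) (x := x₀) hz
  rwa [show range (𝓡 n) = univ from (𝓡 n).range_eq_univ, mdifferentiableWithinAt_univ] at this

/-- A function read in a chart. -/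
theorem contDiffAt_comp_extChartAt_symm {f : M → F} {k : ℕ∞ω} [ENat.LEInfty k] {x₀ y : M}
    (hf : ContMDiffAt (𝓡 n) 𝓘(ℝ, F) k f y) (hy : y ∈ (extChartAt (𝓡 n) x₀).source) :
    ContDiffAt ℝ k (f ∘ (extChartAt (𝓡 n) x₀).symm) (extChartAt (𝓡 n) x₀ y) := by
  rw [← contMDiffAt_iff_contDiffAt]
  have h1 : ContMDiffAt 𝓘(ℝ, EuclideanSpace ℝ (Fin n)) (𝓡 n) k (extChartAt (𝓡 n) x₀).symm
      (extChartAt (𝓡 n) x₀ y) := by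
    have := contMDiffWithinAt_extChartAt_symm_target (I := 𝓡 n) (n := k) x₀
      ((extChartAt (𝓡 n) x₀).map_source hy)
    exact this.contMDiffAt ((isOpen_extChartAt_target x₀).mem_nhds
      ((extChartAt (𝓡 n) x₀).map_source hy))
  refine ContMDiffAt.comp _ ?_ h1
  rwa [(extChartAt (𝓡 n) x₀).left_inv hy]

theorem eventuallyEq_comp_extChartAt (f : M → F) {x₀ y : M}
    (hy : y ∈ (extChartAt (𝓡 n) x₀).source) :
    f =ᶠ[𝓝 y] (f ∘ (extChartAt (𝓡 n) x₀).symm) ∘ extChartAt (𝓡 n) x₀ := by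
  filter_upwards [(isOpen_extChartAt_source x₀).mem_nhds hy] with z hz
  simp only [Function.comp_apply, (extChartAt (𝓡 n) x₀).left_inv hz]

theorem mdifferentiableAt_iff_comp_extChartAt_symm {f : M → F} {x₀ y : M}
    (hy : y ∈ (extChartAt (𝓡 n) x₀).source) :
    MDifferentiableAt (𝓡 n) 𝓘(ℝ, F) f y ↔
      DifferentiableAt ℝ (f ∘ (extChartAt (𝓡 n) x₀).symm) (extChartAt (𝓡 n) x₀ y) := by
  rw [← mdifferentiableAt_iff_differentiableAt]
  constructor
  · intro h
    refine MDifferentiableAt.comp (I' := 𝓡 n) _ ?_ (mdifferentiableAt_extChartAt_symm_of_mem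
      ((extChartAt (𝓡 n) x₀).map_source hy))
    rwa [(extChartAt (𝓡 n) x₀).left_inv hy]
  · intro h
    exact (h.comp y (mdifferentiableAt_extChartAt_of_mem hy)).congr_of_eventuallyEq
      (eventuallyEq_comp_extChartAt f hy)

theorem mdiff_eq_fderiv_chart {f : M → F} {x₀ y : M}
    (hf : MDifferentiableAt (𝓡 n) 𝓘(ℝ, F) f y) (hy : y ∈ (extChartAt (𝓡 n) x₀).source)
    (v : TangentSpace (𝓡 n) y) :
    mdiff n f y v = fderiv ℝ (f ∘ (extChartAt (𝓡 n) x₀).symm) (extChartAt (𝓡 n) x₀ y)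
        (mdiff n (extChartAt (𝓡 n) x₀) y v) := by
  unfold mdiff
  rw [(eventuallyEq_comp_extChartAt f hy).mfderiv_eq,
    mfderiv_comp (I' := 𝓘(ℝ, EuclideanSpace ℝ (Fin n))) y
      ((mdifferentiableAt_iff_comp_extChartAt_symm hy).1 hf).mdifferentiableAt
      (mdifferentiableAt_extChartAt_of_mem hy), mfderiv_eq_fderiv]
  rfl

/-! ### Lipschitz estimates for the Riemannian distance -/

section Riemannian

variable [RiemannianBundle (fun x : M => TangentSpace (𝓡 n) x)]
  [IsContMDiffRiemannianBundle (𝓡 n) ∞ (EuclideanSpace ℝ (Fin n))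
    (fun x : M => TangentSpace (𝓡 n) x)]

instance isContinuousRiemannianBundle_tangent :
    IsContinuousRiemannianBundle (EuclideanSpace ℝ (Fin n))
      (fun x : M => TangentSpace (𝓡 n) x) := by
  obtain ⟨g, hg, h⟩ := IsContMDiffRiemannianBundle.exists_contMDiff (IB := 𝓡 n) (n := ∞)
    (F := EuclideanSpace ℝ (Fin n)) (E := fun x : M => TangentSpace (𝓡 n) x)
  exact ⟨g, hg.continuous, h⟩

theorem eventually_norm_mdiff_chart_apply_le (x₀ : M) :
    ∃ C : ℝ≥0, ∀ᶠ y in 𝓝 x₀, ∀ v : TangentSpace (𝓡 n) y,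
      ‖mdiff n (extChartAt (𝓡 n) x₀) y v‖ ≤ C * ‖v‖ := by
  obtain ⟨C, hC, h⟩ := eventually_norm_mfderiv_extChartAt_lt (𝓡 n) x₀
  refine ⟨⟨C, hC.le⟩, h.mono fun y hy v => ?_⟩
  let _ := normedAddCommGroupTangentSpaceVectorSpace (extChartAt (𝓡 n) x₀ y)
  let _ := normedSpaceTangentSpaceVectorSpace (extChartAt (𝓡 n) x₀ y)
  exact ContinuousLinearMap.le_of_opNorm_le _ hy.le v

theorem eventually_norm_mdiff_apply_le {f : M → F} (hf : ContMDiff (𝓡 n) 𝓘(ℝ, F) 1 f) (x₀ : M) :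
    ∃ C : ℝ≥0, ∀ᶠ y in 𝓝 x₀, ∀ v : TangentSpace (𝓡 n) y, ‖mdiff n f y v‖ ≤ C * ‖v‖ := by
  obtain ⟨C, hC⟩ := eventually_norm_mdiff_chart_apply_le (n := n) x₀
  have h1 : ContDiffAt ℝ 1 (f ∘ (extChartAt (𝓡 n) x₀).symm) (extChartAt (𝓡 n) x₀ x₀) :=
    contDiffAt_comp_extChartAt_symm (hf x₀) (mem_extChartAt_source x₀)
  have h2 : ContinuousAt (fun y => ‖fderiv ℝ (f ∘ (extChartAt (𝓡 n) x₀).symm)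
      (extChartAt (𝓡 n) x₀ y)‖₊) x₀ :=
    (ContinuousAt.comp (f := extChartAt (𝓡 n) x₀) (h1.continuousAt_fderiv (by simp))
      (continuousAt_extChartAt (I := 𝓡 n) x₀)).nnnorm
  refine ⟨(‖fderiv ℝ (f ∘ (extChartAt (𝓡 n) x₀).symm) (extChartAt (𝓡 n) x₀ x₀)‖₊ + 1) * C, ?_⟩
  filter_upwards [hC, h2.eventually (gt_mem_nhds (lt_add_one _)),
    (isOpen_extChartAt_source (I := 𝓡 n) x₀).mem_nhds (mem_extChartAt_source x₀)] with y hy hy2 hy3 v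
  rw [mdiff_eq_fderiv_chart ((hf y).mdifferentiableAt one_ne_zero) hy3]
  refine (ContinuousLinearMap.le_opNorm _ _).trans ?_
  have hy2' : ‖fderiv ℝ (f ∘ (extChartAt (𝓡 n) x₀).symm) (extChartAt (𝓡 n) x₀ y)‖ ≤
      ((‖fderiv ℝ (f ∘ (extChartAt (𝓡 n) x₀).symm) (extChartAt (𝓡 n) x₀ x₀)‖₊ + 1 : ℝ≥0) : ℝ) := by
    exact_mod_cast hy2.le
  rw [NNReal.coe_mul, mul_assoc]
  exact mul_le_mul hy2' (hy v) (norm_nonneg _) (by positivity)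

/-- Finitely many neighbourhoods cover the space, and monotonicity in the constant lets the largest
local constant serve everywhere. -/
theorem exists_forall_of_eventually_mono {X : Type*} [TopologicalSpace X] [CompactSpace X]
    {P : X → ℝ≥0 → Prop} (hP : ∀ x a b, a ≤ b → P x a → P x b)
    (h : ∀ x, ∃ C, ∀ᶠ y in 𝓝 x, P y C) : ∃ C, ∀ x, P x C := by
  have : ∃ C, ∀ x ∈ (univ : Set X), P x C := by
    refine isCompact_univ.induction_on (p := fun s => ∃ C, ∀ x ∈ s, P x C) ⟨0, by simp⟩
      (fun s t hst ⟨C, hC⟩ => ⟨C, fun x hx => hC x (hst hx)⟩) ?_ ?_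
    · rintro s t ⟨C, hC⟩ ⟨D, hD⟩
      refine ⟨max C D, ?_⟩
      rintro x (hx | hx)
      exacts [hP _ _ _ (le_max_left _ _) (hC x hx), hP _ _ _ (le_max_right _ _) (hD x hx)]
    · intro x _
      obtain ⟨C, hC⟩ := h x
      exact ⟨_, mem_nhdsWithin_of_mem_nhds hC, C, fun y hy => hy⟩
  exact this.imp fun C hC x => hC x (mem_univ x)

variable [IsRiemannianManifold (𝓡 n) M]

/-- A bound on the differential, uniform by compactness, is integrated along C¹ paths of nearly
minimal length. -/
theorem exists_lipschitzWith_of_contMDiff [CompactSpace M] {f : M → F}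
    (hf : ContMDiff (𝓡 n) 𝓘(ℝ, F) 1 f) : ∃ K : ℝ≥0, LipschitzWith K f := by
  obtain ⟨K, hK⟩ := exists_forall_of_eventually_mono
    (P := fun (y : M) (C : ℝ≥0) => ∀ v : TangentSpace (𝓡 n) y, ‖mdiff n f y v‖ ≤ C * ‖v‖)
    (fun x a b hab h v => (h v).trans (by gcongr)) (eventually_norm_mdiff_apply_le hf)
  refine ⟨K, fun x y => ?_⟩
  rw [IsRiemannianManifold.out (I := 𝓡 n) x y]
  have key : ∀ r : ENNReal, riemannianEDist (𝓡 n) x y < r → edist (f x) (f y) ≤ K * r := by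
    intro r hr
    obtain ⟨γ, h0, h1, hγ, hl, -⟩ :=
      exists_lt_locally_constant_of_riemannianEDist_lt hr (zero_lt_one (α := ℝ))
    have hs : ContDiff ℝ 1 (f ∘ γ) := (hf.comp hγ).contDiff
    have h2 := enorm_sub_le_lintegral_deriv_of_contDiffOn_Icc (f := f ∘ γ) hs.contDiffOn
      (zero_le_one (α := ℝ))
    rw [edist_comm, edist_eq_enorm_sub, ← h0, ← h1]
    refine h2.trans ?_
    refine le_trans ?_ (mul_le_mul_right hl.le _)
    rw [pathELength_eq_lintegral_mfderiv_Icc, ← lintegral_const_mul' _ _ ENNReal.coe_ne_top]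
    refine lintegral_mono fun t => ?_
    have h3 : deriv (f ∘ γ) t = mdiff n f (γ t) (mfderiv 𝓘(ℝ, ℝ) (𝓡 n) γ t (1 : ℝ)) := by
      rw [← fderiv_apply_one_eq_deriv, ← mfderiv_eq_fderiv,
        mfderiv_comp (I' := 𝓡 n) t ((hf (γ t)).mdifferentiableAt one_ne_zero)
          ((hγ t).mdifferentiableAt one_ne_zero)]
      rfl
    rw [h3, ← ofReal_norm, ← ofReal_norm, ← ENNReal.ofReal_coe_nnreal,
      ← ENNReal.ofReal_mul K.coe_nonneg]
    exact ENNReal.ofReal_le_ofReal (hK (γ t) _)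
  have hfin : riemannianEDist (𝓡 n) x y ≠ ⊤ := by
    rw [← IsRiemannianManifold.out (I := 𝓡 n) x y]; exact edist_ne_top x y
  refine ENNReal.le_of_forall_pos_le_add fun ε hε _ => ?_
  -- The added 1 avoids a division by zero when `K = 0`.
  have hε' : (0 : ENNReal) < ε / (K + 1) := by
    refine ENNReal.div_pos (by exact_mod_cast hε.ne') (by finiteness)
  refine (key _ (ENNReal.lt_add_right hfin hε'.ne')).trans ?_
  rw [mul_add]
  gcongr
  rw [← mul_div_assoc]
  refine ENNReal.div_le_of_le_mul ?_
  rw [mul_comm]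
  gcongr
  exact le_self_add

/-- The inverse chart carries a Euclidean segment to a path whose Riemannian length is at most a
local bound on its differential times the length of the segment. -/
theorem eventually_dist_le_norm_chart_sub (x₀ : M) :
    ∃ C : ℝ≥0, ∃ U ∈ 𝓝 x₀, ∀ x ∈ U, ∀ y ∈ U,
      dist x y ≤ C * ‖extChartAt (𝓡 n) x₀ x - extChartAt (𝓡 n) x₀ y‖ := by
  rcases eventually_enorm_mfderivWithin_symm_extChartAt_lt (𝓡 n) x₀ with ⟨C, C_pos, hC⟩
  simp only [(𝓡 n).range_eq_univ, nhdsWithin_univ, mfderivWithin_univ] at hC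
  have hC' : ∀ᶠ y in 𝓝 (extChartAt (𝓡 n) x₀ x₀), ∀ v : EuclideanSpace ℝ (Fin n),
      ‖mfderiv 𝓘(ℝ, EuclideanSpace ℝ (Fin n)) (𝓡 n) (extChartAt (𝓡 n) x₀).symm y v‖ₑ ≤
        C * ‖v‖ₑ := by
    refine hC.mono fun y hy v => ?_
    let _ := normedAddCommGroupTangentSpaceVectorSpace y
    let _ := normedSpaceTangentSpaceVectorSpace y
    exact (ContinuousLinearMap.le_opENorm _ _).trans (mul_le_mul_left hy.le _)
  obtain ⟨r, r_pos, hr⟩ : ∃ r > 0, Metric.ball (extChartAt (𝓡 n) x₀ x₀) r ⊆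
      (extChartAt (𝓡 n) x₀).target ∩
        {y | ∀ v : EuclideanSpace ℝ (Fin n), ‖mfderiv 𝓘(ℝ, EuclideanSpace ℝ (Fin n)) (𝓡 n)
          (extChartAt (𝓡 n) x₀).symm y v‖ₑ ≤ C * ‖v‖ₑ} :=
    Metric.mem_nhds_iff.1 (Filter.inter_mem (extChartAt_target_mem_nhds x₀)
      (Filter.eventually_iff.1 hC'))
  refine ⟨C, (extChartAt (𝓡 n) x₀) ⁻¹' (Metric.ball (extChartAt (𝓡 n) x₀ x₀) r) ∩
    (extChartAt (𝓡 n) x₀).source, inter_mem ((continuousAt_extChartAt x₀).preimage_mem_nhds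
      (Metric.ball_mem_nhds _ r_pos)) (extChartAt_source_mem_nhds x₀), ?_⟩
  rintro x ⟨hx, hx'⟩ y ⟨hy, hy'⟩
  let η := ContinuousAffineMap.lineMap (R := ℝ) (extChartAt (𝓡 n) x₀ x) (extChartAt (𝓡 n) x₀ y)
  set γ := (extChartAt (𝓡 n) x₀).symm ∘ η
  have hη : Icc 0 1 ⊆ ⇑η ⁻¹' ((extChartAt (𝓡 n) x₀).target ∩
        {y | ∀ v : EuclideanSpace ℝ (Fin n), ‖mfderiv 𝓘(ℝ, EuclideanSpace ℝ (Fin n)) (𝓡 n)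
          (extChartAt (𝓡 n) x₀).symm y v‖ₑ ≤ C * ‖v‖ₑ}) := by
    simp only [← image_subset_iff, ContinuousAffineMap.coe_lineMap_eq,
     ← segment_eq_image_lineMap, η]
    exact Subset.trans ((convex_ball _ _).segment_subset hx hy) hr
  simp only [preimage_inter, subset_inter_iff] at hη
  have η_smooth : ContMDiffOn 𝓘(ℝ, ℝ) 𝓘(ℝ, EuclideanSpace ℝ (Fin n)) 1 η (Icc 0 1) := by
    apply ContMDiff.contMDiffOn
    rw [contMDiff_iff_contDiff]
    exact ContinuousAffineMap.contDiff _
  have h1 : riemannianEDist (𝓡 n) x y ≤ pathELength (𝓡 n) γ 0 1 := by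
    apply riemannianEDist_le_pathELength _ _ _ zero_le_one
    · exact (contMDiffOn_extChartAt_symm x₀).comp η_smooth hη.1
    · simp [γ, η, ContinuousAffineMap.coe_lineMap_eq, -extChartAt, (extChartAt (𝓡 n) x₀).left_inv hx']
    · simp [γ, η, ContinuousAffineMap.coe_lineMap_eq, -extChartAt, (extChartAt (𝓡 n) x₀).left_inv hy']
  have h2 : edist x y ≤ C * edist (extChartAt (𝓡 n) x₀ x) (extChartAt (𝓡 n) x₀ y) := by
    rw [IsRiemannianManifold.out (I := 𝓡 n) x y]
    refine h1.trans ?_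
    rw [← lintegral_fderiv_lineMap_eq_edist, pathELength_eq_lintegral_mfderivWithin_Icc,
      ← lintegral_const_mul' _ _ ENNReal.coe_ne_top]
    apply setLIntegral_mono' measurableSet_Icc (fun t ht ↦ ?_)
    have h3 : mfderivWithin 𝓘(ℝ, ℝ) (𝓡 n) γ (Icc 0 1) t =
        (mfderiv 𝓘(ℝ, EuclideanSpace ℝ (Fin n)) (𝓡 n) (extChartAt (𝓡 n) x₀).symm (η t)) ∘L
          (mfderivWithin 𝓘(ℝ, ℝ) 𝓘(ℝ, EuclideanSpace ℝ (Fin n)) η (Icc 0 1) t) := by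
      apply mfderiv_comp_mfderivWithin
      · exact mdifferentiableAt_extChartAt_symm_of_mem (hη.1 ht)
      · exact η_smooth.mdifferentiableOn one_ne_zero t ht
      · rw [uniqueMDiffWithinAt_iff_uniqueDiffWithinAt]
        exact uniqueDiffOn_Icc zero_lt_one t ht
    have h4 : mfderivWithin 𝓘(ℝ, ℝ) (𝓡 n) γ (Icc 0 1) t (1 : ℝ) =
        (mfderiv 𝓘(ℝ, EuclideanSpace ℝ (Fin n)) (𝓡 n) (extChartAt (𝓡 n) x₀).symm (η t))
          (mfderivWithin 𝓘(ℝ, ℝ) 𝓘(ℝ, EuclideanSpace ℝ (Fin n)) η (Icc 0 1) t (1 : ℝ)) :=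
      congr($h3 (1 : ℝ))
    change ‖mfderivWithin 𝓘(ℝ, ℝ) (𝓡 n) γ (Icc 0 1) t (1 : ℝ)‖ₑ ≤ _
    rw [h4]
    refine (hη.2 ht _).trans (le_of_eq ?_)
    simp only [mfderivWithin_eq_fderivWithin]
    rfl
  rw [← dist_eq_norm, dist_edist, dist_edist, ← ENNReal.coe_toReal, ← ENNReal.toReal_mul]
  exact ENNReal.toReal_mono (by finiteness) h2

end Riemannian

/-! ### Immersions into a vector space -/

section Immersion

variable [FiniteDimensional ℝ F]

theorem isInvertible_mdiff_extChartAt {x₀ y : M} (hy : y ∈ (extChartAt (𝓡 n) x₀).source) :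
    (mdiff n (extChartAt (𝓡 n) x₀) y).IsInvertible :=
  isInvertible_mfderiv_extChartAt hy

/-- An immersion determines the chart locally, through a `C¹` map. -/
theorem exists_contDiffAt_comp_eq_extChartAt {f : M → F} {x₀ : M}
    (hf : ContMDiffAt (𝓡 n) 𝓘(ℝ, F) 1 f x₀) (hinj : Function.Injective (mdiff n f x₀)) :
    ∃ g : F → EuclideanSpace ℝ (Fin n), ContDiffAt ℝ 1 g (f x₀) ∧
      ∀ᶠ x in 𝓝 x₀, g (f x) = extChartAt (𝓡 n) x₀ x := by
  have hs := mem_extChartAt_source (I := 𝓡 n) x₀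
  set h := f ∘ (extChartAt (𝓡 n) x₀).symm with hh
  set D := fderiv ℝ h (extChartAt (𝓡 n) x₀ x₀)
  have hD : Function.Injective D := by
    rw [injective_iff_map_eq_zero]
    intro w hw
    obtain ⟨v, rfl⟩ := (isInvertible_mdiff_extChartAt hs).bijective.2 w
    rw [← mdiff_eq_fderiv_chart (hf.mdifferentiableAt one_ne_zero) hs] at hw
    rw [(injective_iff_map_eq_zero _).1 hinj v hw, map_zero]
  -- After composition with a linear left inverse of the differential, the coordinate expression has
  -- derivative the identity, so the inverse function theorem recovers the chart from `f`.
  obtain ⟨Λ₀, hΛ₀⟩ := LinearMap.exists_leftInverse_of_injective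
    (D : EuclideanSpace ℝ (Fin n) →ₗ[ℝ] F)
    (LinearMap.ker_eq_bot.2 hD)
  let Λ : F →L[ℝ] EuclideanSpace ℝ (Fin n) := LinearMap.toContinuousLinearMap Λ₀
  have hcd : ContDiffAt ℝ 1 h (extChartAt (𝓡 n) x₀ x₀) := contDiffAt_comp_extChartAt_symm hf hs
  have hcd2 : ContDiffAt ℝ 1 (Λ ∘ h) (extChartAt (𝓡 n) x₀ x₀) := Λ.contDiff.contDiffAt.comp _ hcd
  have hder : HasFDerivAt (Λ ∘ h) ((ContinuousLinearEquiv.refl ℝ (EuclideanSpace ℝ (Fin n)) :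
      EuclideanSpace ℝ (Fin n) ≃L[ℝ] EuclideanSpace ℝ (Fin n)) :
      EuclideanSpace ℝ (Fin n) →L[ℝ] EuclideanSpace ℝ (Fin n)) (extChartAt (𝓡 n) x₀ x₀) := by
    have h1 := Λ.hasFDerivAt.comp _ (hcd.differentiableAt one_ne_zero).hasFDerivAt
    have e : ((ContinuousLinearEquiv.refl ℝ (EuclideanSpace ℝ (Fin n)) :
        EuclideanSpace ℝ (Fin n) ≃L[ℝ] EuclideanSpace ℝ (Fin n)) :
        EuclideanSpace ℝ (Fin n) →L[ℝ] EuclideanSpace ℝ (Fin n)) = Λ ∘L D := by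
      ext1 v
      exact (LinearMap.congr_fun hΛ₀ v).symm
    rw [e]
    exact h1
  have hstrict := hcd2.hasStrictFDerivAt' hder one_ne_zero
  refine ⟨hcd2.localInverse hder one_ne_zero ∘ Λ, ?_, ?_⟩
  · refine ContDiffAt.comp _ ?_ Λ.contDiff.contDiffAt
    have := hcd2.to_localInverse hder one_ne_zero
    simpa only [hh, Function.comp_apply, (extChartAt (𝓡 n) x₀).left_inv hs] using this
  · have h2 : ∀ᶠ z in 𝓝 (extChartAt (𝓡 n) x₀ x₀),
        hcd2.localInverse hder one_ne_zero ((Λ ∘ h) z) = z := hstrict.eventually_left_inverse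
    filter_upwards [(continuousAt_extChartAt (I := 𝓡 n) x₀).eventually h2,
      extChartAt_source_mem_nhds (I := 𝓡 n) x₀] with x hx hx2
    simpa only [hh, Function.comp_apply, (extChartAt (𝓡 n) x₀).left_inv hx2] using hx

theorem eventually_norm_chart_sub_le {f : M → F} {x₀ : M}
    (hf : ContMDiffAt (𝓡 n) 𝓘(ℝ, F) 1 f x₀) (hinj : Function.Injective (mdiff n f x₀)) :
    ∃ C : ℝ≥0, ∃ U ∈ 𝓝 x₀, ∀ x ∈ U, ∀ y ∈ U,
      ‖extChartAt (𝓡 n) x₀ x - extChartAt (𝓡 n) x₀ y‖ ≤ C * ‖f x - f y‖ := by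
  obtain ⟨g, hg, hgf⟩ := exists_contDiffAt_comp_eq_extChartAt hf hinj
  obtain ⟨C, t, ht, hC⟩ := hg.exists_lipschitzOnWith
  refine ⟨C, _, inter_mem hgf (hf.continuousAt.preimage_mem_nhds ht), ?_⟩
  rintro x ⟨hx, hx'⟩ y ⟨hy, hy'⟩
  have hx : g (f x) = _ := hx
  have hy : g (f y) = _ := hy
  rw [← hx, ← hy, ← dist_eq_norm, ← dist_eq_norm]
  exact hC.dist_le_mul _ hx' _ hy'

/-- The chart is locally a C¹ function of `f`, so the coordinates of `γ` inherit differentiability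
from `f ∘ γ`; continuity at `t` keeps nearby values in the chart domain. -/
theorem mdifferentiableAt_of_differentiableAt_comp {f : M → F} {γ : ℝ → M} {t : ℝ}
    (hf : ContMDiffAt (𝓡 n) 𝓘(ℝ, F) 1 f (γ t)) (hinj : Function.Injective (mdiff n f (γ t)))
    (hγ : ContinuousAt γ t) (hd : DifferentiableAt ℝ (f ∘ γ) t) :
    MDifferentiableAt 𝓘(ℝ, ℝ) (𝓡 n) γ t := by
  obtain ⟨g, hg, hgf⟩ := exists_contDiffAt_comp_eq_extChartAt hf hinj
  have h1 : DifferentiableAt ℝ (extChartAt (𝓡 n) (γ t) ∘ γ) t := by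
    refine ((hg.differentiableAt one_ne_zero).comp t hd).congr_of_eventuallyEq ?_
    filter_upwards [hγ.eventually hgf] with s hs using hs.symm
  have h2 := (mdifferentiableAt_extChartAt_symm_of_mem (mem_extChartAt_target (I := 𝓡 n) (γ t))
    ).comp t h1.mdifferentiableAt
  refine h2.congr_of_eventuallyEq ?_
  filter_upwards [hγ.preimage_mem_nhds (extChartAt_source_mem_nhds (I := 𝓡 n) (γ t))] with s hs
  exact ((extChartAt (𝓡 n) (γ t)).left_inv hs).symm

end Immersion

/-! ### A bi-Lipschitz embedding -/

section Embedding

/-- A `C¹` immersion into a vector space which is bi-Lipschitz for the Riemannian distance. -/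
structure IsBiLipschitzImmersion (n : ℕ) {M : Type*} [MetricSpace M]
    [ChartedSpace (EuclideanSpace ℝ (Fin n)) M] {F : Type*} [NormedAddCommGroup F] [NormedSpace ℝ F]
    (f : M → F) : Prop where
  contMDiff : ContMDiff (𝓡 n) 𝓘(ℝ, F) 1 f
  injective_mdiff : ∀ x, Function.Injective (mdiff n f x)
  lipschitz : ∃ K : ℝ≥0, LipschitzWith K f
  antilipschitz : ∃ K : ℝ≥0, AntilipschitzWith K f

variable [RiemannianBundle (fun x : M => TangentSpace (𝓡 n) x)]
  [IsContMDiffRiemannianBundle (𝓡 n) ∞ (EuclideanSpace ℝ (Fin n))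
    (fun x : M => TangentSpace (𝓡 n) x)] [IsRiemannianManifold (𝓡 n) M] [CompactSpace M]

/-- Compactness of M × M: near the diagonal both distances are compared with the chart distance;
away from it, injectivity bounds the distance between images below. -/
theorem exists_antilipschitzWith_of_immersion [FiniteDimensional ℝ F] {f : M → F}
    (hf : ContMDiff (𝓡 n) 𝓘(ℝ, F) 1 f) (hinj : Function.Injective f)
    (hd : ∀ x, Function.Injective (mdiff n f x)) : ∃ K : ℝ≥0, AntilipschitzWith K f := by
  obtain ⟨K, hK⟩ := exists_forall_of_eventually_mono
    (P := fun (z : M × M) (C : ℝ≥0) => dist z.1 z.2 ≤ C * dist (f z.1) (f z.2))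
    (fun x a b hab h => h.trans (by gcongr)) (fun z => by
      obtain ⟨x, y⟩ := z
      by_cases hxy : x = y
      · subst hxy
        obtain ⟨C, U, hU, hC⟩ := eventually_dist_le_norm_chart_sub (n := n) x
        obtain ⟨D, V, hV, hD⟩ := eventually_norm_chart_sub_le (hf x) (hd x)
        refine ⟨C * D, ?_⟩
        rw [nhds_prod_eq]
        filter_upwards [Filter.prod_mem_prod (Filter.inter_mem hU hV) (Filter.inter_mem hU hV)]
        rintro ⟨a, b⟩ ⟨⟨ha, ha'⟩, hb, hb'⟩
        refine (hC a ha b hb).trans ?_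
        rw [NNReal.coe_mul, mul_assoc, dist_eq_norm]
        exact mul_le_mul_of_nonneg_left (hD a ha' b hb') C.coe_nonneg
      · have hpos : 0 < dist (f x) (f y) := dist_pos.2 fun h => hxy (hinj h)
        have hc : Continuous fun z : M × M => dist (f z.1) (f z.2) :=
          (hf.continuous.comp continuous_fst).dist (hf.continuous.comp continuous_snd)
        have hc' : Continuous fun z : M × M => dist z.1 z.2 := continuous_dist
        refine ⟨⟨(dist x y + 1) / (dist (f x) (f y) / 2), by positivity⟩, ?_⟩
        filter_upwards [hc.continuousAt.eventually (lt_mem_nhds (half_lt_self hpos)),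
          hc'.continuousAt.eventually (gt_mem_nhds (lt_add_one (dist x y)))] with z hz hz'
        calc dist z.1 z.2 ≤ dist x y + 1 := hz'.le
          _ = (dist x y + 1) / (dist (f x) (f y) / 2) * (dist (f x) (f y) / 2) := by
            field_simp
          _ ≤ (dist x y + 1) / (dist (f x) (f y) / 2) * dist (f z.1) (f z.2) :=
            mul_le_mul_of_nonneg_left hz.le (by positivity))
  exact ⟨K, AntilipschitzWith.of_le_mul_dist fun x y => hK (x, y)⟩

variable (n M) in
theorem exists_isBiLipschitzImmersion :
    ∃ (N : ℕ) (f : M → EuclideanSpace ℝ (Fin N)), IsBiLipschitzImmersion n f := by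
  obtain ⟨N, e, he, hemb, hinj⟩ := exists_embedding_euclidean_of_compact (I := 𝓡 n) (M := M)
  have he1 : ContMDiff (𝓡 n) (𝓡 N) 1 e := he.of_le (by simp)
  exact ⟨N, e, he1, hinj, exists_lipschitzWith_of_contMDiff he1,
    exists_antilipschitzWith_of_immersion he1 hemb.injective hinj⟩

end Embedding

/-! ### Continuity of the Hamiltonian in vector-space covectors -/

section CotangentContinuity

/-- The Hamiltonian transported by the differential of a map into a vector space. -/
noncomputable def pullHamiltonian (H : ∀ x : M, Cotangent n x → ℝ) (f : M → F) (x : M) (q : F →L[ℝ] ℝ) : ℝ :=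
  H x (q.comp (mdiff n f x))

/-- In the trivialization at `x₀` the covector q ∘ d_x f reads as q composed with the derivative of
`f` in the chart, which is jointly continuous. Smoothness is asked only at `x₀`, so that `f` may
itself be a chart. -/
theorem continuousAt_pullHamiltonian {H : ∀ x : M, Cotangent n x → ℝ}
    (hH : ContinuousOnCotangentBundle H) {f : M → F} {x₀ : M}
    (hf : ContMDiffAt (𝓡 n) 𝓘(ℝ, F) 1 f x₀) (q₀ : F →L[ℝ] ℝ) :
    ContinuousAt (fun z : M × (F →L[ℝ] ℝ) => pullHamiltonian H f z.1 z.2) (x₀, q₀) := by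
  let s : M × (F →L[ℝ] ℝ) → TotalSpace (EuclideanSpace ℝ (Fin n) →L[ℝ] ℝ)
    (fun x : M => TangentSpace (𝓡 n) x →L[ℝ] Bundle.Trivial M ℝ x) :=
    fun z => ⟨z.1, z.2.comp (mdiff n f z.1)⟩
  suffices h : ContinuousAt s (x₀, q₀) from (hH.continuousAt (x := s (x₀, q₀))).comp h
  rw [FiberBundle.continuousAt_totalSpace]
  refine ⟨continuousAt_fst, ?_⟩
  have hev : ∀ᶠ y in 𝓝 x₀, MDifferentiableAt (𝓡 n) 𝓘(ℝ, F) f y := by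
    filter_upwards [extChartAt_source_mem_nhds (I := 𝓡 n) x₀,
      (continuousAt_extChartAt (I := 𝓡 n) x₀).eventually ((contDiffAt_comp_extChartAt_symm hf
        (mem_extChartAt_source x₀)).eventually (by simp))] with y hy hy2
    exact (mdifferentiableAt_iff_comp_extChartAt_symm hy).2 (hy2.differentiableAt one_ne_zero)
  have hc : ContinuousAt (fun z : M × (F →L[ℝ] ℝ) =>
      z.2.comp (fderiv ℝ (f ∘ (extChartAt (𝓡 n) x₀).symm) (extChartAt (𝓡 n) x₀ z.1))) (x₀, q₀) := by
    have h1 : ContinuousAt (fun y => fderiv ℝ (f ∘ (extChartAt (𝓡 n) x₀).symm)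
        (extChartAt (𝓡 n) x₀ y)) x₀ :=
      ContinuousAt.comp (f := extChartAt (𝓡 n) x₀) ((contDiffAt_comp_extChartAt_symm hf
        (mem_extChartAt_source x₀)).continuousAt_fderiv (by simp))
        (continuousAt_extChartAt (I := 𝓡 n) x₀)
    have h2 : ContinuousAt (fun z : M × (F →L[ℝ] ℝ) =>
      fderiv ℝ (f ∘ (extChartAt (𝓡 n) x₀).symm) (extChartAt (𝓡 n) x₀ z.1)) (x₀, q₀) :=
      ContinuousAt.comp (f := Prod.fst) (g := fun y => fderiv ℝ (f ∘ (extChartAt (𝓡 n) x₀).symm)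
        (extChartAt (𝓡 n) x₀ y)) h1 continuousAt_fst
    exact continuousAt_snd.clm_comp h2
  refine hc.congr ?_
  have hsrc := extChartAt_source_mem_nhds (I := 𝓡 n) x₀
  filter_upwards [continuousAt_fst.eventually hev, continuousAt_fst.preimage_mem_nhds hsrc]
    with z hz hz2
  rw [hom_trivializationAt_apply]
  have hz3 : z.1 ∈ (chartAt (EuclideanSpace ℝ (Fin n)) x₀).source := by simpa using hz2
  have hb : z.1 ∈ (trivializationAt (EuclideanSpace ℝ (Fin n))
      (fun x : M => TangentSpace (𝓡 n) x) x₀).baseSet := by simpa using hz3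
  ext1 v
  set w : TangentSpace (𝓡 n) z.1 := (trivializationAt (EuclideanSpace ℝ (Fin n))
      (fun x : M => TangentSpace (𝓡 n) x) x₀).symmL ℝ z.1 v with hw
  have h1 : mdiff n (extChartAt (𝓡 n) x₀) z.1 w = v := by
    unfold mdiff
    rw [← TangentBundle.continuousLinearMapAt_trivializationAt hz3]
    exact Bundle.Trivialization.continuousLinearMapAt_symmL _ hb v
  have h2 : ContinuousLinearMap.inCoordinates (EuclideanSpace ℝ (Fin n))
      (fun x : M => TangentSpace (𝓡 n) x) ℝ (Bundle.Trivial M ℝ) x₀ z.1 x₀ z.1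
      (z.2.comp (mdiff n f z.1)) v = z.2 (mdiff n f z.1 w) := by
    simp [ContinuousLinearMap.inCoordinates, hw]
  refine Eq.trans ?_ h2.symm
  rw [mdiff_eq_fderiv_chart hz hz2, h1]
  rfl

end CotangentContinuity

end Geometry


/-! ### Convex conjugates in finite dimension -/

section Conjugate

/-- For a continuous family of convex functions, superlinearity at one parameter localizes the
conjugates at all nearby parameters. -/
theorem eventually_forall_exists_le_of_superlinear {X W : Type*} [TopologicalSpace X]
    [NormedAddCommGroup W] [NormedSpace ℝ W] [FiniteDimensional ℝ W]
    {G : X → (W →L[ℝ] ℝ) → ℝ} {x₀ : X}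
    (hG : ∀ p, ContinuousAt (fun z : X × (W →L[ℝ] ℝ) => G z.1 z.2) (x₀, p))
    (hconv : ∀ x, ConvexOn ℝ univ (G x))
    (hsup : ∀ A : ℝ, ∃ R : ℝ, 0 < R ∧ ∀ p, R ≤ ‖p‖ → A * ‖p‖ ≤ G x₀ p)
    (R₀ : ℝ) {ε : ℝ} (hε : 0 < ε) :
    ∃ R : ℝ, ∀ᶠ y in 𝓝 x₀, ∀ w : W, ‖w‖ ≤ R₀ → ∀ p, ∃ p' : W →L[ℝ] ℝ,
      ‖p'‖ ≤ R ∧ p w - G y p ≤ p' w - G x₀ p' + ε := by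
  have : ProperSpace (W →L[ℝ] ℝ) := FiniteDimensional.proper ℝ _
  obtain ⟨R₁, hR₁, h₁⟩ := hsup (R₀ + 1)
  set m := G x₀ 0
  -- Beyond this radius the slope `R₀ + 1` makes every covector worse than 0 in the conjugate. The
  -- margin 2 absorbs two errors `δ ≤ 1`, one at the rescaled covector and one at 0.
  set R := max R₁ (m + 2)
  have hR : 0 < R := hR₁.trans_le (le_max_left _ _)
  set δ := min ε 1
  have hδ : 0 < δ := lt_min hε one_pos
  refine ⟨R, ?_⟩
  have hev : ∀ᶠ y in 𝓝 x₀, ∀ p ∈ Metric.closedBall (0 : W →L[ℝ] ℝ) R,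
      |G y p - G x₀ p| < δ := by
    refine (isCompact_closedBall _ _).eventually_forall_of_forall_eventually fun p _ => ?_
    have hc1 : ContinuousAt (fun z : X × (W →L[ℝ] ℝ) => G x₀ z.2) (x₀, p) :=
      ContinuousAt.comp (f := fun z : X × (W →L[ℝ] ℝ) => (x₀, z.2))
        (g := fun z : X × (W →L[ℝ] ℝ) => G z.1 z.2) (hG p) (by fun_prop)
    have hc := ((hG p).sub hc1).abs
    refine hc.eventually (gt_mem_nhds ?_)
    simpa using hδ
  filter_upwards [hev] with y hy w hw p
  have hδε : δ ≤ ε := min_le_left _ _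
  have hδ1 : δ ≤ 1 := min_le_right _ _
  by_cases hp : ‖p‖ ≤ R
  · refine ⟨p, hp, ?_⟩
    have := (abs_lt.1 (hy p (by simpa using hp))).1
    linarith
  · push Not at hp
    refine ⟨0, by simpa using hR.le, ?_⟩
    have hp0 : 0 < ‖p‖ := hR.trans hp
    -- A covector outside the ball is pulled back to the sphere of radius `R`; convexity between 0
    -- and `p` transfers the estimate there to `p`, and 0 serves as `p'`.
    set l := R / ‖p‖
    have hl0 : 0 < l := div_pos hR hp0
    have hl1 : l < 1 := (div_lt_one hp0).2 hp
    have hnorm : ‖l • p‖ = R := by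
      rw [norm_smul, Real.norm_of_nonneg hl0.le, div_mul_cancel₀ _ hp0.ne']
    have hcv := (hconv y).2 (mem_univ p) (mem_univ 0) hl0.le (sub_nonneg.2 hl1.le) (by ring)
    rw [smul_zero, add_zero] at hcv
    have h0 := abs_lt.1 (hy 0 (by simpa using hR.le))
    have h2 := (abs_lt.1 (hy (l • p) (by simp [hnorm]))).1
    have h3 := h₁ (l • p) (by rw [hnorm]; exact le_max_left _ _)
    have h4 : (l • p) w ≤ R * R₀ := by
      refine (Real.le_norm_self _).trans ((ContinuousLinearMap.le_opNorm _ _).trans ?_)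
      rw [hnorm]
      gcongr
    rw [hnorm] at h3
    have h5 : (l • p) w = l * p w := rfl
    have h6 : m + 2 ≤ R := le_max_right _ _
    simp only [smul_eq_mul] at hcv
    have h7 : l * (p w - G y p) ≤ l * (- G y 0) := by nlinarith
    have h8 := le_of_mul_le_mul_left h7 hl0
    simp only [zero_apply, zero_sub]
    linarith

/-- Reflexivity through the Riesz isomorphism; it converts a separating functional on covectors into
a tangent vector. -/
theorem exists_eval_eq {k : ℕ} (l : (EuclideanSpace ℝ (Fin k) →L[ℝ] ℝ) →L[ℝ] ℝ) :
    ∃ v : EuclideanSpace ℝ (Fin k), ∀ q : EuclideanSpace ℝ (Fin k) →L[ℝ] ℝ, l q = q v := by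
  let T := InnerProductSpace.toDual ℝ (EuclideanSpace ℝ (Fin k))
  let l' : EuclideanSpace ℝ (Fin k) →L[ℝ] ℝ := LinearMap.toContinuousLinearMap
    { toFun := fun w => l (T w)
      map_add' := fun v w => by rw [map_add, map_add]
      map_smul' := fun a w => by rw [map_smulₛₗ, map_smul]; rfl }
  refine ⟨T.symm l', fun q => ?_⟩
  have h1 : inner ℝ (T.symm l') (T.symm q) = l' (T.symm q) :=
    InnerProductSpace.toDual_symm_apply
  have h2 : l' (T.symm q) = l q := by
    change l (T (T.symm q)) = l q
    rw [T.apply_symm_apply]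
  rw [← h2, ← h1, real_inner_comm]
  exact InnerProductSpace.toDual_symm_apply

end Conjugate

/-! ### Bounds, semicontinuity and duality for the Lagrangian -/

section Lagrangian

variable {n : ℕ} {M : Type*} [MetricSpace M] [ChartedSpace (EuclideanSpace ℝ (Fin n)) M]
  [IsManifold (𝓡 n) ∞ M]
  {F : Type*} [NormedAddCommGroup F] [NormedSpace ℝ F]
  [RiemannianBundle (fun x : M => TangentSpace (𝓡 n) x)]

/-- Continuous Hamiltonians which are convex and superlinear in the fibres. -/
structure IsTonelliHamiltonian (H : ∀ x : M, Cotangent n x → ℝ) : Prop where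
  continuous : ContinuousOnCotangentBundle H
  convex : ∀ x : M, ConvexOn ℝ Set.univ (H x)
  superlinear : IsSuperlinear H

variable {H : ∀ x : M, Cotangent n x → ℝ} (hH : IsTonelliHamiltonian H)

include hH

theorem convexOn_pullHamiltonian (f : M → F) (x : M) :
    ConvexOn ℝ univ (pullHamiltonian H f x) := by
  refine ⟨convex_univ, fun q _ r _ a b ha hb hab => ?_⟩
  have e : (a • q + b • r).comp (mdiff n f x) =
      a • q.comp (mdiff n f x) + b • r.comp (mdiff n f x) := by
    ext1 v
    rfl
  unfold pullHamiltonian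
  rw [e]
  exact (hH.convex x).2 (mem_univ _) (mem_univ _) ha hb hab

/-- The differential of the chart is invertible at `x`, so the Riemannian dual norm and the norm of
the model space differ there by a bounded factor. -/
theorem superlinear_pullHamiltonian_chart (x : M) (A : ℝ) :
    ∃ R : ℝ, 0 < R ∧ ∀ p : EuclideanSpace ℝ (Fin n) →L[ℝ] ℝ, R ≤ ‖p‖ →
      A * ‖p‖ ≤ pullHamiltonian H (extChartAt (𝓡 n) x) x p := by
  obtain ⟨e, he⟩ := isInvertible_mdiff_extChartAt (mem_extChartAt_source (I := 𝓡 n) x)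
  let S : EuclideanSpace ℝ (Fin n) →L[ℝ] TangentSpace (𝓡 n) x := e.symm
  obtain ⟨R, hR, h⟩ := hH.superlinear x (|A| * ‖S‖)
  refine ⟨R * (‖S‖ + 1), by positivity, fun p hp => ?_⟩
  have h1 : ‖p‖ ≤ ‖p.comp (mdiff n (extChartAt (𝓡 n) x) x)‖ * ‖S‖ := by
    have : p = (p.comp (mdiff n (extChartAt (𝓡 n) x) x)).comp S := by
      ext1 v
      change p v = p (mdiff n (extChartAt (𝓡 n) x) x (e.symm v))
      rw [← he]
      exact congrArg p (e.apply_symm_apply v).symm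
    conv_lhs => rw [this]
    exact ContinuousLinearMap.opNorm_comp_le _ _
  set p' : Cotangent n x := p.comp (mdiff n (extChartAt (𝓡 n) x) x) with hp'
  have hR' : R ≤ ‖p'‖ := by
    by_contra hlt
    push Not at hlt
    have : ‖p'‖ * ‖S‖ ≤ R * ‖S‖ := by gcongr
    nlinarith
  have h2 := h p' hR'
  rw [le_div_iff₀ (hR.trans_le hR')] at h2
  calc A * ‖p‖ ≤ |A| * (‖p'‖ * ‖S‖) := by
        refine (mul_le_mul_of_nonneg_right (le_abs_self A) (norm_nonneg _)).trans ?_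
        gcongr
    _ ≤ H x p' := by linarith
    _ = _ := rfl

/-- The conjugates near `x₀` are controlled by the conjugate at `x₀`. -/
theorem eventually_chart_conjugate_le (x₀ : M) (R₀ : ℝ) {ε : ℝ} (hε : 0 < ε) :
    ∃ R : ℝ, ∀ᶠ y in 𝓝 x₀, ∀ v : TangentSpace (𝓡 n) y,
      ‖mdiff n (extChartAt (𝓡 n) x₀) y v‖ ≤ R₀ → ∀ p : Cotangent n y,
      ∃ p' : EuclideanSpace ℝ (Fin n) →L[ℝ] ℝ, ‖p'‖ ≤ R ∧
        p v - H y p ≤ p' (mdiff n (extChartAt (𝓡 n) x₀) y v) -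
          pullHamiltonian H (extChartAt (𝓡 n) x₀) x₀ p' + ε := by
  obtain ⟨R, hR⟩ := eventually_forall_exists_le_of_superlinear
    (G := pullHamiltonian H (extChartAt (𝓡 n) x₀)) (x₀ := x₀)
    (fun p => continuousAt_pullHamiltonian hH.continuous
      (contMDiffAt_extChartAt (I := 𝓡 n) (n := 1) (x := x₀)) p)
    (convexOn_pullHamiltonian hH _) (superlinear_pullHamiltonian_chart hH x₀) R₀ hε
  refine ⟨R, ?_⟩
  filter_upwards [hR, extChartAt_source_mem_nhds (I := 𝓡 n) x₀] with y hy hys v hv p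
  obtain ⟨e, he⟩ := isInvertible_mdiff_extChartAt hys
  let S : EuclideanSpace ℝ (Fin n) →L[ℝ] TangentSpace (𝓡 n) y := e.symm
  obtain ⟨p', hp', h⟩ := hy _ hv (p.comp S)
  refine ⟨p', hp', ?_⟩
  have h1 : (p.comp S).comp (mdiff n (extChartAt (𝓡 n) x₀) y) = p := by
    ext1 w
    change p (e.symm (mdiff n (extChartAt (𝓡 n) x₀) y w)) = p w
    rw [← he]
    exact congrArg p (e.symm_apply_apply w)
  have h2 : (p.comp S) (mdiff n (extChartAt (𝓡 n) x₀) y v) = p v := congr($h1 v)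
  rw [h2, pullHamiltonian, h1] at h
  exact h

/-- Up to an error 1, only covectors in a fixed ball at `x₀` compete, and the convex Hamiltonian is
bounded on that ball. -/
theorem eventually_chart_conjugate_bounded (x₀ : M) (R₀ : ℝ) :
    ∃ C : ℝ≥0, ∀ᶠ y in 𝓝 x₀, ∀ v : TangentSpace (𝓡 n) y,
      ‖mdiff n (extChartAt (𝓡 n) x₀) y v‖ ≤ R₀ → ∀ p : Cotangent n y, p v - H y p ≤ C := by
  have : ProperSpace (EuclideanSpace ℝ (Fin n) →L[ℝ] ℝ) := FiniteDimensional.proper ℝ _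
  obtain ⟨R, hR⟩ := eventually_chart_conjugate_le hH x₀ R₀ one_pos
  have hc : Continuous (pullHamiltonian H (extChartAt (𝓡 n) x₀) x₀) :=
    (convexOn_pullHamiltonian hH _ x₀).locallyLipschitz.continuous
  obtain ⟨B, hB⟩ := (isCompact_closedBall (0 : EuclideanSpace ℝ (Fin n) →L[ℝ] ℝ)
    R).exists_bound_of_continuousOn hc.continuousOn
  refine ⟨⟨max 0 (R * R₀ + B + 1), le_max_left _ _⟩, hR.mono fun y hy v hv p => ?_⟩
  obtain ⟨p', hp', h⟩ := hy v hv p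
  have h1 := (abs_le.1 (hB p' (by simpa using hp'))).1
  have h2 : p' (mdiff n (extChartAt (𝓡 n) x₀) y v) ≤ R * R₀ := by
    refine (Real.le_norm_self _).trans ((ContinuousLinearMap.le_opNorm _ _).trans ?_)
    have := (norm_nonneg p').trans hp'
    gcongr
  refine le_trans ?_ (le_max_right _ _)
  linarith

/-- Without this bound the real supremum defining `lagrangian` would take its default value instead
of being the conjugate. -/
theorem bddAbove_conjugate (x : M) (v : TangentSpace (𝓡 n) x) :
    BddAbove (range fun p : Cotangent n x => p v - H x p) := by
  obtain ⟨C, hC⟩ := eventually_chart_conjugate_bounded hH x ‖mdiff n (extChartAt (𝓡 n) x) x v‖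
  refine ⟨C, ?_⟩
  rintro _ ⟨p, rfl⟩
  exact hC.self_of_nhds v le_rfl p

theorem sub_le_lagrangian (x : M) (v : TangentSpace (𝓡 n) x) (p : Cotangent n x) :
    p v - H x p ≤ lagrangian H x v :=
  le_ciSup (bddAbove_conjugate hH x v) p

theorem eventually_lagrangian_le (x₀ : M) (R₀ : ℝ) :
    ∃ C : ℝ≥0, ∀ᶠ y in 𝓝 x₀, ∀ v : TangentSpace (𝓡 n) y,
      ‖mdiff n (extChartAt (𝓡 n) x₀) y v‖ ≤ R₀ → lagrangian H y v ≤ C := by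
  obtain ⟨C, hC⟩ := eventually_chart_conjugate_bounded hH x₀ R₀
  exact ⟨C, hC.mono fun y hy v hv => ciSup_le (hy v hv)⟩

/-- Each covector at a nearby point is replaced, with loss `ε`, by one at `x₀`. This one-sided
continuity, for a vector constant in the chart, suffices for estimates along affine chart lines. -/
theorem eventually_lagrangian_le_add (x₀ : M) (v₀ : TangentSpace (𝓡 n) x₀) {ε : ℝ} (hε : 0 < ε) :
    ∀ᶠ y in 𝓝 x₀, ∀ v : TangentSpace (𝓡 n) y,
      mdiff n (extChartAt (𝓡 n) x₀) y v = mdiff n (extChartAt (𝓡 n) x₀) x₀ v₀ →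
        lagrangian H y v ≤ lagrangian H x₀ v₀ + ε := by
  obtain ⟨R, hR⟩ := eventually_chart_conjugate_le hH x₀
    ‖mdiff n (extChartAt (𝓡 n) x₀) x₀ v₀‖ hε
  refine hR.mono fun y hy v hv => ciSup_le fun p => ?_
  obtain ⟨p', -, h⟩ := hy v (by rw [hv]) p
  rw [hv] at h
  have := sub_le_lagrangian hH x₀ v₀ (p'.comp (mdiff n (extChartAt (𝓡 n) x₀) x₀))
  simp only [ContinuousLinearMap.comp_apply] at this
  exact h.trans (by unfold pullHamiltonian; linarith)

theorem exists_lagrangian_zero_le [CompactSpace M] : ∃ C : ℝ≥0, ∀ x : M, lagrangian H x 0 ≤ C :=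
  exists_forall_of_eventually_mono (P := fun x C => lagrangian H x 0 ≤ C)
    (fun x a b hab h => h.trans (by exact_mod_cast hab)) fun x => by
      obtain ⟨C, hC⟩ := eventually_lagrangian_le hH x 0
      exact ⟨C, hC.mono fun y hy => hy 0 (by simp)⟩

theorem exists_neg_le_lagrangian [CompactSpace M] :
    ∃ C : ℝ≥0, ∀ (x : M) (v : TangentSpace (𝓡 n) x), -(C : ℝ) ≤ lagrangian H x v := by
  obtain ⟨C, hC⟩ := exists_forall_of_eventually_mono (P := fun (x : M) C => H x 0 ≤ C)
    (fun x a b hab h => h.trans (by exact_mod_cast hab)) fun x => by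
      -- Pulling back by a constant map produces the zero covector, hence continuity of H(·,0);
      -- testing the conjugate with 0 then bounds L below.
      have h1 := continuousAt_pullHamiltonian hH.continuous
        (contMDiffAt_const (I := 𝓡 n) (I' := 𝓘(ℝ, ℝ)) (n := 1) (x := x) (c := (0 : ℝ))) 0
      have h2 : ContinuousAt (fun y => H y 0) x := by
        refine (ContinuousAt.comp (f := fun y : M => (y, (0 : ℝ →L[ℝ] ℝ))) h1
          (by fun_prop)).congr (Eventually.of_forall fun y => ?_)
        simp [pullHamiltonian]
      refine ⟨⟨max 0 (H x 0 + 1), le_max_left _ _⟩, ?_⟩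
      filter_upwards [h2.eventually (gt_mem_nhds (lt_add_one _))] with y hy
      exact hy.le.trans (le_max_right _ _)
  refine ⟨C, fun x v => le_trans ?_ (sub_le_lagrangian hH x v 0)⟩
  simpa using hC x

/-- Fenchel–Moreau duality for the Hamiltonian. -/
theorem symHamiltonian_eq (x : M) (p : Cotangent n x) : symHamiltonian H x p = H x (-p) := by
  have hle : ∀ v : TangentSpace (𝓡 n) x, p v - symLagrangian H x v ≤ H x (-p) := by
    intro v
    have := sub_le_lagrangian hH x (-v) (-p)
    simp only [neg_apply, map_neg, neg_neg] at this
    unfold symLagrangian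
    linarith
  refine le_antisymm (ciSup_le hle) (le_of_forall_lt fun a ha => ?_)
  let G : (EuclideanSpace ℝ (Fin n) →L[ℝ] ℝ) → ℝ := H x
  have hG : ConvexOn ℝ univ G := hH.convex x
  obtain ⟨b, hab, hb⟩ := exists_between ha
  let p₀ : EuclideanSpace ℝ (Fin n) →L[ℝ] ℝ := -p
  -- Hahn–Banach: an affine minorant of the Hamiltonian takes the value `b` at `-p`. Its slope is a
  -- vector `v` with L(x,v) ≤ -c, and -v is the almost optimal vector for Ĥ.
  obtain ⟨l, c, hlc, hl⟩ := ConvexOn.exists_affine_le_of_lt (𝕜 := ℝ) (φ := G) (x := p₀) (a := b)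
    (mem_univ _) hb isClosed_univ (hG.locallyLipschitz.continuous.lowerSemicontinuous.lowerSemicontinuousOn _) hG
  obtain ⟨v, hv⟩ : ∃ v : TangentSpace (𝓡 n) x, ∀ q : Cotangent n x, l q = q v := exists_eval_eq l
  have hL : lagrangian H x v ≤ -c := by
    refine ciSup_le fun q => ?_
    have h1 : l q + c ≤ H x q := hlc ⟨q, mem_univ _⟩
    have h2 : l q = q v := hv q
    linarith
  have hsup : p (-v) - symLagrangian H x (-v) ≤ symHamiltonian H x p :=
    le_ciSup (f := fun v => p v - symLagrangian H x v) ⟨H x (-p), by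
      rintro _ ⟨w, rfl⟩; exact hle w⟩ (-v)
  simp only [symLagrangian, neg_neg, map_neg] at hsup
  have h1 : l p₀ + c = b := hl
  have h2 : l p₀ = -(p v) := hv p₀
  linarith

end Lagrangian


/-! ### Absolutely continuous curves in metric spaces -/

section AbsolutelyContinuous

variable {X Y : Type*} [PseudoMetricSpace X] [PseudoMetricSpace Y]

theorem _root_.LipschitzWith.comp_absolutelyContinuousOnInterval {g : X → Y} {K : ℝ≥0}
    (hg : LipschitzWith K g) {γ : ℝ → X} {a b : ℝ} (hγ : AbsolutelyContinuousOnInterval γ a b) :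
    AbsolutelyContinuousOnInterval (g ∘ γ) a b := by
  refine squeeze_zero (fun E => Finset.sum_nonneg fun i _ => dist_nonneg) (fun E => ?_)
    (by simpa using Tendsto.const_mul (K : ℝ) hγ)
  rw [Finset.mul_sum]
  exact Finset.sum_le_sum fun i _ => hg.dist_le_mul _ _

theorem absolutelyContinuousOnInterval_congr {γ η : ℝ → X} {a b : ℝ}
    (hγ : AbsolutelyContinuousOnInterval γ a b) (h : EqOn γ η (uIcc a b)) :
    AbsolutelyContinuousOnInterval η a b := by
  rw [absolutelyContinuousOnInterval_iff] at hγ ⊢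
  intro ε hε
  obtain ⟨δ, hδ, H⟩ := hγ ε hε
  refine ⟨δ, hδ, fun E hE hlt => ?_⟩
  refine (Finset.sum_congr rfl fun i hi => ?_).trans_lt (H E hE hlt)
  rw [h (hE.1 i hi).1, h (hE.1 i hi).2]

theorem continuousOn_of_absolutelyContinuousOnInterval {γ : ℝ → X} {a b : ℝ}
    (hγ : AbsolutelyContinuousOnInterval γ a b) : ContinuousOn γ (uIcc a b) := by
  rw [absolutelyContinuousOnInterval_iff] at hγ
  refine Metric.continuousOn_iff.2 fun t ht ε hε => ?_
  obtain ⟨δ, hδ, H⟩ := hγ ε hε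
  refine ⟨δ, hδ, fun s hs hst => ?_⟩
  simpa using H (1, fun _ => (s, t)) ⟨fun i _ => ⟨hs, ht⟩, by simp⟩ (by simpa using hst)

theorem absolutelyContinuousOnInterval_comp_add_const {γ : ℝ → X} {a b c : ℝ}
    (hγ : AbsolutelyContinuousOnInterval γ (a + c) (b + c)) :
    AbsolutelyContinuousOnInterval (fun t => γ (t + c)) a b := by
  rw [absolutelyContinuousOnInterval_iff] at hγ ⊢
  intro ε hε
  obtain ⟨δ, hδ, H⟩ := hγ ε hε
  refine ⟨δ, hδ, fun E hE hlt => ?_⟩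
  refine H (E.1, fun i => ((E.2 i).1 + c, (E.2 i).2 + c)) ⟨fun i hi => ?_, fun i hi j hj hij => ?_⟩
    (by simpa using hlt)
  · have := hE.1 i hi
    simp only [mem_uIcc] at this ⊢
    grind
  · have h1 := Set.disjoint_left.1 (hE.2 hi hj hij)
    refine Set.disjoint_left.2 fun s hs ht => h1 (a := s - c) ?_ ?_
    · simp only [mem_uIoc] at hs ⊢; grind
    · simp only [mem_uIoc] at ht ⊢; grind

theorem absolutelyContinuousOnInterval_union {γ : ℝ → X} {a b c : ℝ} (hab : a ≤ b) (hbc : b ≤ c)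
    (h₁ : AbsolutelyContinuousOnInterval γ a b) (h₂ : AbsolutelyContinuousOnInterval γ b c) :
    AbsolutelyContinuousOnInterval γ a c := by
  rw [absolutelyContinuousOnInterval_iff] at h₁ h₂ ⊢
  intro ε hε
  obtain ⟨δ₁, hδ₁, H₁⟩ := h₁ (ε / 2) (half_pos hε)
  obtain ⟨δ₂, hδ₂, H₂⟩ := h₂ (ε / 2) (half_pos hε)
  refine ⟨min δ₁ δ₂, lt_min hδ₁ hδ₂, fun E hE hlt => ?_⟩
  have hE1 : ∀ i ∈ Finset.range E.1, (a ≤ (E.2 i).1 ∧ (E.2 i).1 ≤ c) ∧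
      a ≤ (E.2 i).2 ∧ (E.2 i).2 ≤ c := by
    intro i hi
    have := hE.1 i hi
    rwa [uIcc_of_le (hab.trans hbc)] at this
  -- Truncation at `b` by `min`, and by `max` below, splits each interval into its parts in the two
  -- halves; parts beyond `b` degenerate to a point.
  have k₁ := H₁ (E.1, fun i => (min (E.2 i).1 b, min (E.2 i).2 b))
    ⟨fun i hi => by
      have := hE1 i hi
      simp only [uIcc_of_le hab, mem_Icc]
      grind, fun i hi j hj hij => by
      have h1 := Set.disjoint_left.1 (hE.2 hi hj hij)
      refine Set.disjoint_left.2 fun s hs ht => h1 (a := s) ?_ ?_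
      · simp only [mem_uIoc] at hs ⊢; grind
      · simp only [mem_uIoc] at ht ⊢; grind⟩
    (lt_of_le_of_lt (Finset.sum_le_sum fun i _ => by
      simp only [Real.dist_eq]
      exact abs_min_sub_min_le_max _ _ _ _ |>.trans (by simp)) (hlt.trans_le (min_le_left _ _)))
  have k₂ := H₂ (E.1, fun i => (max (E.2 i).1 b, max (E.2 i).2 b))
    ⟨fun i hi => by
      have := hE1 i hi
      simp only [uIcc_of_le hbc, mem_Icc]
      grind, fun i hi j hj hij => by
      have h1 := Set.disjoint_left.1 (hE.2 hi hj hij)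
      refine Set.disjoint_left.2 fun s hs ht => h1 (a := s) ?_ ?_
      · simp only [mem_uIoc] at hs ⊢; grind
      · simp only [mem_uIoc] at ht ⊢; grind⟩
    (lt_of_le_of_lt (Finset.sum_le_sum fun i _ => by
      simp only [Real.dist_eq]
      exact abs_max_sub_max_le_max _ _ _ _ |>.trans (by simp)) (hlt.trans_le (min_le_right _ _)))
  have key : ∀ s t : ℝ, dist (γ s) (γ t) ≤
      dist (γ (min s b)) (γ (min t b)) + dist (γ (max s b)) (γ (max t b)) := by
    intro s t
    rcases le_total s b with hs | hs <;> rcases le_total t b with ht | ht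
    · simp [hs, ht]
    · simpa [hs, ht] using dist_triangle (γ s) (γ b) (γ t)
    · simpa [hs, ht, add_comm] using dist_triangle (γ s) (γ b) (γ t)
    · simp [hs, ht]
  calc _ ≤ ∑ i ∈ Finset.range E.1, (dist (γ (min (E.2 i).1 b)) (γ (min (E.2 i).2 b)) +
        dist (γ (max (E.2 i).1 b)) (γ (max (E.2 i).2 b))) :=
        Finset.sum_le_sum fun i _ => key _ _
    _ < ε := by
        rw [Finset.sum_add_distrib]
        simp only at k₁ k₂
        linarith

end AbsolutelyContinuous

/-! ### The Lagrangian along a curve -/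

section Curves

variable {n : ℕ} {M : Type*} [MetricSpace M] [ChartedSpace (EuclideanSpace ℝ (Fin n)) M]
  [IsManifold (𝓡 n) ∞ M]
  {F : Type*} [NormedAddCommGroup F] [NormedSpace ℝ F]
  [RiemannianBundle (fun x : M => TangentSpace (𝓡 n) x)]
  {H : ∀ x : M, Cotangent n x → ℝ}

theorem deriv_comp_eq_mdiff_velocity {f : M → F} {γ : ℝ → M} {t : ℝ}
    (hf : MDifferentiableAt (𝓡 n) 𝓘(ℝ, F) f (γ t))
    (hγ : MDifferentiableAt 𝓘(ℝ, ℝ) (𝓡 n) γ t) :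
    HasDerivAt (f ∘ γ) (mdiff n f (γ t) (velocity n γ t)) t := by
  have h1 := (hf.comp t hγ).differentiableAt.hasDerivAt
  convert h1 using 1
  rw [← fderiv_apply_one_eq_deriv, ← mfderiv_eq_fderiv, mfderiv_comp (I' := 𝓡 n) t hf hγ]
  rfl

/-- The Lagrangian evaluated along a curve. -/
noncomputable def lagrangianAlong (H : ∀ x : M, Cotangent n x → ℝ) (γ : ℝ → M) (t : ℝ) : ℝ :=
  lagrangian H (γ t) (velocity n γ t)

theorem runningCost_eq (lam : ℝ) (γ : ℝ → M) (t : ℝ) :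
    runningCost H lam γ t = Real.exp (-lam * t) * (lagrangianAlong H γ t + criticalValue H) := rfl

/-- Every covector at `x` factors through the injective differential, so the supremum may run over a
dual space that does not depend on `x`. -/
theorem lagrangian_eq_iSup_of_injective [FiniteDimensional ℝ F] {f : M → F} {x : M}
    (hf : Function.Injective (mdiff n f x)) (v : TangentSpace (𝓡 n) x) :
    lagrangian H x v = ⨆ q : F →L[ℝ] ℝ, (q (mdiff n f x v) - pullHamiltonian H f x q) := by
  obtain ⟨Λ, hΛ⟩ := LinearMap.exists_leftInverse_of_injective
    (mdiff n f x : TangentSpace (𝓡 n) x →ₗ[ℝ] F) (LinearMap.ker_eq_bot.2 hf)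
  have hs : Function.Surjective (fun q : F →L[ℝ] ℝ => (q.comp (mdiff n f x) : Cotangent n x)) := by
    intro p
    refine ⟨p.comp (LinearMap.toContinuousLinearMap Λ), ?_⟩
    ext1 w
    exact congrArg p (LinearMap.congr_fun hΛ w)
  exact (hs.iSup_comp fun p : Cotangent n x => p v - H x p).symm

section Immersion

variable [FiniteDimensional ℝ F] {f : M → F} (hf : IsBiLipschitzImmersion n f)

include hf

theorem mdifferentiableAt_iff_comp {γ : ℝ → M} {t : ℝ} (hγ : ContinuousAt γ t) :
    MDifferentiableAt 𝓘(ℝ, ℝ) (𝓡 n) γ t ↔ DifferentiableAt ℝ (f ∘ γ) t := by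
  refine ⟨fun h => ?_, fun h => mdifferentiableAt_of_differentiableAt_comp (hf.contMDiff _)
    (hf.injective_mdiff _) hγ h⟩
  exact (deriv_comp_eq_mdiff_velocity ((hf.contMDiff _).mdifferentiableAt one_ne_zero)
    h).differentiableAt

/-- No differentiability is needed: `γ` and `f ∘ γ` are differentiable at the same times of
continuity, and at the others both sides have the default value 0. -/
theorem deriv_comp_immersion {γ : ℝ → M} {t : ℝ} (hγ : ContinuousAt γ t) :
    deriv (f ∘ γ) t = mdiff n f (γ t) (velocity n γ t) := by
  by_cases h : MDifferentiableAt 𝓘(ℝ, ℝ) (𝓡 n) γ t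
  · exact (deriv_comp_eq_mdiff_velocity ((hf.contMDiff _).mdifferentiableAt one_ne_zero) h).deriv
  · have h' := fun h2 => h ((mdifferentiableAt_iff_comp hf hγ).2 h2)
    have hv : velocity n γ t = 0 := by
      unfold velocity
      rw [mfderiv_zero_of_not_mdifferentiableAt h]
      rfl
    rw [deriv_zero_of_not_differentiableAt h', hv, map_zero]

theorem lagrangianAlong_eq_iSup {γ : ℝ → M} {t : ℝ} (hγ : ContinuousAt γ t) :
    lagrangianAlong H γ t =
      ⨆ q : F →L[ℝ] ℝ, (q (deriv (f ∘ γ) t) - pullHamiltonian H f (γ t) q) := by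
  rw [deriv_comp_immersion hf hγ]
  exact lagrangian_eq_iSup_of_injective (hf.injective_mdiff _) _

theorem bddAbove_conjugate_along (hH : IsTonelliHamiltonian H) {γ : ℝ → M} {t : ℝ}
    (hγ : ContinuousAt γ t) :
    BddAbove (range fun q : F →L[ℝ] ℝ => q (deriv (f ∘ γ) t) - pullHamiltonian H f (γ t) q) := by
  rw [deriv_comp_immersion hf hγ]
  obtain ⟨C, hC⟩ := bddAbove_conjugate hH (γ t) (velocity n γ t)
  refine ⟨C, ?_⟩
  rintro _ ⟨q, rfl⟩
  exact hC ⟨q.comp (mdiff n f (γ t)), rfl⟩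

theorem lagrangianAlong_congr {γ η : ℝ → M} {t : ℝ} (hγ : ContinuousAt γ t) (h : γ =ᶠ[𝓝 t] η) :
    lagrangianAlong H γ t = lagrangianAlong H η t := by
  have hη : ContinuousAt η t := hγ.congr h
  have h2 : f ∘ γ =ᶠ[𝓝 t] f ∘ η := h.mono fun s hs => congrArg f hs
  rw [lagrangianAlong_eq_iSup hf hγ, lagrangianAlong_eq_iSup hf hη, h2.deriv_eq, h.self_of_nhds]

theorem lagrangianAlong_comp_add_const {γ : ℝ → M} {t c : ℝ} (hγ : ContinuousAt γ (t + c)) :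
    lagrangianAlong H (fun s => γ (s + c)) t = lagrangianAlong H γ (t + c) := by
  have hη : ContinuousAt (fun s => γ (s + c)) t := by
    refine ContinuousAt.comp (g := γ) (f := fun s => s + c) hγ (by fun_prop)
  rw [lagrangianAlong_eq_iSup hf hγ, lagrangianAlong_eq_iSup hf hη]
  have : deriv (f ∘ fun s => γ (s + c)) t = deriv (f ∘ γ) (t + c) :=
    deriv_comp_add_const (f := f ∘ γ) ..
  rw [this]

/-- The conjugate is continuous in the covector, so a dense sequence realizes the supremum; each
term is measurable because derivatives are. -/
theorem measurable_lagrangianAlong (hH : IsTonelliHamiltonian H) {γ : ℝ → M} (hγ : Continuous γ) :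
    Measurable (lagrangianAlong H γ) := by
  have : TopologicalSpace.SeparableSpace (F →L[ℝ] ℝ) := by
    have : ProperSpace (F →L[ℝ] ℝ) := FiniteDimensional.proper ℝ _
    infer_instance
  borelize F
  have e : lagrangianAlong H γ = fun t => ⨆ i : ℕ,
      (TopologicalSpace.denseSeq (F →L[ℝ] ℝ) i (deriv (f ∘ γ) t) -
        pullHamiltonian H f (γ t) (TopologicalSpace.denseSeq (F →L[ℝ] ℝ) i)) := by
    funext t
    have hb := bddAbove_conjugate_along hf hH (hγ.continuousAt (x := t))
    have hc : Continuous (fun q : F →L[ℝ] ℝ => q (deriv (f ∘ γ) t) -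
        pullHamiltonian H f (γ t) q) := by
      refine Continuous.sub (by fun_prop) ?_
      exact (convexOn_pullHamiltonian hH f (γ t)).locallyLipschitz.continuous
    rw [lagrangianAlong_eq_iSup hf hγ.continuousAt]
    refine le_antisymm (ciSup_le fun q => ?_) (ciSup_le fun i => le_ciSup hb (TopologicalSpace.denseSeq _ i))
    have hb' : BddAbove (range fun i : ℕ => TopologicalSpace.denseSeq (F →L[ℝ] ℝ) i (deriv (f ∘ γ) t) -
        pullHamiltonian H f (γ t) (TopologicalSpace.denseSeq (F →L[ℝ] ℝ) i)) :=
      hb.mono (by rintro _ ⟨i, rfl⟩; exact ⟨TopologicalSpace.denseSeq _ i, rfl⟩)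
    refine (TopologicalSpace.denseRange_denseSeq (F →L[ℝ] ℝ)).induction_on (p := fun q => q (deriv (f ∘ γ) t) -
        pullHamiltonian H f (γ t) q ≤ _) q (isClosed_le hc continuous_const) fun i =>
      le_ciSup hb' i
  rw [e]
  refine Measurable.iSup fun i => ?_
  refine Measurable.sub ((TopologicalSpace.denseSeq (F →L[ℝ] ℝ) i).continuous.measurable.comp
    (measurable_deriv _)) (Continuous.measurable ?_)
  refine continuous_iff_continuousAt.2 fun t => ?_
  exact ContinuousAt.comp (f := fun s => (γ s, TopologicalSpace.denseSeq (F →L[ℝ] ℝ) i))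
    (continuousAt_pullHamiltonian hH.continuous (hf.contMDiff (γ t)) _) (by fun_prop)

/-- The curve is extended by constants to a continuous one; velocities can change only at the two
endpoints. -/
theorem aestronglyMeasurable_lagrangianAlong (hH : IsTonelliHamiltonian H) {γ : ℝ → M} {a b : ℝ}
    (hγ : ContinuousOn γ (Icc a b)) :
    AEStronglyMeasurable (lagrangianAlong H γ) (volume.restrict (Ioc a b)) := by
  rcases lt_or_ge b a with hab | hab
  · simp [Ioc_eq_empty_of_le hab.le]
  set η : ℝ → M := fun t => γ (projIcc a b hab t) with hη
  have hηc : Continuous η := (continuousOn_iff_continuous_domRestrict.1 hγ).comp continuous_projIcc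
  refine (measurable_lagrangianAlong hf hH hηc).aestronglyMeasurable.congr ?_
  rw [← restrict_Ioo_eq_restrict_Ioc]
  filter_upwards [ae_restrict_mem measurableSet_Ioo] with t ht
  refine lagrangianAlong_congr hf hηc.continuousAt ?_
  filter_upwards [Icc_mem_nhds ht.1 ht.2] with s hs
  simp [hη, projIcc_of_mem hab hs]

/-- The image under `f` is absolutely continuous, hence of bounded variation and differentiable
almost everywhere; the immersion carries this back to the manifold. -/
theorem ae_mdifferentiableAt_of_absolutelyContinuous {γ : ℝ → M} {a b : ℝ} (hab : a ≤ b)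
    (hγ : AbsolutelyContinuousOnInterval γ a b) :
    ∀ᵐ t ∂volume.restrict (Ioc a b), ContinuousAt γ t ∧ MDifferentiableAt 𝓘(ℝ, ℝ) (𝓡 n) γ t := by
  obtain ⟨K, hK⟩ := hf.lipschitz
  have h0 : AbsolutelyContinuousOnInterval (f ∘ γ) a b := hK.comp_absolutelyContinuousOnInterval hγ
  have h1 := h0.boundedVariationOn.ae_differentiableAt_of_mem_uIcc
  rw [uIcc_of_le hab] at h1
  have hcont : ContinuousOn γ (uIcc a b) :=
    continuousOn_of_absolutelyContinuousOnInterval hγ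
  rw [uIcc_of_le hab] at hcont
  rw [← restrict_Ioo_eq_restrict_Ioc, ae_restrict_iff' measurableSet_Ioo]
  filter_upwards [h1] with t ht hts
  have hc : ContinuousAt γ t := hcont.continuousAt (Icc_mem_nhds hts.1 hts.2)
  exact ⟨hc, (mdifferentiableAt_iff_comp hf hc).2 (ht ⟨hts.1.le, hts.2.le⟩)⟩

end Immersion

theorem apply_velocity_le (hH : IsTonelliHamiltonian H) {g : M → ℝ} {γ : ℝ → M} {t : ℝ}
    (hg : MDifferentiableAt (𝓡 n) 𝓘(ℝ, ℝ) g (γ t))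
    (hγ : MDifferentiableAt 𝓘(ℝ, ℝ) (𝓡 n) γ t) :
    deriv (g ∘ γ) t ≤ lagrangianAlong H γ t + H (γ t) (differential n g (γ t)) := by
  rw [(deriv_comp_eq_mdiff_velocity hg hγ).deriv]
  have := sub_le_lagrangian hH (γ t) (velocity n γ t) (differential n g (γ t))
  change differential n g (γ t) (velocity n γ t) ≤ _
  unfold lagrangianAlong
  linarith

end Curves


/-! ### Equi-absolute continuity from bounded action -/

section Tonelli

variable {n : ℕ} {M : Type*} [MetricSpace M] [ChartedSpace (EuclideanSpace ℝ (Fin n)) M]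
  [IsManifold (𝓡 n) ∞ M] [CompactSpace M]
  {F : Type*} [NormedAddCommGroup F] [NormedSpace ℝ F]
  [RiemannianBundle (fun x : M => TangentSpace (𝓡 n) x)]
  {H : ∀ x : M, Cotangent n x → ℝ}

/-- The running cost shifted by a constant, so as to be nonnegative. -/
noncomputable def shiftedCost (H : ∀ x : M, Cotangent n x → ℝ) (lam B : ℝ) (γ : ℝ → M) (t : ℝ) : ℝ :=
  Real.exp (-lam * t) * (lagrangianAlong H γ t + criticalValue H + B)

theorem shiftedCost_eq (lam B : ℝ) (γ : ℝ → M) (t : ℝ) :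
    shiftedCost H lam B γ t = runningCost H lam γ t + B * Real.exp (-lam * t) := by
  rw [shiftedCost, runningCost_eq]
  ring

theorem exists_lagrangian_bounds (hH : IsTonelliHamiltonian H) :
    ∃ B : ℝ, 0 ≤ B ∧ (∀ (x : M) (v : TangentSpace (𝓡 n) x),
      0 ≤ lagrangian H x v + criticalValue H + B) ∧
      ∀ x : M, lagrangian H x 0 + criticalValue H ≤ B := by
  obtain ⟨C, hC⟩ := exists_neg_le_lagrangian hH
  obtain ⟨D, hD⟩ := exists_lagrangian_zero_le hH
  have h1 := abs_le.1 (le_refl |criticalValue H|)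
  have hC0 := C.coe_nonneg
  have hD0 := D.coe_nonneg
  refine ⟨C + D + |criticalValue H|, by positivity, fun x v => ?_, fun x => ?_⟩
  · have := hC x v
    linarith [h1.1]
  · have := hD x
    linarith [h1.2]

theorem integrableOn_exp_neg_mul {lam : ℝ} (hlam : 0 < lam) :
    IntegrableOn (fun t : ℝ => Real.exp (-lam * t)) (Ioi 0) :=
  integrableOn_exp_mul_Ioi (by linarith) 0

theorem integral_exp_neg_mul {lam : ℝ} (hlam : 0 < lam) :
    ∫ t in Ioi (0 : ℝ), Real.exp (-lam * t) = 1 / lam := by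
  rw [integral_exp_mul_Ioi (by linarith)]
  simp [neg_div_neg_eq]

theorem exists_pullHamiltonian_le (hH : IsTonelliHamiltonian H) [FiniteDimensional ℝ F] {f : M → F}
    (hf : ContMDiff (𝓡 n) 𝓘(ℝ, F) 1 f) (A : ℝ) :
    ∃ C : ℝ, 0 ≤ C ∧ ∀ (x : M) (q : F →L[ℝ] ℝ), ‖q‖ ≤ A → pullHamiltonian H f x q ≤ C := by
  have : ProperSpace (F →L[ℝ] ℝ) := FiniteDimensional.proper ℝ _
  have hc : Continuous fun z : M × (F →L[ℝ] ℝ) => pullHamiltonian H f z.1 z.2 :=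
    continuous_iff_continuousAt.2 fun z => continuousAt_pullHamiltonian hH.continuous (hf z.1) z.2
  obtain ⟨C, hC⟩ := ((isCompact_univ (X := M)).prod (isCompact_closedBall (0 : F →L[ℝ] ℝ)
    A)).exists_bound_of_continuousOn hc.continuousOn
  refine ⟨max C 0, le_max_right _ _, fun x q hq => le_max_of_le_left ?_⟩
  exact (Real.le_norm_self _).trans (hC (x, q) ⟨mem_univ _, by simpa using hq⟩)

variable [FiniteDimensional ℝ F] {f : M → F} (hf : IsBiLipschitzImmersion n f)
  (hH : IsTonelliHamiltonian H) {lam B : ℝ} (hlam : 0 ≤ lam)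
  (hB : ∀ (x : M) (v : TangentSpace (𝓡 n) x), 0 ≤ lagrangian H x v + criticalValue H + B)

include hB in
theorem shiftedCost_nonneg (γ : ℝ → M) (t : ℝ) : 0 ≤ shiftedCost H lam B γ t :=
  mul_nonneg (Real.exp_nonneg _) (hB _ _)

include hf hH hlam hB

/-- Fenchel's inequality for the constant covector `q`, integrated in time. Nonnegativity of the
shifted Lagrangian allows the discount to be undone by the single factor e^{λt}. -/
theorem apply_sub_le_integral_shiftedCost {γ : ℝ → M} {s t : ℝ} (hst : s ≤ t)
    (hγ : AbsolutelyContinuousOnInterval γ s t)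
    (hi : IntervalIntegrable (shiftedCost H lam B γ) volume s t) {q : F →L[ℝ] ℝ} {h : ℝ}
    (hq : ∀ r ∈ Icc s t, pullHamiltonian H f (γ r) q ≤ h) :
    q (f (γ t)) - q (f (γ s)) ≤ Real.exp (lam * t) * (∫ r in s..t, shiftedCost H lam B γ r) +
      (h - criticalValue H - B) * (t - s) := by
  obtain ⟨K, hK⟩ := hf.lipschitz
  have hac : AbsolutelyContinuousOnInterval (q ∘ f ∘ γ) s t :=
    q.lipschitz.comp_absolutelyContinuousOnInterval (hK.comp_absolutelyContinuousOnInterval hγ)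
  have h1 : q (f (γ t)) - q (f (γ s)) = ∫ r in s..t, deriv (q ∘ f ∘ γ) r :=
    hac.integral_deriv_eq_sub.symm
  have h2 : Real.exp (lam * t) * (∫ r in s..t, shiftedCost H lam B γ r) +
      (h - criticalValue H - B) * (t - s) =
      ∫ r in s..t, (Real.exp (lam * t) * shiftedCost H lam B γ r + (h - criticalValue H - B)) := by
    rw [intervalIntegral.integral_add (hi.const_mul _) intervalIntegrable_const,
      intervalIntegral.integral_const_mul, intervalIntegral.integral_const, smul_eq_mul]
    ring
  rw [h1, h2]
  refine intervalIntegral.integral_mono_ae_restrict hst hac.intervalIntegrable_deriv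
    ((hi.const_mul _).add intervalIntegrable_const) ?_
  have hae := ae_mdifferentiableAt_of_absolutelyContinuous hf hst hγ
  rw [← restrict_Ioo_eq_restrict_Ioc] at hae
  rw [← restrict_Ioo_eq_restrict_Icc]
  filter_upwards [hae, ae_restrict_mem measurableSet_Ioo] with r hr hrs
  have hd : HasDerivAt (q ∘ f ∘ γ) (q (deriv (f ∘ γ) r)) r :=
    q.hasFDerivAt.comp_hasDerivAt r ((mdifferentiableAt_iff_comp hf hr.1).1 hr.2).hasDerivAt
  rw [hd.deriv]
  have h3 : q (deriv (f ∘ γ) r) - pullHamiltonian H f (γ r) q ≤ lagrangianAlong H γ r := by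
    rw [lagrangianAlong_eq_iSup hf hr.1]
    exact le_ciSup (bddAbove_conjugate_along hf hH hr.1) q
  have h4 := hq r ⟨hrs.1.le, hrs.2.le⟩
  have h5 : lagrangianAlong H γ r + criticalValue H + B ≤
      Real.exp (lam * t) * shiftedCost H lam B γ r := by
    rw [shiftedCost, ← mul_assoc, ← Real.exp_add]
    refine le_mul_of_one_le_left (hB _ _) (Real.one_le_exp ?_)
    nlinarith [hrs.2]
  linarith

/-- Curves of bounded action have a common modulus of absolute continuity. -/
theorem exists_dist_le_integral_shiftedCost (T : ℝ) {ε : ℝ} (hε : 0 < ε) :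
    ∃ C : ℝ, 0 ≤ C ∧ ∀ γ : ℝ → M, AbsolutelyContinuousOnInterval γ 0 T →
      IntegrableOn (shiftedCost H lam B γ) (Ioc 0 T) → ∀ s t : ℝ, s ∈ Icc 0 T → t ∈ Icc 0 T →
        dist (γ s) (γ t) ≤ ε * (∫ r in uIoc s t, shiftedCost H lam B γ r) + C * dist s t := by
  obtain ⟨K, hK⟩ := hf.antilipschitz
  -- The size of the test covector is tuned so that the action enters the final estimate with
  -- coefficient exactly `ε`; the Hamiltonian is bounded on covectors of that size.
  set A : ℝ := (K + 1) * Real.exp (lam * T) / ε with hA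
  have hA0 : 0 < A := by positivity
  obtain ⟨D, hD0, hD⟩ := exists_pullHamiltonian_le hH hf.contMDiff A
  refine ⟨(K + 1) / A * |D - criticalValue H - B|, by positivity, fun γ hγ hi => ?_⟩
  have key : ∀ s t : ℝ, s ∈ Icc 0 T → t ∈ Icc 0 T → s ≤ t → dist (γ s) (γ t) ≤
      ε * (∫ r in uIoc s t, shiftedCost H lam B γ r) +
      (K + 1) / A * |D - criticalValue H - B| * dist s t := by
    intro s t hs ht hst
    have h0T : (0 : ℝ) ≤ T := hs.1.trans hs.2
    -- A functional norming the displacement converts the covector estimate into a bound on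
    -- distance.
    obtain ⟨q, hq1, hq2⟩ := exists_dual_vector'' ℝ (f (γ t) - f (γ s))
    have hsub : uIcc s t ⊆ uIcc 0 T := by
      rw [uIcc_of_le hst, uIcc_of_le h0T]
      exact Icc_subset_Icc hs.1 ht.2
    have hii : IntervalIntegrable (shiftedCost H lam B γ) volume s t := by
      rw [intervalIntegrable_iff_integrableOn_Ioc_of_le hst]
      exact hi.mono_set (Ioc_subset_Ioc hs.1 ht.2)
    have h1 := apply_sub_le_integral_shiftedCost hf hH hlam hB hst (hγ.mono hsub) hii (q := A • q)
      (h := D) (fun r _ => hD _ _ (by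
        rw [norm_smul, Real.norm_of_nonneg hA0.le]
        exact mul_le_of_le_one_right hA0.le hq1))
    have h2 : (A • q) (f (γ t)) - (A • q) (f (γ s)) = A * dist (f (γ s)) (f (γ t)) := by
      have : q (f (γ t)) - q (f (γ s)) = ‖f (γ t) - f (γ s)‖ := by rw [← map_sub]; exact hq2
      simp only [smul_apply, smul_eq_mul]
      rw [← mul_sub, this, dist_comm, dist_eq_norm]
    rw [h2] at h1
    have h3 : dist (γ s) (γ t) ≤ (K + 1) * dist (f (γ s)) (f (γ t)) :=
      (hK.le_mul_dist _ _).trans (by gcongr; simp)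
    rw [uIoc_of_le hst, ← intervalIntegral.integral_of_le hst, Real.dist_eq, abs_sub_comm s t,
      abs_of_nonneg (sub_nonneg.2 hst)]
    have hpos : 0 ≤ ∫ r in s..t, shiftedCost H lam B γ r :=
      intervalIntegral.integral_nonneg hst fun r _ => shiftedCost_nonneg hB γ r
    have h4 : Real.exp (lam * t) ≤ Real.exp (lam * T) :=
      Real.exp_le_exp.2 (mul_le_mul_of_nonneg_left ht.2 hlam)
    have h5 : A * dist (f (γ s)) (f (γ t)) ≤
        Real.exp (lam * T) * (∫ r in s..t, shiftedCost H lam B γ r) +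
        |D - criticalValue H - B| * (t - s) := by
      refine h1.trans (add_le_add (mul_le_mul_of_nonneg_right h4 hpos) ?_)
      exact mul_le_mul_of_nonneg_right (le_abs_self _) (sub_nonneg.2 hst)
    have h6 : (K + 1 : ℝ) / A * Real.exp (lam * T) = ε := by
      rw [hA]; field_simp
    calc dist (γ s) (γ t) ≤ (K + 1) / A * (A * dist (f (γ s)) (f (γ t))) := by
          refine h3.trans (le_of_eq ?_); field_simp
      _ ≤ (K + 1) / A * (Real.exp (lam * T) * (∫ r in s..t, shiftedCost H lam B γ r) +
        |D - criticalValue H - B| * (t - s)) := by gcongr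
      _ = (K + 1) / A * Real.exp (lam * T) * (∫ r in s..t, shiftedCost H lam B γ r) +
        (K + 1) / A * |D - criticalValue H - B| * (t - s) := by ring
      _ = _ := by rw [h6]
  intro s t hs ht
  rcases le_total s t with hst | hst
  · exact key s t hs ht hst
  · have := key t s ht hs hst
    rwa [uIoc_comm, dist_comm, dist_comm t s] at this

end Tonelli


/-! ### Compactness and lower semicontinuity of the action -/

section Existence

variable {n : ℕ} {M : Type*} [MetricSpace M] [ChartedSpace (EuclideanSpace ℝ (Fin n)) M]
  [IsManifold (𝓡 n) ∞ M] [CompactSpace M]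
  {F : Type*} [NormedAddCommGroup F] [NormedSpace ℝ F]
  [RiemannianBundle (fun x : M => TangentSpace (𝓡 n) x)]
  {H : ∀ x : M, Cotangent n x → ℝ}
  [FiniteDimensional ℝ F] {f : M → F} (hf : IsBiLipschitzImmersion n f)
  (hH : IsTonelliHamiltonian H) {lam B : ℝ} (hlam : 0 ≤ lam)
  (hB : ∀ (x : M) (v : TangentSpace (𝓡 n) x), 0 ≤ lagrangian H x v + criticalValue H + B)

include hf hH hlam hB

/-- The quantitative form of absolute continuity satisfied by curves of bounded action. -/
theorem exists_sum_dist_le {T : ℝ} (hT : 0 ≤ T) {ε : ℝ} (hε : 0 < ε) :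
    ∃ C : ℝ, 0 ≤ C ∧ ∀ γ : ℝ → M, AbsolutelyContinuousOnInterval γ 0 T →
      IntegrableOn (shiftedCost H lam B γ) (Ioc 0 T) →
      ∀ E ∈ AbsolutelyContinuousOnInterval.disjWithin 0 T,
        ∑ i ∈ Finset.range E.1, dist (γ (E.2 i).1) (γ (E.2 i).2) ≤
          ε * (∫ r in uIoc 0 T, shiftedCost H lam B γ r) +
            C * ∑ i ∈ Finset.range E.1, dist (E.2 i).1 (E.2 i).2 := by
  obtain ⟨C, hC0, hC⟩ := exists_dist_le_integral_shiftedCost hf hH hlam hB T hε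
  refine ⟨C, hC0, fun γ hγ hi E hE => ?_⟩
  have hE1 := hE.1
  rw [uIcc_of_le hT] at hE1
  have hsub : ∀ i ∈ Finset.range E.1, uIoc (E.2 i).1 (E.2 i).2 ⊆ Ioc 0 T := by
    intro i hi r hr
    have := hE1 i hi
    simp only [mem_uIoc, mem_Icc, mem_Ioc] at *
    grind
  calc _ ≤ ∑ i ∈ Finset.range E.1, (ε * (∫ r in uIoc (E.2 i).1 (E.2 i).2, shiftedCost H lam B γ r) +
        C * dist (E.2 i).1 (E.2 i).2) :=
        Finset.sum_le_sum fun i hi' => hC γ hγ hi _ _ (hE1 i hi').1 (hE1 i hi').2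
    _ = ε * (∫ r in ⋃ i ∈ Finset.range E.1, uIoc (E.2 i).1 (E.2 i).2, shiftedCost H lam B γ r) +
        C * ∑ i ∈ Finset.range E.1, dist (E.2 i).1 (E.2 i).2 := by
        rw [Finset.sum_add_distrib, ← Finset.mul_sum, ← Finset.mul_sum, integral_biUnion_finset _
          (fun i _ => measurableSet_uIoc) (fun i hi j hj hij => hE.2 hi hj hij)
          (fun i hi' => hi.mono_set (hsub i hi'))]
    _ ≤ _ := by
        gcongr ?_ * ?_ + _
        rw [uIoc_of_le hT]
        exact setIntegral_mono_set hi (ae_of_all _ fun r => shiftedCost_nonneg hB γ r)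
          (Set.iUnion₂_subset hsub).eventuallyLE

/-- Lower semicontinuity and compactness for the discounted action. -/
theorem exists_limit_curve {x : M} {γ : ℕ → ℝ → M}
    (hγ : ∀ k, IsForwardCurve x (γ k))
    (hi : ∀ k, IntegrableOn (shiftedCost H lam B (γ k)) (Ioi 0)) {E : ℕ → ℝ} {E₀ E₁ : ℝ}
    (hE : ∀ k, ∫ t in Ioi 0, shiftedCost H lam B (γ k) t ≤ E k) (hE₀ : ∀ k, E k ≤ E₀)
    (hE₁ : Tendsto E atTop (𝓝 E₁)) :
    ∃ η : ℝ → M, IsForwardCurve x η ∧ IntegrableOn (shiftedCost H lam B η) (Ioi 0) ∧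
      ∫ t in Ioi 0, shiftedCost H lam B η t ≤ E₁ := by
  -- Limits along a free ultrafilter exist at every time simultaneously and replace the extraction
  -- of subsequences for curves and cumulative costs.
  set U : Ultrafilter ℕ := hyperfilter ℕ with hU
  have hUt : (U : Filter ℕ) ≤ atTop := Nat.hyperfilter_le_atTop
  -- The cumulative cost, frozen at negative times so as to be monotone on the whole line.
  set S : ℕ → ℝ → ℝ := fun k t => ∫ r in (0 : ℝ)..(max t 0), shiftedCost H lam B (γ k) r with hS
  have hii : ∀ k a b, 0 ≤ a → 0 ≤ b → IntervalIntegrable (shiftedCost H lam B (γ k)) volume a b :=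
    fun k a b ha hb => intervalIntegrable_iff.2 ((hi k).mono_set fun r hr => by
      simp only [mem_uIoc, mem_Ioi] at *; grind)
  have hSsub : ∀ k s t, 0 ≤ s → 0 ≤ t → S k t - S k s = ∫ r in s..t, shiftedCost H lam B (γ k) r := by
    intro k s t hs ht
    simp only [hS, max_eq_left hs, max_eq_left ht]
    exact intervalIntegral.integral_interval_sub_left (hii k 0 t le_rfl ht) (hii k 0 s le_rfl hs)
  have hSmono : ∀ k, Monotone (S k) := by
    intro k s t hst
    refine intervalIntegral.integral_mono_interval le_rfl (le_max_right _ _)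
      (max_le_max_right _ hst) (ae_of_all _ fun r => shiftedCost_nonneg hB _ r)
      (hii k _ _ le_rfl (le_max_right _ _))
  have hS0 : ∀ k t, 0 ≤ S k t := fun k t =>
    intervalIntegral.integral_nonneg (le_max_right _ _) fun r _ => shiftedCost_nonneg hB _ r
  have hSE : ∀ k t, S k t ≤ E k := by
    intro k t
    refine le_trans ?_ (hE k)
    simp only [hS]
    rw [intervalIntegral.integral_of_le (le_max_right _ _)]
    exact setIntegral_mono_set (hi k) (ae_of_all _ fun r => shiftedCost_nonneg hB _ r)
      Ioc_subset_Ioi_self.eventuallyLE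
  have hη : ∀ t, ∃ y, Tendsto (fun k => γ k t) U (𝓝 y) := fun t =>
    ⟨_, (U.map fun k => γ k t).le_nhds_lim⟩
  choose η hη using hη
  have hσ : ∀ t, ∃ y, Tendsto (fun k => S k t) U (𝓝 y) := by
    intro t
    obtain ⟨y, -, hy⟩ := (isCompact_Icc (a := (0 : ℝ)) (b := E₀)).ultrafilter_le_nhds'
      (U.map fun k => S k t) (Filter.Eventually.of_forall (f := (U : Filter ℕ))
        fun k => ⟨hS0 k t, (hSE k t).trans (hE₀ k)⟩)
    exact ⟨y, hy⟩
  choose σ hσ using hσ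
  have hσmono : Monotone σ := fun s t hst =>
    le_of_tendsto_of_tendsto' (hσ s) (hσ t) fun k => hSmono k hst
  have hσ0 : 0 ≤ σ 0 := ge_of_tendsto' (hσ 0) fun k => hS0 k 0
  have hσE : ∀ t, σ t ≤ E₁ := fun t =>
    le_of_tendsto_of_tendsto' (hσ t) (hE₁.mono_left hUt) fun k => hSE k t
  have hE₀0 : 0 ≤ E₀ := ((hS0 0 0).trans (hSE 0 0)).trans (hE₀ 0)
  have hη0 : η 0 = x := tendsto_nhds_unique (hη 0) (by simp [(hγ _).1])
  have hac : ∀ T, 0 ≤ T → AbsolutelyContinuousOnInterval η 0 T := by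
    intro T hT
    rw [absolutelyContinuousOnInterval_iff]
    intro ε hε
    -- The uniform modulus passes to the limit sums; the constants make the action term and the
    -- length term at most ε/4 each.
    obtain ⟨C, hC0, hC⟩ := exists_sum_dist_le hf hH hlam hB hT
      (ε := ε / (4 * (E₀ + 1))) (by positivity)
    refine ⟨ε / (4 * (C + 1)), by positivity, fun I hI hlt => ?_⟩
    have h1 : Tendsto (fun k => ∑ i ∈ Finset.range I.1, dist (γ k (I.2 i).1) (γ k (I.2 i).2)) U
        (𝓝 (∑ i ∈ Finset.range I.1, dist (η (I.2 i).1) (η (I.2 i).2))) :=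
      tendsto_finsetSum _ fun i _ => (hη _).dist (hη _)
    refine lt_of_le_of_lt (le_of_tendsto' (b := ε / 4 + ε / 4) h1 fun k => ?_) (by linarith)
    refine (hC (γ k) ((hγ k).2 T hT) ((hi k).mono_set Ioc_subset_Ioi_self) I hI).trans
      (add_le_add ?_ ?_)
    · have : ∫ r in uIoc 0 T, shiftedCost H lam B (γ k) r ≤ E₀ := by
        have h2 := (hSE k T).trans (hE₀ k)
        simp only [hS, max_eq_left hT] at h2
        rwa [uIoc_of_le hT, ← intervalIntegral.integral_of_le hT]
      calc _ ≤ ε / (4 * (E₀ + 1)) * (E₀ + 1) := by gcongr; linarith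
        _ = ε / 4 := by field_simp
    · calc _ ≤ (C + 1) * (ε / (4 * (C + 1))) := by gcongr; linarith
        _ = ε / 4 := by field_simp
  have hcont : ∀ t, 0 < t → ContinuousAt η t := by
    intro t ht
    have h1 := continuousOn_of_absolutelyContinuousOnInterval (hac (t + 1) (by linarith))
    rw [uIcc_of_le (by linarith)] at h1
    exact h1.continuousAt (Icc_mem_nhds ht (by linarith))
  have hder : ∀ t, 0 < t → DifferentiableAt ℝ σ t → MDifferentiableAt 𝓘(ℝ, ℝ) (𝓡 n) η t →
      shiftedCost H lam B η t ≤ deriv σ t := by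
    intro t ht hσd hηd
    have hfd := ((mdifferentiableAt_iff_comp hf (hcont t ht)).1 hηd).hasDerivAt
    -- The integrated Fenchel inequality for the `γ k` on [t, s] is passed to the limit, then
    -- divided by s - t. Only a constant covector is involved, so convergence of velocities is not
    -- needed.
    have key : ∀ (q : F →L[ℝ] ℝ) (h : ℝ), pullHamiltonian H f (η t) q < h →
        q (deriv (f ∘ η) t) ≤ Real.exp (lam * t) * deriv σ t + (h - criticalValue H - B) := by
      intro q h hqh
      have hc : ContinuousAt (fun y => pullHamiltonian H f y q) (η t) :=
        ContinuousAt.comp (f := fun y => (y, q))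
          (continuousAt_pullHamiltonian hH.continuous (hf.contMDiff (η t)) q) (by fun_prop)
      obtain ⟨ρ, hρ, hρh⟩ := Metric.eventually_nhds_iff.1 (hc.eventually (Iio_mem_nhds hqh))
      -- The modulus keeps `γ k` on [t, s] within 3ρ/4 of `η t` for `U`-almost every `k`: a quarter
      -- each from the action, the elapsed time and the convergence at `t`. There the Hamiltonian
      -- stays below `h`.
      obtain ⟨C, hC0, hC⟩ := exists_dist_le_integral_shiftedCost hf hH hlam hB (t + 1)
        (ε := ρ / (4 * (E₀ + 1))) (by positivity)
      have hineq : ∀ᶠ s in 𝓝[>] t, q (f (η s)) - q (f (η t)) ≤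
          Real.exp (lam * s) * (σ s - σ t) + (h - criticalValue H - B) * (s - t) := by
        have hlt : t < min (t + 1) (t + ρ / (4 * (C + 1))) :=
          lt_min (by linarith) (by linarith [show 0 < ρ / (4 * (C + 1)) by positivity])
        filter_upwards [Ioo_mem_nhdsGT hlt] with s hs
        have hs1 : s < t + 1 := hs.2.trans_le (min_le_left _ _)
        have hs2 : s < t + ρ / (4 * (C + 1)) := hs.2.trans_le (min_le_right _ _)
        have hfc := hf.contMDiff.continuous
        have l1 : Tendsto (fun k => q (f (γ k s)) - q (f (γ k t))) U
            (𝓝 (q (f (η s)) - q (f (η t)))) :=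
          (((q.continuous.comp hfc).tendsto _).comp (hη s)).sub
            (((q.continuous.comp hfc).tendsto _).comp (hη t))
        have l2 := (((hσ s).sub (hσ t)).const_mul (Real.exp (lam * s))).add_const
          ((h - criticalValue H - B) * (s - t))
        refine le_of_tendsto_of_tendsto l1 l2 ?_
        filter_upwards [(hη t).eventually (Metric.ball_mem_nhds _ (ε := ρ / 4) (by positivity))]
          with k hk
        rw [hSsub k t s ht.le (ht.trans hs.1).le]
        refine apply_sub_le_integral_shiftedCost hf hH hlam hB hs.1.le
          (((hγ k).2 (t + 1) (by linarith)).mono ?_) (hii k _ _ ht.le (ht.trans hs.1).le) ?_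
        · rw [uIcc_of_le hs.1.le, uIcc_of_le (by linarith)]
          exact Icc_subset_Icc ht.le hs1.le
        · intro r hr
          refine (hρh ?_).le
          have h1 := hC (γ k) ((hγ k).2 (t + 1) (by linarith))
            ((hi k).mono_set Ioc_subset_Ioi_self) r t ⟨by linarith [hr.1], by linarith [hr.2]⟩
            ⟨ht.le, by linarith⟩
          have h2 : ∫ r in uIoc r t, shiftedCost H lam B (γ k) r ≤ E₀ := by
            rw [uIoc_comm, uIoc_of_le hr.1, ← intervalIntegral.integral_of_le hr.1,
              ← hSsub k t r ht.le (by linarith [hr.1])]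
            linarith [hS0 k t, hSE k r, hE₀ k]
          have h3 : ρ / (4 * (E₀ + 1)) * ∫ r in uIoc r t, shiftedCost H lam B (γ k) r ≤ ρ / 4 := by
            calc _ ≤ ρ / (4 * (E₀ + 1)) * (E₀ + 1) := by gcongr; linarith
              _ = ρ / 4 := by field_simp
          have h4 : C * dist r t ≤ ρ / 4 := by
            calc _ ≤ (C + 1) * (ρ / (4 * (C + 1))) := by
                  gcongr
                  · linarith
                  · rw [Real.dist_eq, abs_of_nonneg (by linarith [hr.1])]
                    linarith [hr.2]
              _ = ρ / 4 := by field_simp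
          have h5 : dist (γ k t) (η t) < ρ / 4 := hk
          linarith [dist_triangle (γ k r) (γ k t) (η t)]
      have d1 : Tendsto (slope (q ∘ f ∘ η) t) (𝓝[>] t) (𝓝 (q (deriv (f ∘ η) t))) :=
        (hasDerivAt_iff_tendsto_slope.1 (q.hasFDerivAt.comp_hasDerivAt t hfd)).mono_left
          (nhdsWithin_mono _ fun s hs => ne_of_gt hs)
      have d2 : Tendsto (slope σ t) (𝓝[>] t) (𝓝 (deriv σ t)) :=
        (hasDerivAt_iff_tendsto_slope.1 hσd.hasDerivAt).mono_left
          (nhdsWithin_mono _ fun s hs => ne_of_gt hs)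
      have d3 : Tendsto (fun s => Real.exp (lam * s)) (𝓝[>] t) (𝓝 (Real.exp (lam * t))) :=
        (Continuous.tendsto (by fun_prop) t).mono_left nhdsWithin_le_nhds
      refine le_of_tendsto_of_tendsto d1 ((d3.mul d2).add_const (h - criticalValue H - B)) ?_
      filter_upwards [hineq, self_mem_nhdsWithin] with s hs hst
      have hst' : 0 < s - t := sub_pos.2 hst
      simp only [slope_def_field, Function.comp_apply]
      rw [div_le_iff₀ hst']
      refine hs.trans (le_of_eq ?_)
      field_simp
    rw [shiftedCost]
    have h1 : lagrangianAlong H η t ≤ Real.exp (lam * t) * deriv σ t - criticalValue H - B := by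
      rw [lagrangianAlong_eq_iSup hf (hcont t ht)]
      refine ciSup_le fun q => le_of_forall_pos_le_add fun e he => ?_
      linarith [key q (pullHamiltonian H f (η t) q + e) (by linarith)]
    calc _ ≤ Real.exp (-lam * t) * (Real.exp (lam * t) * deriv σ t) := by
          gcongr
          linarith
      _ = deriv σ t := by rw [← mul_assoc, ← Real.exp_add]; simp
  have hT : ∀ T, 0 ≤ T → IntegrableOn (shiftedCost H lam B η) (Ioc 0 T) ∧
      ∫ t in (0 : ℝ)..T, shiftedCost H lam B η t ≤ E₁ := by
    intro T hT
    have hle : ∀ᵐ t ∂volume.restrict (Ioc 0 T), shiftedCost H lam B η t ≤ deriv σ t := by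
      filter_upwards [ae_mdifferentiableAt_of_absolutelyContinuous hf hT (hac T hT),
        ae_restrict_of_ae hσmono.ae_differentiableAt, ae_restrict_mem measurableSet_Ioc]
        with t h1 h2 h3
      exact hder t h3.1 h2 h1.2
    have hm : AEStronglyMeasurable (shiftedCost H lam B η) (volume.restrict (Ioc 0 T)) := by
      have hcη := continuousOn_of_absolutelyContinuousOnInterval (hac T hT)
      rw [uIcc_of_le hT] at hcη
      refine AEStronglyMeasurable.mul (Continuous.aestronglyMeasurable (by fun_prop)) ?_
      exact ((aestronglyMeasurable_lagrangianAlong hf hH hcη).add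
        aestronglyMeasurable_const).add aestronglyMeasurable_const
    have hd := (hσmono.monotoneOn (uIcc 0 T)).intervalIntegrable_deriv
    have hd' := (intervalIntegrable_iff_integrableOn_Ioc_of_le hT).1 hd
    have hint : IntegrableOn (shiftedCost H lam B η) (Ioc 0 T) := by
      refine hd'.mono' hm ?_
      filter_upwards [hle] with t ht
      rwa [Real.norm_of_nonneg (shiftedCost_nonneg hB _ _)]
    refine ⟨hint, ?_⟩
    have h1 : ∫ t in (0 : ℝ)..T, shiftedCost H lam B η t ≤ ∫ t in (0 : ℝ)..T, deriv σ t := by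
      rw [intervalIntegral.integral_of_le hT, intervalIntegral.integral_of_le hT]
      exact integral_mono_ae hint hd' hle
    -- A monotone function increases at least by the integral of its derivative; jumps or a singular
    -- part of the limit cost act in the favourable direction.
    have h2 := (hσmono.monotoneOn (uIcc 0 T)).intervalIntegral_deriv_mem_uIcc
    rw [uIcc_of_le (sub_nonneg.2 (hσmono hT))] at h2
    linarith [h2.2, hσE T]
  have hint : IntegrableOn (shiftedCost H lam B η) (Ioi 0) := by
    refine integrableOn_Ioi_of_intervalIntegral_norm_bounded E₁ 0 (b := fun k : ℕ => (k : ℝ))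
      (fun k => (hT k k.cast_nonneg).1) tendsto_natCast_atTop_atTop
      (Filter.Eventually.of_forall fun k => ?_)
    refine le_trans (le_of_eq ?_) (hT k k.cast_nonneg).2
    refine intervalIntegral.integral_congr fun t _ => ?_
    exact Real.norm_of_nonneg (shiftedCost_nonneg hB _ _)
  refine ⟨η, ⟨hη0, hac⟩, hint, ?_⟩
  exact le_of_tendsto' (intervalIntegral_tendsto_integral_Ioi 0 hint
    (tendsto_natCast_atTop_atTop (R := ℝ))) fun k : ℕ => (hT k k.cast_nonneg).2

end Existence


/-! ### Translation of half-line integrals -/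

section Shift

variable {E : Type*} [NormedAddCommGroup E] [NormedSpace ℝ E]

theorem integrableOn_Ioi_comp_add_right_iff (g : ℝ → E) (a c : ℝ) :
    IntegrableOn (fun t => g (t + c)) (Ioi a) ↔ IntegrableOn g (Ioi (a + c)) := by
  have h := (measurePreserving_add_right (volume : Measure ℝ) c).integrableOn_comp_preimage
    (Homeomorph.addRight c).measurableEmbedding (f := g) (s := Ioi (a + c))
  simpa [Function.comp_def] using h

theorem setIntegral_Ioi_comp_add_right (g : ℝ → E) (a c : ℝ) :
    ∫ t in Ioi a, g (t + c) = ∫ t in Ioi (a + c), g t := by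
  have h := (measurePreserving_add_right (volume : Measure ℝ) c).setIntegral_preimage_emb
    (Homeomorph.addRight c).measurableEmbedding g (Ioi (a + c))
  simpa using h

end Shift

/-! ### The value function and dynamic programming -/

section Value

variable {n : ℕ} {M : Type*} [MetricSpace M] [ChartedSpace (EuclideanSpace ℝ (Fin n)) M]
  [IsManifold (𝓡 n) ∞ M] [CompactSpace M]
  {F : Type*} [NormedAddCommGroup F] [NormedSpace ℝ F]
  [RiemannianBundle (fun x : M => TangentSpace (𝓡 n) x)]
  {H : ∀ x : M, Cotangent n x → ℝ} {lam B : ℝ}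

/-- The value function `-u_λ^+`. -/
noncomputable def valueFunction (H : ∀ x : M, Cotangent n x → ℝ) (lam : ℝ) (x : M) : ℝ :=
  sInf (actionValues H lam x)

theorem IsForwardCurve.continuousAt {x : M} {γ : ℝ → M} (hγ : IsForwardCurve x γ) {t : ℝ}
    (ht : 0 < t) : ContinuousAt γ t := by
  have h1 := continuousOn_of_absolutelyContinuousOnInterval (hγ.2 (t + 1) (by linarith))
  rw [uIcc_of_le (by linarith)] at h1
  exact h1.continuousAt (Icc_mem_nhds ht (by linarith))

theorem isForwardCurve_const (x : M) : IsForwardCurve x fun _ => x := by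
  refine ⟨rfl, fun T _ => ?_⟩
  rw [absolutelyContinuousOnInterval_iff]
  intro ε hε
  exact ⟨1, one_pos, fun E _ _ => by simpa using hε⟩

theorem runningCost_const (x : M) (t : ℝ) :
    runningCost H lam (fun _ => x) t =
      Real.exp (-lam * t) * (lagrangian H x 0 + criticalValue H) := by
  have : velocity n (fun _ : ℝ => x) t = 0 := by
    unfold velocity
    rw [mfderiv_const]
    rfl
  rw [runningCost, this]

variable (hlam : 0 < lam)

include hlam

theorem integrableOn_runningCost_const (x : M) :
    IntegrableOn (runningCost H lam fun _ => x) (Ioi 0) := by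
  have : IntegrableOn (fun t => Real.exp (-lam * t) * (lagrangian H x 0 + criticalValue H))
      (Ioi 0) := (integrableOn_exp_neg_mul hlam).mul_const _
  exact this.congr_fun (fun t _ => (runningCost_const x t).symm) measurableSet_Ioi

theorem discountedAction_const (x : M) :
    discountedAction H lam (fun _ => x) = 1 / lam * (lagrangian H x 0 + criticalValue H) := by
  unfold discountedAction
  simp only [runningCost_const]
  rw [integral_mul_const, integral_exp_neg_mul hlam]

theorem actionValues_nonempty (x : M) : (actionValues H lam x).Nonempty :=
  ⟨_, _, isForwardCurve_const x, integrableOn_runningCost_const hlam x, rfl⟩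

theorem integrableOn_shiftedCost_iff {γ : ℝ → M} :
    IntegrableOn (shiftedCost H lam B γ) (Ioi 0) ↔ IntegrableOn (runningCost H lam γ) (Ioi 0) := by
  have he := (integrableOn_exp_neg_mul hlam).const_mul B
  have e1 : shiftedCost H lam B γ = fun t => runningCost H lam γ t + B * Real.exp (-lam * t) :=
    funext (shiftedCost_eq _ _ _)
  have e2 : runningCost H lam γ = fun t => shiftedCost H lam B γ t - B * Real.exp (-lam * t) := by
    rw [e1]
    simp
  refine ⟨fun h => ?_, fun h => ?_⟩
  · rw [e2]
    exact h.sub he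
  · rw [e1]
    exact h.add he

theorem integral_shiftedCost {γ : ℝ → M} (h : IntegrableOn (runningCost H lam γ) (Ioi 0)) :
    ∫ t in Ioi 0, shiftedCost H lam B γ t = discountedAction H lam γ + B / lam := by
  simp only [shiftedCost_eq]
  rw [integral_add h ((integrableOn_exp_neg_mul hlam).const_mul B), integral_const_mul,
    integral_exp_neg_mul hlam, discountedAction]
  ring

theorem neg_div_le_discountedAction
    (hB : ∀ (x : M) (v : TangentSpace (𝓡 n) x), 0 ≤ lagrangian H x v + criticalValue H + B)
    {γ : ℝ → M} (h : IntegrableOn (runningCost H lam γ) (Ioi 0)) :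
    -(B / lam) ≤ discountedAction H lam γ := by
  have h1 := integral_shiftedCost (B := B) hlam h
  have h2 : 0 ≤ ∫ t in Ioi 0, shiftedCost H lam B γ t :=
    integral_nonneg fun t => shiftedCost_nonneg hB γ t
  linarith

variable (hH : IsTonelliHamiltonian H)

include hH

theorem bddBelow_actionValues (x : M) : BddBelow (actionValues H lam x) := by
  obtain ⟨B, -, hB, -⟩ := exists_lagrangian_bounds hH
  refine ⟨-(B / lam), ?_⟩
  rintro _ ⟨γ, -, hi, rfl⟩
  exact neg_div_le_discountedAction hlam hB hi

theorem valueFunction_le {x : M} {γ : ℝ → M} (hγ : IsForwardCurve x γ)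
    (hi : IntegrableOn (runningCost H lam γ) (Ioi 0)) :
    valueFunction H lam x ≤ discountedAction H lam γ :=
  csInf_le (bddBelow_actionValues hlam hH x) ⟨γ, hγ, hi, rfl⟩

omit hlam in
/-- The value function multiplied by the discount is bounded uniformly in the discount. -/
theorem exists_abs_mul_valueFunction_le :
    ∃ B : ℝ, 0 ≤ B ∧ ∀ lam : ℝ, 0 < lam → ∀ x, |lam * valueFunction H lam x| ≤ B := by
  obtain ⟨B, hB0, hB, hB'⟩ := exists_lagrangian_bounds hH
  refine ⟨B, hB0, fun lam hlam x => abs_le.2 ⟨?_, ?_⟩⟩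
  · have h : -(B / lam) ≤ valueFunction H lam x := by
      refine le_csInf (actionValues_nonempty hlam x) ?_
      rintro _ ⟨γ, -, hi, rfl⟩
      exact neg_div_le_discountedAction hlam hB hi
    calc -B = lam * -(B / lam) := by field_simp
      _ ≤ _ := by gcongr
  · have h := valueFunction_le hlam hH (isForwardCurve_const x)
      (integrableOn_runningCost_const hlam x)
    rw [discountedAction_const hlam] at h
    calc _ ≤ lam * (1 / lam * (lagrangian H x 0 + criticalValue H)) := by gcongr
      _ = lagrangian H x 0 + criticalValue H := by field_simp
      _ ≤ B := hB' x

variable [FiniteDimensional ℝ F] {f : M → F} (hf : IsBiLipschitzImmersion n f)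

include hf

/-- The direct method. The minimizing sequence of values decreases, so its first term bounds all the
actions. -/
theorem exists_isForwardMinimizer (x : M) : ∃ γ : ℝ → M, IsForwardMinimizer H lam x γ := by
  obtain ⟨B, hB0, hB, -⟩ := exists_lagrangian_bounds hH
  obtain ⟨a, ha, hat, hmem⟩ := exists_seq_tendsto_sInf (actionValues_nonempty (H := H) hlam x)
    (bddBelow_actionValues hlam hH x)
  choose γ hγ hi hA using hmem
  obtain ⟨η, hη, hηi, hηle⟩ := exists_limit_curve hf hH hlam.le hB (E := fun k => a k + B / lam)
    (E₀ := a 0 + B / lam) hγ (fun k => (integrableOn_shiftedCost_iff hlam).2 (hi k))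
    (fun k => by rw [integral_shiftedCost hlam (hi k), hA k])
    (fun k => by simpa using ha (Nat.zero_le k)) (hat.add_const _)
  have hηr := (integrableOn_shiftedCost_iff hlam).1 hηi
  rw [integral_shiftedCost hlam hηr] at hηle
  refine ⟨η, hη, hηr, ⟨η, hη, hηr, rfl⟩, fun A hA => ?_⟩
  have := csInf_le (bddBelow_actionValues hlam hH x) hA
  linarith

omit hlam hH in
theorem runningCost_comp_add_const {γ : ℝ → M} {t c : ℝ} (hγ : ContinuousAt γ (t + c)) :
    runningCost H lam (fun s => γ (s + c)) t =
      Real.exp (lam * c) * runningCost H lam γ (t + c) := by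
  rw [runningCost_eq, runningCost_eq, lagrangianAlong_comp_add_const hf hγ, ← mul_assoc,
    ← Real.exp_add]
  ring_nf

omit hlam hH in
theorem runningCost_congr {γ η : ℝ → M} {t : ℝ} (hγ : ContinuousAt γ t) (h : γ =ᶠ[𝓝 t] η) :
    runningCost H lam γ t = runningCost H lam η t := by
  rw [runningCost_eq, runningCost_eq, lagrangianAlong_congr hf hγ h]

/-- Dynamic programming: the inequality between the value function and the action of curves. -/
theorem valueFunction_sub_le {a b : ℝ} (hab : a ≤ b) {γ : ℝ → M}
    (hγ : AbsolutelyContinuousOnInterval γ a b)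
    (hi : IntervalIntegrable (runningCost H lam γ) volume a b) :
    Real.exp (-lam * a) * valueFunction H lam (γ a) -
      Real.exp (-lam * b) * valueFunction H lam (γ b) ≤ ∫ s in a..b, runningCost H lam γ s := by
  obtain ⟨η, hη, hηi, hηA⟩ := exists_isForwardMinimizer hlam hH hf (γ b)
  have hηV : discountedAction H lam η = valueFunction H lam (γ b) := hηA.csInf_eq.symm
  set d : ℝ := b - a with hd
  have hd0 : 0 ≤ d := sub_nonneg.2 hab
  -- The competitor follows `γ`, moved to start at time 0, and then a minimizer from `γ b`.
  set ζ : ℝ → M := fun t => if t ≤ d then γ (t + a) else η (t + -d) with hζ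
  have hγ0 : AbsolutelyContinuousOnInterval ζ 0 d := by
    refine absolutelyContinuousOnInterval_congr
      (absolutelyContinuousOnInterval_comp_add_const (c := a) (γ := γ) (by simpa [hd] using hγ))
      fun t ht => ?_
    rw [uIcc_of_le hd0] at ht
    simp [hζ, ht.2]
  have hζc : ∀ T, d ≤ T → AbsolutelyContinuousOnInterval ζ d T := by
    intro T hT
    refine absolutelyContinuousOnInterval_congr
      (absolutelyContinuousOnInterval_comp_add_const (c := -d) (γ := η)
        (by simpa using hη.2 (T + -d) (by linarith))) fun t ht => ?_
    rw [uIcc_of_le hT] at ht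
    rcases ht.1.eq_or_lt with h | h
    · simp [hζ, ← h, hη.1, hd]
    · simp [hζ, h.not_ge]
  have hζ' : IsForwardCurve (γ a) ζ := by
    refine ⟨by simp [hζ, hd0], fun T hT => ?_⟩
    rcases le_total T d with h | h
    · refine hγ0.mono ?_
      rw [uIcc_of_le hT, uIcc_of_le hd0]
      exact Icc_subset_Icc_right h
    · exact absolutelyContinuousOnInterval_union hd0 h hγ0 (hζc T h)
  have hγc := continuousOn_of_absolutelyContinuousOnInterval hγ
  rw [uIcc_of_le hab] at hγc
  have e1 : EqOn (runningCost H lam ζ)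
      (fun t => Real.exp (lam * a) * runningCost H lam γ (t + a)) (Ioo 0 d) := by
    intro t ht
    have hc : ContinuousAt γ (t + a) :=
      hγc.continuousAt (Icc_mem_nhds (by linarith [ht.1]) (by linarith [ht.2]))
    change _ = Real.exp (lam * a) * runningCost H lam γ (t + a)
    rw [← runningCost_comp_add_const hf hc]
    refine (runningCost_congr hf (ContinuousAt.comp (g := γ) (f := fun s => s + a) hc
      (by fun_prop)) ?_).symm
    filter_upwards [Iio_mem_nhds ht.2] with s hs
    simp [hζ, (mem_Iio.1 hs).le]
  have e2 : EqOn (runningCost H lam ζ)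
      (fun t => Real.exp (lam * -d) * runningCost H lam η (t + -d)) (Ioi d) := by
    intro t ht
    have hc : ContinuousAt η (t + -d) := hη.continuousAt (by linarith [mem_Ioi.1 ht])
    change _ = Real.exp (lam * -d) * runningCost H lam η (t + -d)
    rw [← runningCost_comp_add_const hf hc]
    refine (runningCost_congr hf (ContinuousAt.comp (g := η) (f := fun s => s + -d) hc
      (by fun_prop)) ?_).symm
    filter_upwards [Ioi_mem_nhds ht] with s hs
    simp [hζ, (mem_Ioi.1 hs).not_ge]
  have i1 : IntegrableOn (runningCost H lam ζ) (Ioc 0 d) := by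
    rw [integrableOn_Ioc_iff_integrableOn_Ioo]
    refine IntegrableOn.congr_fun ?_ e1.symm measurableSet_Ioo
    rw [← integrableOn_Ioc_iff_integrableOn_Ioo,
      ← intervalIntegrable_iff_integrableOn_Ioc_of_le hd0]
    have := (hi.comp_add_right a).const_mul (Real.exp (lam * a))
    simpa [hd] using this
  have i2 : IntegrableOn (runningCost H lam ζ) (Ioi d) := by
    refine IntegrableOn.congr_fun ?_ e2.symm measurableSet_Ioi
    refine Integrable.const_mul ?_ _
    have := (integrableOn_Ioi_comp_add_right_iff (runningCost H lam η) d (-d)).2 (by simpa using hηi)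
    exact this
  have iζ : IntegrableOn (runningCost H lam ζ) (Ioi 0) := by
    rw [← Ioc_union_Ioi_eq_Ioi hd0]
    exact i1.union i2
  have hle := valueFunction_le hlam hH hζ' iζ
  have v1 : ∫ t in Ioc 0 d, runningCost H lam ζ t =
      Real.exp (lam * a) * ∫ s in a..b, runningCost H lam γ s := by
    rw [integral_Ioc_eq_integral_Ioo, setIntegral_congr_fun measurableSet_Ioo e1,
      ← integral_Ioc_eq_integral_Ioo, ← intervalIntegral.integral_of_le hd0,
      intervalIntegral.integral_const_mul,
      intervalIntegral.integral_comp_add_right (runningCost H lam γ)]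
    simp [hd]
  have v2 : ∫ t in Ioi d, runningCost H lam ζ t =
      Real.exp (lam * -d) * valueFunction H lam (γ b) := by
    rw [setIntegral_congr_fun measurableSet_Ioi e2, integral_const_mul,
      setIntegral_Ioi_comp_add_right (runningCost H lam η), ← hηV]
    simp [discountedAction]
  unfold discountedAction at hle
  rw [← Ioc_union_Ioi_eq_Ioi hd0, setIntegral_union Ioc_disjoint_Ioi_same measurableSet_Ioi i1 i2,
    v1, v2] at hle
  have h1 := mul_le_mul_of_nonneg_left hle (Real.exp_nonneg (-lam * a))
  rw [mul_add, ← mul_assoc, ← mul_assoc, ← Real.exp_add, ← Real.exp_add] at h1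
  have t1 : -lam * a + lam * a = 0 := by ring
  have t2 : -lam * a + lam * -d = -lam * b := by rw [hd]; ring
  rw [t1, t2, Real.exp_zero, one_mul] at h1
  linarith

/-- Dynamic programming along minimizers. -/
theorem IsForwardMinimizer.valueFunction_eq {x : M} {γ : ℝ → M}
    (hγ : IsForwardMinimizer H lam x γ) {t : ℝ} (ht : 0 ≤ t) :
    valueFunction H lam x = Real.exp (-lam * t) * valueFunction H lam (γ t) +
      ∫ s in (0 : ℝ)..t, runningCost H lam γ s := by
  obtain ⟨hγ, hi, hA⟩ := hγ
  have hV : discountedAction H lam γ = valueFunction H lam x := hA.csInf_eq.symm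
  have hii : IntervalIntegrable (runningCost H lam γ) volume 0 t :=
    (intervalIntegrable_iff_integrableOn_Ioc_of_le ht).2 (hi.mono_set Ioc_subset_Ioi_self)
  have h1 := valueFunction_sub_le hlam hH hf ht (hγ.2 t ht) hii
  rw [hγ.1] at h1
  simp only [mul_zero, Real.exp_zero, one_mul] at h1
  -- The tail of the minimizer competes for the value at `γ t`, which gives the inequality opposite
  -- to dynamic programming.
  have hshift : IsForwardCurve (γ t) fun s => γ (s + t) := by
    refine ⟨by simp, fun T hT => absolutelyContinuousOnInterval_comp_add_const
      ((hγ.2 (T + t) (by linarith)).mono ?_)⟩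
    rw [uIcc_of_le (by linarith), uIcc_of_le (by linarith)]
    exact Icc_subset_Icc_left (by linarith)
  have e : EqOn (runningCost H lam fun s => γ (s + t))
      (fun s => Real.exp (lam * t) * runningCost H lam γ (s + t)) (Ioi 0) := fun s hs =>
    runningCost_comp_add_const hf (hγ.continuousAt (by linarith [mem_Ioi.1 hs]))
  have hi2 : IntegrableOn (runningCost H lam γ) (Ioi (0 + t)) :=
    hi.mono_set (Ioi_subset_Ioi (by linarith))
  have hs : IntegrableOn (runningCost H lam fun s => γ (s + t)) (Ioi 0) := by
    refine IntegrableOn.congr_fun ?_ e.symm measurableSet_Ioi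
    exact Integrable.const_mul ((integrableOn_Ioi_comp_add_right_iff _ 0 t).2 hi2) _
  have h2 := valueFunction_le hlam hH hshift hs
  unfold discountedAction at h2 hV
  rw [setIntegral_congr_fun measurableSet_Ioi e, integral_const_mul,
    setIntegral_Ioi_comp_add_right (runningCost H lam γ), zero_add] at h2
  rw [← Ioc_union_Ioi_eq_Ioi ht, setIntegral_union Ioc_disjoint_Ioi_same measurableSet_Ioi
    (hi.mono_set Ioc_subset_Ioi_self) (hi.mono_set (Ioi_subset_Ioi ht)),
    ← intervalIntegral.integral_of_le ht] at hV
  have h3 := mul_le_mul_of_nonneg_left h2 (Real.exp_nonneg (-lam * t))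
  rw [← mul_assoc, ← Real.exp_add, show -lam * t + lam * t = 0 by ring, Real.exp_zero,
    one_mul] at h3
  linarith

theorem isDominated_uPlus : IsDominated H lam (uPlus H lam) := by
  rintro a b hab x y γ hγ rfl rfl hi
  have := valueFunction_sub_le hlam hH hf hab hγ hi
  change Real.exp (-lam * b) * -valueFunction H lam (γ b) -
    Real.exp (-lam * a) * -valueFunction H lam (γ a) ≤ _
  linarith

theorem IsForwardMinimizer.isCalibrated {x : M} {γ : ℝ → M} (hγ : IsForwardMinimizer H lam x γ) :
    IsCalibrated H lam (uPlus H lam) x γ := by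
  intro t ht
  have := hγ.valueFunction_eq hlam hH hf ht
  change -valueFunction H lam x = Real.exp (-lam * t) * -valueFunction H lam (γ t) + _
  rw [intervalIntegral.integral_symm]
  linarith

end Value


/-! ### From local to global equi-Lipschitz bounds -/

section EquiLipschitz

/-- On a compact connected metric space, a locally equi-Lipschitz family is equi-Lipschitz. -/
theorem exists_forall_lipschitzWith {X ι : Type*} [MetricSpace X] [CompactSpace X]
    [PreconnectedSpace X] {u : ι → X → ℝ}
    (h : ∀ x₀, ∃ K : ℝ≥0, ∃ U ∈ 𝓝 x₀, ∀ i, ∀ x ∈ U, ∀ y ∈ U, u i x - u i y ≤ K * dist x y) :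
    ∃ K : ℝ≥0, ∀ i, LipschitzWith K (u i) := by
  have h' : ∀ x₀, ∃ K : ℝ≥0, ∃ U ∈ 𝓝 x₀, ∀ i, ∀ x ∈ U, ∀ y ∈ U,
      |u i x - u i y| ≤ K * dist x y := by
    intro x₀
    obtain ⟨K, U, hU, hK⟩ := h x₀
    refine ⟨K, U, hU, fun i x hx y hy => abs_le.2 ⟨?_, hK i x hx y hy⟩⟩
    have := hK i y hy x hx
    rw [dist_comm] at this
    linarith
  -- Connectedness chains the local estimates into a bound uniform in `i`; it controls pairs away
  -- from the diagonal, where the local estimates say nothing.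
  have hosc : ∀ x y, ∃ D : ℝ≥0, ∀ i, |u i x - u i y| ≤ D := by
    refine PreconnectedSpace.induction₂' _ (fun x₀ => ?_) ⟨?_⟩
    · obtain ⟨K, U, hU, hK⟩ := h' x₀
      filter_upwards [hU] with y hy
      exact ⟨⟨K * nndist x₀ y, fun i => hK i x₀ (mem_of_mem_nhds hU) y hy⟩,
        ⟨K * nndist y x₀, fun i => hK i y hy x₀ (mem_of_mem_nhds hU)⟩⟩
    · rintro x y z ⟨D, hD⟩ ⟨D', hD'⟩
      exact ⟨D + D', fun i => (abs_sub_le _ (u i y) _).trans (add_le_add (hD i) (hD' i))⟩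
  obtain ⟨K, hK⟩ := exists_forall_of_eventually_mono
    (P := fun (z : X × X) (C : ℝ≥0) => ∀ i, |u i z.1 - u i z.2| ≤ C * dist z.1 z.2)
    (fun x a b hab h i => (h i).trans (by gcongr)) (fun z => by
      obtain ⟨x, y⟩ := z
      by_cases hxy : x = y
      · subst hxy
        obtain ⟨K, U, hU, hK⟩ := h' x
        refine ⟨K, ?_⟩
        rw [nhds_prod_eq]
        filter_upwards [prod_mem_prod hU hU] with z hz i
        exact hK i _ hz.1 _ hz.2
      · obtain ⟨D, hD⟩ := hosc x y
        obtain ⟨K₁, U₁, hU₁, hK₁⟩ := h' x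
        obtain ⟨K₂, U₂, hU₂, hK₂⟩ := h' y
        have hpos : 0 < dist x y := dist_pos.2 hxy
        refine ⟨⟨(D + K₁ + K₂) / (dist x y / 2), by positivity⟩, ?_⟩
        have hc : Continuous fun z : X × X => dist z.1 z.2 := continuous_dist
        have hev := hc.continuousAt (x := (x, y)).eventually (lt_mem_nhds (half_lt_self hpos))
        rw [nhds_prod_eq] at hev ⊢
        filter_upwards [prod_mem_prod (Filter.inter_mem hU₁ (Metric.ball_mem_nhds x one_pos))
          (Filter.inter_mem hU₂ (Metric.ball_mem_nhds y one_pos)),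
          hev] with z hz hz' i
        have h1 := hK₁ i z.1 hz.1.1 x (mem_of_mem_nhds hU₁)
        have h2 := hK₂ i z.2 hz.2.1 y (mem_of_mem_nhds hU₂)
        have d1 : K₁ * dist z.1 x ≤ K₁ := mul_le_of_le_one_right K₁.coe_nonneg (le_of_lt hz.1.2)
        have d2 : K₂ * dist z.2 y ≤ K₂ := mul_le_of_le_one_right K₂.coe_nonneg (le_of_lt hz.2.2)
        have h3 := hD i
        have h4 : |u i z.1 - u i z.2| ≤ D + K₁ + K₂ := by
          rw [abs_le] at *
          constructor <;> linarith [h1.1, h1.2, h2.1, h2.2, h3.1, h3.2]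
        calc _ ≤ (D + K₁ + K₂ : ℝ) := h4
          _ = (D + K₁ + K₂) / (dist x y / 2) * (dist x y / 2) := by field_simp
          _ ≤ (D + K₁ + K₂) / (dist x y / 2) * dist z.1 z.2 :=
            mul_le_mul_of_nonneg_left (le_of_lt hz') (by positivity))
  exact ⟨K, fun i => LipschitzWith.of_dist_le_mul fun x y => hK (x, y) i⟩

end EquiLipschitz

/-! ### Affine lines in charts -/

section ChartLine

variable {n : ℕ} {M : Type*} [MetricSpace M] [ChartedSpace (EuclideanSpace ℝ (Fin n)) M]

/-- The curve which is an affine line in the chart at `x₀`. -/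
noncomputable def chartLine (x₀ : M) (z w : EuclideanSpace ℝ (Fin n)) (t : ℝ) : M :=
  (extChartAt (𝓡 n) x₀).symm (z + t • w)

variable [IsManifold (𝓡 n) ∞ M] [RiemannianBundle (fun x : M => TangentSpace (𝓡 n) x)]

theorem hasDerivAt_add_smul (z w : EuclideanSpace ℝ (Fin n)) (t : ℝ) :
    HasDerivAt (fun s : ℝ => z + s • w) w t := by
  simpa using ((hasDerivAt_id t).smul_const w).const_add z

theorem mdifferentiableAt_chartLine {x₀ : M} {z w : EuclideanSpace ℝ (Fin n)} {t : ℝ}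
    (h : z + t • w ∈ (extChartAt (𝓡 n) x₀).target) :
    MDifferentiableAt 𝓘(ℝ, ℝ) (𝓡 n) (chartLine x₀ z w) t :=
  MDifferentiableAt.comp (I' := 𝓘(ℝ, EuclideanSpace ℝ (Fin n))) t
    (mdifferentiableAt_extChartAt_symm_of_mem h)
    (hasDerivAt_add_smul z w t).differentiableAt.mdifferentiableAt

theorem chartLine_mem_source {x₀ : M} {z w : EuclideanSpace ℝ (Fin n)} {t : ℝ}
    (h : z + t • w ∈ (extChartAt (𝓡 n) x₀).target) :
    chartLine x₀ z w t ∈ (extChartAt (𝓡 n) x₀).source :=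
  (extChartAt (𝓡 n) x₀).map_target h

theorem mdiff_velocity_chartLine {x₀ : M} {z w : EuclideanSpace ℝ (Fin n)} {t : ℝ}
    (h : z + t • w ∈ (extChartAt (𝓡 n) x₀).target) :
    mdiff n (extChartAt (𝓡 n) x₀) (chartLine x₀ z w t) (velocity n (chartLine x₀ z w) t) = w := by
  have h1 := deriv_comp_eq_mdiff_velocity
    (mdifferentiableAt_extChartAt_of_mem (chartLine_mem_source h)) (mdifferentiableAt_chartLine h)
  have h2 : HasDerivAt (extChartAt (𝓡 n) x₀ ∘ chartLine x₀ z w) w t := by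
    refine (hasDerivAt_add_smul z w t).congr_of_eventuallyEq ?_
    have hc : ContinuousAt (fun s : ℝ => z + s • w) t := by fun_prop
    filter_upwards [hc.preimage_mem_nhds ((isOpen_extChartAt_target x₀).mem_nhds h)] with s hs
    exact (extChartAt (𝓡 n) x₀).right_inv hs
  exact h1.unique h2

theorem chartLine_extChartAt_zero {x₀ x : M} (hx : x ∈ (extChartAt (𝓡 n) x₀).source)
    (w : EuclideanSpace ℝ (Fin n)) : chartLine x₀ (extChartAt (𝓡 n) x₀ x) w 0 = x := by
  rw [chartLine, zero_smul, add_zero, (extChartAt (𝓡 n) x₀).left_inv hx]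

variable [IsContMDiffRiemannianBundle (𝓡 n) ∞ (EuclideanSpace ℝ (Fin n))
    (fun x : M => TangentSpace (𝓡 n) x)] [IsRiemannianManifold (𝓡 n) M]

/-- Around a point, inverse charts are Lipschitz; moreover any neighborhood can be reached. -/
theorem exists_ball_chart (x₀ : M) {P : M → Prop} (hP : ∀ᶠ x in 𝓝 x₀, P x) :
    ∃ C : ℝ≥0, ∃ r > 0, Metric.ball (extChartAt (𝓡 n) x₀ x₀) r ⊆ (extChartAt (𝓡 n) x₀).target ∧
      (∀ z ∈ Metric.ball (extChartAt (𝓡 n) x₀ x₀) r, P ((extChartAt (𝓡 n) x₀).symm z)) ∧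
      ∀ z ∈ Metric.ball (extChartAt (𝓡 n) x₀ x₀) r, ∀ z' ∈ Metric.ball (extChartAt (𝓡 n) x₀ x₀) r,
        dist ((extChartAt (𝓡 n) x₀).symm z) ((extChartAt (𝓡 n) x₀).symm z') ≤ C * ‖z - z'‖ := by
  obtain ⟨C, U, hU, hC⟩ := eventually_dist_le_norm_chart_sub (n := n) x₀
  have h1 := (continuousAt_extChartAt_symm (I := 𝓡 n) x₀)
  have h2 : (extChartAt (𝓡 n) x₀).symm ⁻¹' (U ∩ {x | P x}) ∈ 𝓝 (extChartAt (𝓡 n) x₀ x₀) := by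
    refine h1.preimage_mem_nhds ?_
    rw [extChartAt_to_inv]
    exact Filter.inter_mem hU hP
  obtain ⟨r, hr, hrs⟩ := Metric.mem_nhds_iff.1 (Filter.inter_mem h2 (extChartAt_target_mem_nhds x₀))
  refine ⟨C, r, hr, fun z hz => (hrs hz).2, fun z hz => (hrs hz).1.2, fun z hz z' hz' => ?_⟩
  have := hC _ (hrs hz).1.1 _ (hrs hz').1.1
  rwa [(extChartAt (𝓡 n) x₀).right_inv (hrs hz).2,
    (extChartAt (𝓡 n) x₀).right_inv (hrs hz').2] at this

omit [IsManifold (𝓡 n) ∞ M] [RiemannianBundle (fun x : M => TangentSpace (𝓡 n) x)]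
  [IsContMDiffRiemannianBundle (𝓡 n) ∞ (EuclideanSpace ℝ (Fin n))
    (fun x : M => TangentSpace (𝓡 n) x)] [IsRiemannianManifold (𝓡 n) M] in
theorem absolutelyContinuousOnInterval_chartLine {x₀ : M} {z w : EuclideanSpace ℝ (Fin n)}
    {a b : ℝ} {C : ℝ≥0} {S : Set (EuclideanSpace ℝ (Fin n))}
    (hC : ∀ z ∈ S, ∀ z' ∈ S,
      dist ((extChartAt (𝓡 n) x₀).symm z) ((extChartAt (𝓡 n) x₀).symm z') ≤ C * ‖z - z'‖)
    (hS : ∀ t ∈ uIcc a b, z + t • w ∈ S) :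
    AbsolutelyContinuousOnInterval (chartLine x₀ z w) a b := by
  refine LipschitzOnWith.absolutelyContinuousOnInterval (K := C * ‖w‖₊)
    (LipschitzOnWith.of_dist_le_mul fun s hs t ht => ?_)
  refine (hC _ (hS s hs) _ (hS t ht)).trans (le_of_eq ?_)
  rw [add_sub_add_left_eq_sub, ← sub_smul, norm_smul, Real.dist_eq, Real.norm_eq_abs]
  push_cast
  ring

theorem add_smul_mem_ball {c z w : EuclideanSpace ℝ (Fin n)} {r h t : ℝ}
    (hz : z ∈ Metric.ball c r) (hzh : z + h • w ∈ Metric.ball c r) (ht : t ∈ Icc 0 h) :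
    z + t • w ∈ Metric.ball c r := by
  rcases (ht.1.trans ht.2).eq_or_lt with h0 | h0
  · have : t = 0 := le_antisymm (h0 ▸ ht.2) ht.1
    simpa [this] using hz
  have := (convex_ball c r).add_smul_sub_mem hz hzh (t := t / h)
    ⟨div_nonneg ht.1 h0.le, (div_le_one h0).2 ht.2⟩
  rwa [add_sub_cancel_left, smul_smul, div_mul_cancel₀ _ h0.ne'] at this

end ChartLine

/-! ### Lipschitz bound on the value function, uniform in the discount -/

section ValueLipschitz

variable {n : ℕ} {M : Type*} [MetricSpace M] [ChartedSpace (EuclideanSpace ℝ (Fin n)) M]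
  [IsManifold (𝓡 n) ∞ M] [CompactSpace M]
  {F : Type*} [NormedAddCommGroup F] [NormedSpace ℝ F] [FiniteDimensional ℝ F]
  [RiemannianBundle (fun x : M => TangentSpace (𝓡 n) x)]
  {H : ∀ x : M, Cotangent n x → ℝ} (hH : IsTonelliHamiltonian H)
  {f : M → F} (hf : IsBiLipschitzImmersion n f)

include hH hf

theorem intervalIntegrable_lagrangianAlong_of_le {γ : ℝ → M} {a b ℓ : ℝ} (hab : a ≤ b)
    (hγ : AbsolutelyContinuousOnInterval γ a b)
    (hℓ : ∀ s ∈ Ioo a b, lagrangianAlong H γ s ≤ ℓ) :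
    IntervalIntegrable (lagrangianAlong H γ) volume a b := by
  obtain ⟨C, hC⟩ := exists_neg_le_lagrangian hH
  have hγc := continuousOn_of_absolutelyContinuousOnInterval hγ
  rw [uIcc_of_le hab] at hγc
  rw [intervalIntegrable_iff_integrableOn_Ioc_of_le hab]
  refine Integrable.of_bound (aestronglyMeasurable_lagrangianAlong hf hH hγc) (max ℓ C) ?_
  rw [← restrict_Ioo_eq_restrict_Ioc]
  filter_upwards [ae_restrict_mem measurableSet_Ioo] with s hs
  refine abs_le.2 ⟨?_, (hℓ s hs).trans (le_max_left _ _)⟩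
  have := hC (γ s) (velocity n γ s)
  have h2 := le_max_right ℓ C
  unfold lagrangianAlong
  linarith

theorem valueFunction_sub_le_of_lagrangianAlong_le {lam : ℝ} (hlam : 0 < lam) {γ : ℝ → M} {h ℓ : ℝ}
    (h0 : 0 ≤ h) (hγ : AbsolutelyContinuousOnInterval γ 0 h)
    (hℓ : ∀ s ∈ Ioo 0 h, lagrangianAlong H γ s ≤ ℓ) :
    valueFunction H lam (γ 0) - Real.exp (-lam * h) * valueFunction H lam (γ h) ≤
      ∫ s in (0 : ℝ)..h, Real.exp (-lam * s) * (ℓ + criticalValue H) := by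
  have hi := intervalIntegrable_lagrangianAlong_of_le hH hf h0 hγ hℓ
  have hi' : IntervalIntegrable (runningCost H lam γ) volume 0 h :=
    (hi.add intervalIntegrable_const).continuousOn_mul
      (f := fun s => lagrangianAlong H γ s + criticalValue H)
      (g := fun s : ℝ => Real.exp (-lam * s)) (Continuous.continuousOn (by fun_prop))
  have h1 := valueFunction_sub_le hlam hH hf h0 hγ hi'
  simp only [mul_zero, Real.exp_zero, one_mul] at h1
  refine h1.trans (intervalIntegral.integral_mono_on_of_le_Ioo h0 hi'
    (Continuous.intervalIntegrable (by fun_prop) _ _) fun s hs => ?_)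
  rw [runningCost_eq]
  gcongr
  exact hℓ s hs

variable [IsContMDiffRiemannianBundle (𝓡 n) ∞ (EuclideanSpace ℝ (Fin n))
    (fun x : M => TangentSpace (𝓡 n) x)] [IsRiemannianManifold (𝓡 n) M]

/-- Locally, two points are joined by a curve of controlled length and bounded Lagrangian. -/
theorem exists_joining_curve (x₀ : M) :
    ∃ (ℓ : ℝ≥0) (K : ℝ≥0), ∃ U ∈ 𝓝 x₀, ∀ x ∈ U, ∀ y ∈ U, ∃ (h : ℝ) (γ : ℝ → M), 0 ≤ h ∧
      h ≤ K * dist x y ∧ γ 0 = x ∧ γ h = y ∧ AbsolutelyContinuousOnInterval γ 0 h ∧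
      ∀ s ∈ Ioo 0 h, lagrangianAlong H γ s ≤ ℓ := by
  obtain ⟨ℓ, hℓ⟩ := eventually_lagrangian_le hH x₀ 1
  obtain ⟨C, r, hr, hrt, hrℓ, hC⟩ := exists_ball_chart (n := n) x₀ hℓ
  obtain ⟨K₁, U₁, hU₁, hK₁⟩ := eventually_norm_chart_sub_le (hf.contMDiff x₀) (hf.injective_mdiff x₀)
  obtain ⟨K₂, hK₂⟩ := hf.lipschitz
  refine ⟨ℓ, K₁ * K₂, (U₁ ∩ extChartAt (𝓡 n) x₀ ⁻¹' Metric.ball (extChartAt (𝓡 n) x₀ x₀) r) ∩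
    (extChartAt (𝓡 n) x₀).source, Filter.inter_mem (Filter.inter_mem hU₁
      ((continuousAt_extChartAt x₀).preimage_mem_nhds (Metric.ball_mem_nhds _ hr)))
      (extChartAt_source_mem_nhds x₀), fun x hx y hy => ?_⟩
  set a := extChartAt (𝓡 n) x₀ x with ha
  set b := extChartAt (𝓡 n) x₀ y with hb
  set h := ‖b - a‖ with hh
  have hhle : h ≤ (K₁ * K₂ : ℝ≥0) * dist x y := by
    rw [hh, norm_sub_rev]
    refine (hK₁ x hx.1.1 y hy.1.1).trans ?_
    rw [← dist_eq_norm]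
    push_cast
    rw [mul_assoc]
    gcongr
    exact hK₂.dist_le_mul x y
  -- The segment is run at unit speed in the chart, so its duration `h` is its length. If the
  -- endpoints coincide, `h⁻¹ = 0` and the line is constant.
  set w := h⁻¹ • (b - a) with hw
  have hhw : h • w = b - a := by
    rcases eq_or_ne h 0 with h0 | h0
    · have : b - a = 0 := norm_eq_zero.1 h0
      rw [h0, zero_smul, this]
    · rw [hw, smul_smul, mul_inv_cancel₀ h0, one_smul]
  have hw1 : ‖w‖ ≤ 1 := by
    rw [hw, norm_smul, norm_inv, Real.norm_of_nonneg (norm_nonneg _)]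
    exact inv_mul_le_one
  have hbm : a + h • w ∈ Metric.ball (extChartAt (𝓡 n) x₀ x₀) r := by
    rw [hhw, add_sub_cancel]
    exact hy.1.2
  have hmem : ∀ t ∈ Icc 0 h, a + t • w ∈ Metric.ball (extChartAt (𝓡 n) x₀ x₀) r :=
    fun t ht => add_smul_mem_ball hx.1.2 hbm ht
  refine ⟨h, chartLine x₀ a w, norm_nonneg _, hhle, chartLine_extChartAt_zero hx.2 w, ?_,
    absolutelyContinuousOnInterval_chartLine hC fun t ht => hmem t ?_, fun s hs => ?_⟩
  · rw [chartLine, hhw, add_sub_cancel, hb, (extChartAt (𝓡 n) x₀).left_inv hy.2]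
  · rwa [uIcc_of_le (norm_nonneg _)] at ht
  · have hm := hmem s ⟨hs.1.le, hs.2.le⟩
    refine hrℓ _ hm _ ?_
    refine le_of_eq_of_le ?_ hw1
    exact congrArg norm (mdiff_velocity_chartLine (hrt hm))

/-- Dynamic programming along a short joining curve. The discount costs (1 - e^{-λT})|V| ≤ λT|V|,
and λ|V| is bounded independently of λ, so both contributions are of the order of the distance. -/
theorem exists_lipschitzWith_valueFunction [ConnectedSpace M] :
    ∃ K : ℝ≥0, ∀ lam : ℝ, 0 < lam → LipschitzWith K (valueFunction H lam) := by
  obtain ⟨B, hB0, hB⟩ := exists_abs_mul_valueFunction_le hH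
  obtain ⟨K, hK⟩ := exists_forall_lipschitzWith
    (u := fun lam : {lam : ℝ // 0 < lam} => valueFunction H lam) (by
      intro x₀
      obtain ⟨ℓ, K, U, hU, h⟩ := exists_joining_curve hH hf x₀
      refine ⟨⟨|ℓ + criticalValue H| + B, by positivity⟩ * K, U, hU, ?_⟩
      rintro ⟨lam, hlam⟩ x hx y hy
      obtain ⟨T, γ, hT0, hT, rfl, rfl, hγ, hL⟩ := h x hx y hy
      have h1 := valueFunction_sub_le_of_lagrangianAlong_le hH hf hlam hT0 hγ hL
      have h2 : ∫ s in (0 : ℝ)..T, Real.exp (-lam * s) * (ℓ + criticalValue H) ≤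
          ∫ s in (0 : ℝ)..T, |ℓ + criticalValue H| := by
        refine intervalIntegral.integral_mono_on hT0
          (Continuous.intervalIntegrable (by fun_prop) _ _) intervalIntegrable_const fun s hs => ?_
        refine (le_abs_self _).trans ?_
        rw [abs_mul, abs_of_nonneg (Real.exp_nonneg _)]
        refine mul_le_of_le_one_left (abs_nonneg _) (Real.exp_le_one_iff.2 ?_)
        nlinarith [hs.1]
      rw [intervalIntegral.integral_const, smul_eq_mul, sub_zero] at h2
      have h3 : (1 - Real.exp (-lam * T)) * -valueFunction H lam (γ T) ≤ B * T := by
        have e1 : 1 - Real.exp (-lam * T) ≤ lam * T := by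
          have := Real.add_one_le_exp (-lam * T)
          linarith
        have e0 : 0 ≤ 1 - Real.exp (-lam * T) :=
          sub_nonneg.2 (Real.exp_le_one_iff.2 (by nlinarith))
        calc _ ≤ (1 - Real.exp (-lam * T)) * |valueFunction H lam (γ T)| := by
              gcongr
              exact neg_le_abs _
          _ ≤ lam * T * |valueFunction H lam (γ T)| := by gcongr
          _ = |lam * valueFunction H lam (γ T)| * T := by rw [abs_mul, abs_of_pos hlam]; ring
          _ ≤ B * T := by gcongr; exact hB lam hlam _
      change valueFunction H lam (γ 0) - valueFunction H lam (γ T) ≤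
        (|ℓ + criticalValue H| + B) * K * dist (γ 0) (γ T)
      calc _ ≤ (|ℓ + criticalValue H| + B) * T := by linarith
        _ ≤ (|ℓ + criticalValue H| + B) * (K * dist (γ 0) (γ T)) := by gcongr
        _ = _ := by ring)
  exact ⟨K, fun lam hlam => hK ⟨lam, hlam⟩⟩

end ValueLipschitz


/-! ### Discounted integration and Fubini along lines -/

section Real

/-- The hypothesis bounds the derivative of e^{-λs} g(s). The lower bound on the value function and
the supersolution property are both obtained this way. -/
theorem exp_mul_sub_le_integral {g k : ℝ → ℝ} {lam T : ℝ} (hT : 0 ≤ T)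
    (hg : AbsolutelyContinuousOnInterval g 0 T)
    (hk : IntervalIntegrable (fun s => Real.exp (-lam * s) * k s) volume 0 T)
    (hle : ∀ᵐ s ∂volume.restrict (Ioc 0 T), deriv g s - lam * g s ≤ k s) :
    Real.exp (-lam * T) * g T - g 0 ≤ ∫ s in (0 : ℝ)..T, Real.exp (-lam * s) * k s := by
  have he : AbsolutelyContinuousOnInterval (fun s : ℝ => Real.exp (-lam * s)) 0 T := by
    refine ContDiffOn.absolutelyContinuousOnInterval (ContDiff.contDiffOn ?_)
    fun_prop
  have hp := he.fun_mul hg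
  have h1 := hp.integral_deriv_eq_sub
  simp only [mul_zero, Real.exp_zero, one_mul] at h1
  rw [← h1]
  refine intervalIntegral.integral_mono_ae_restrict hT hp.intervalIntegrable_deriv hk ?_
  have hd : ∀ᵐ s ∂volume.restrict (Icc 0 T), DifferentiableAt ℝ g s := by
    rw [ae_restrict_iff' measurableSet_Icc]
    have := hg.ae_differentiableAt
    rwa [uIcc_of_le hT] at this
  rw [← restrict_Ioc_eq_restrict_Icc] at hd ⊢
  filter_upwards [hd, hle] with s hs hs'
  have h2 : HasDerivAt (fun s : ℝ => Real.exp (-lam * s)) (Real.exp (-lam * s) * -lam) s := by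
    simpa using ((hasDerivAt_id s).const_mul (-lam)).exp
  have h3 := (h2.mul hs.hasDerivAt).deriv
  rw [show (fun s : ℝ => Real.exp (-lam * s) * g s) =
    (fun s : ℝ => Real.exp (-lam * s)) * g from rfl, h3]
  calc _ = Real.exp (-lam * s) * (deriv g s - lam * g s) := by ring
    _ ≤ _ := by gcongr

theorem ae_ae_add_smul {E : Type*} [NormedAddCommGroup E] [NormedSpace ℝ E] [MeasurableSpace E]
    [BorelSpace E] [SecondCountableTopology E] (μ : Measure E) [SFinite μ]
    [μ.IsAddRightInvariant] {P : E → Prop} (h : ∀ᵐ y ∂μ, P y) (w : E) :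
    ∀ᵐ z ∂μ, ∀ᵐ s : ℝ, P (z + s • w) := by
  -- `P` need not be measurable; Fubini is applied to a measurable null set containing its
  -- exceptional points.
  obtain ⟨N, hN, hNm, hN0⟩ := exists_measurable_superset_of_null (ae_iff.1 h)
  have h1 : ∀ᵐ z ∂μ, ∀ᵐ s : ℝ, z + s • w ∉ N := by
    have hm : Measurable fun p : E × ℝ => p.1 + p.2 • w := by fun_prop
    refine (Measure.ae_ae_comm (p := fun (z : E) (s : ℝ) => z + s • w ∉ N) (hm hNm.compl)).2 ?_
    refine ae_of_all _ fun s => ?_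
    exact (measurePreserving_add_right μ (s • w)).quasiMeasurePreserving.ae
      (p := fun y => y ∉ N) (measure_eq_zero_iff_ae_notMem.1 hN0)
  filter_upwards [h1] with z hz
  filter_upwards [hz] with s hs
  by_contra hcon
  exact hs (hN hcon)

end Real

/-! ### Almost everywhere subsolutions and the lower bound on the value -/

section Subsolution

variable {n : ℕ} {M : Type*} [MetricSpace M] [ChartedSpace (EuclideanSpace ℝ (Fin n)) M]
  [IsManifold (𝓡 n) ∞ M]
  [RiemannianBundle (fun x : M => TangentSpace (𝓡 n) x)]
  {H : ∀ x : M, Cotangent n x → ℝ}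

/-- Lipschitz functions with `H(x, d_x w) ≤ c` almost everywhere. -/
def IsLipschitzSubsolution (H : ∀ x : M, Cotangent n x → ℝ) (c : ℝ) (w : M → ℝ) : Prop :=
  (∃ K : ℝ≥0, LipschitzWith K w) ∧ AlmostEverywhere n (fun x =>
    MDifferentiableAt (𝓡 n) 𝓘(ℝ, ℝ) w x ∧ H x (differential n w x) ≤ c)

variable (hH : IsTonelliHamiltonian H)
  [IsContMDiffRiemannianBundle (𝓡 n) ∞ (EuclideanSpace ℝ (Fin n))
    (fun x : M => TangentSpace (𝓡 n) x)] [IsRiemannianManifold (𝓡 n) M]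

include hH

/-- The line through `x₀` may lie in the exceptional null set. The estimate is first integrated
along parallel lines from almost every starting point, and continuity of `w` brings it back to `x₀`.
-/
theorem IsLipschitzSubsolution.eventually_chartLine_sub_le {c : ℝ} {w : M → ℝ}
    (hw : IsLipschitzSubsolution H c w) (x₀ : M) (v₀ : TangentSpace (𝓡 n) x₀) {ε : ℝ}
    (hε : 0 < ε) :
    ∀ᶠ h in 𝓝[>] (0 : ℝ), w (chartLine x₀ (extChartAt (𝓡 n) x₀ x₀)
      (mdiff n (extChartAt (𝓡 n) x₀) x₀ v₀) h) - w x₀ ≤ h * (lagrangian H x₀ v₀ + ε + c) := by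
  obtain ⟨⟨K, hK⟩, hae⟩ := hw
  set v := mdiff n (extChartAt (𝓡 n) x₀) x₀ v₀ with hv
  set z₀ := extChartAt (𝓡 n) x₀ x₀ with hz₀
  obtain ⟨C, r, hr, hrt, hrL, hC⟩ := exists_ball_chart (n := n) x₀
    (eventually_lagrangian_le_add hH x₀ v₀ hε)
  have hae' := ae_ae_add_smul volume (hae x₀) v
  have hsmall : ∀ᶠ h in 𝓝[>] (0 : ℝ), z₀ + h • v ∈ Metric.ball z₀ r := by
    have hc : ContinuousAt (fun h : ℝ => z₀ + h • v) 0 := by fun_prop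
    exact (hc.eventually_mem (by simpa using Metric.ball_mem_nhds z₀ hr)).filter_mono
      nhdsWithin_le_nhds
  filter_upwards [hsmall, self_mem_nhdsWithin] with h hh h0
  replace h0 : 0 < h := h0
  have hline : ∀ᶠ z in 𝓝 z₀, z ∈ Metric.ball z₀ r ∧ z + h • v ∈ Metric.ball z₀ r := by
    have hc : ContinuousAt (fun z : EuclideanSpace ℝ (Fin n) => z + h • v) z₀ := by fun_prop
    exact Filter.Eventually.and (Metric.ball_mem_nhds z₀ hr) (hc.eventually (Metric.isOpen_ball.mem_nhds hh))
  have hest : ∀ z, z ∈ Metric.ball z₀ r → z + h • v ∈ Metric.ball z₀ r →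
      (∀ᵐ s : ℝ, z + s • v ∈ (chartAt (EuclideanSpace ℝ (Fin n)) x₀).target →
        MDifferentiableAt (𝓡 n) 𝓘(ℝ, ℝ) w
          ((chartAt (EuclideanSpace ℝ (Fin n)) x₀).symm (z + s • v)) ∧
        H _ (differential n w ((chartAt (EuclideanSpace ℝ (Fin n)) x₀).symm (z + s • v))) ≤ c) →
      w (chartLine x₀ z v h) - w (chartLine x₀ z v 0) ≤ h * (lagrangian H x₀ v₀ + ε + c) := by
    intro z hz hzh hg
    have hmem : ∀ s ∈ Icc 0 h, z + s • v ∈ Metric.ball z₀ r := fun s hs =>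
      add_smul_mem_ball hz hzh hs
    have hac : AbsolutelyContinuousOnInterval (w ∘ chartLine x₀ z v) 0 h :=
      hK.comp_absolutelyContinuousOnInterval (absolutelyContinuousOnInterval_chartLine hC
        fun s hs => hmem s (by rwa [uIcc_of_le h0.le] at hs))
    have h1 := hac.integral_deriv_eq_sub
    simp only [Function.comp_apply] at h1
    rw [← h1]
    calc _ ≤ ∫ _ in (0 : ℝ)..h, (lagrangian H x₀ v₀ + ε + c) := by
          refine intervalIntegral.integral_mono_ae_restrict h0.le hac.intervalIntegrable_deriv
            intervalIntegrable_const ?_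
          filter_upwards [ae_restrict_of_ae hg, ae_restrict_mem measurableSet_Icc] with s hs hs'
          have ht := hrt (hmem s hs')
          obtain ⟨hs1, hs2⟩ := hs (by simpa using ht)
          have h3 := apply_velocity_le hH (γ := chartLine x₀ z v) (t := s) (g := w)
            hs1 (mdifferentiableAt_chartLine ht)
          have h4 : lagrangianAlong H (chartLine x₀ z v) s ≤ lagrangian H x₀ v₀ + ε :=
            hrL _ (hmem s hs') _ (mdiff_velocity_chartLine ht)
          have h5 : H (chartLine x₀ z v s) (differential n w (chartLine x₀ z v s)) ≤ c := hs2
          linarith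
      _ = _ := by rw [intervalIntegral.integral_const, sub_zero, smul_eq_mul]
  have hcont : ∀ s : ℝ, z₀ + s • v ∈ Metric.ball z₀ r →
      ContinuousAt (fun z => w (chartLine x₀ z v s)) z₀ := by
    intro s hs
    refine hK.continuous.continuousAt.comp ?_
    exact ContinuousAt.comp (f := fun z : EuclideanSpace ℝ (Fin n) => z + s • v)
      (mdifferentiableAt_extChartAt_symm_of_mem (hrt hs)).continuousAt (by fun_prop)
  -- Good starting points have full measure, so they accumulate at `z₀`.
  have hdense := Measure.dense_of_ae hae'
  have hne := mem_closure_iff_nhdsWithin_neBot.1 (hdense z₀)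
  have hlim := ((hcont h hh).sub (hcont 0 (by simpa using hr))).tendsto.mono_left
    (nhdsWithin_le_nhds (s := {z | ∀ᵐ s : ℝ, z + s • v ∈
        (chartAt (EuclideanSpace ℝ (Fin n)) x₀).target →
        MDifferentiableAt (𝓡 n) 𝓘(ℝ, ℝ) w
          ((chartAt (EuclideanSpace ℝ (Fin n)) x₀).symm (z + s • v)) ∧
        H _ (differential n w ((chartAt (EuclideanSpace ℝ (Fin n)) x₀).symm (z + s • v))) ≤ c}))
  have h6 := le_of_tendsto (b := h * (lagrangian H x₀ v₀ + ε + c)) hlim (by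
    filter_upwards [self_mem_nhdsWithin, nhdsWithin_le_nhds hline] with z hz1 hz2
    exact hest z hz2.1 hz2.2 hz1)
  simp only [Pi.sub_apply] at h6
  rwa [chartLine_extChartAt_zero (mem_extChartAt_source x₀)] at h6

/-- The curve is replaced by its tangent line in the chart; since `w` is Lipschitz, the error is of
smaller order than the time increment. Hence the inequality holds even on curves inside the
exceptional set. -/
theorem IsLipschitzSubsolution.deriv_comp_le {c : ℝ} {w : M → ℝ}
    (hw : IsLipschitzSubsolution H c w) {γ : ℝ → M} {t : ℝ}
    (hγ : MDifferentiableAt 𝓘(ℝ, ℝ) (𝓡 n) γ t) (hd : DifferentiableAt ℝ (w ∘ γ) t) :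
    deriv (w ∘ γ) t ≤ lagrangianAlong H γ t + c := by
  obtain ⟨K, hK⟩ := hw.1
  obtain ⟨C, r, hr, hrt, -, hC⟩ := exists_ball_chart (n := n) (γ t) (P := fun _ => True)
    (Filter.Eventually.of_forall fun _ => trivial)
  set z₀ := extChartAt (𝓡 n) (γ t) (γ t) with hz₀
  set v := mdiff n (extChartAt (𝓡 n) (γ t)) (γ t) (velocity n γ t) with hv
  have h1 : HasDerivAt (extChartAt (𝓡 n) (γ t) ∘ γ) v t := deriv_comp_eq_mdiff_velocity
    (mdifferentiableAt_extChartAt_of_mem (mem_extChartAt_source (γ t))) hγ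
  have key : ∀ ε : ℝ, 0 < ε → deriv (w ∘ γ) t ≤ lagrangianAlong H γ t + ε + c + K * C * ε := by
    intro ε hε
    have hs := (hasDerivAt_iff_tendsto_slope.1 hd.hasDerivAt).mono_left
      (nhdsWithin_mono (s := Ioi t) _ fun s hs => ne_of_gt hs)
    refine le_of_tendsto hs ?_
    have e1 := hw.eventually_chartLine_sub_le hH (γ t) (velocity n γ t) hε
    have e2 : Tendsto (fun s : ℝ => s - t) (𝓝[>] t) (𝓝[>] 0) := by
      refine tendsto_nhdsWithin_iff.2 ⟨?_, ?_⟩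
      · have : Tendsto (fun s : ℝ => s - t) (𝓝 t) (𝓝 (t - t)) := Continuous.tendsto (by fun_prop) t
        rw [sub_self] at this
        exact this.mono_left nhdsWithin_le_nhds
      · filter_upwards [self_mem_nhdsWithin] with s hs using mem_Ioi.2 (sub_pos.2 (mem_Ioi.1 hs))
    have e3 := (hasDerivAt_iff_isLittleO.1 h1).def hε
    have e4 : ∀ᶠ s in 𝓝 t, extChartAt (𝓡 n) (γ t) (γ s) ∈ Metric.ball z₀ r ∧
        γ s ∈ (extChartAt (𝓡 n) (γ t)).source := by
      refine (h1.continuousAt.eventually (Metric.ball_mem_nhds _ hr)).and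
        (hγ.continuousAt.eventually (extChartAt_source_mem_nhds (γ t)))
    have e5 : ∀ᶠ s in 𝓝 t, z₀ + (s - t) • v ∈ Metric.ball z₀ r := by
      have hc : ContinuousAt (fun s : ℝ => z₀ + (s - t) • v) t := by fun_prop
      exact hc.eventually_mem (by simpa using Metric.ball_mem_nhds z₀ hr)
    filter_upwards [e2.eventually e1, nhdsWithin_le_nhds e3, nhdsWithin_le_nhds e4,
      nhdsWithin_le_nhds e5, self_mem_nhdsWithin] with s h1 h3 h4 h5 hst
    have hst' : 0 < s - t := sub_pos.2 hst
    have h6 := hC _ h4.1 _ h5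
    rw [(extChartAt (𝓡 n) (γ t)).left_inv h4.2] at h6
    have h7 : w (γ s) - w (chartLine (γ t) z₀ v (s - t)) ≤ K * (C * (ε * (s - t))) := by
      refine (le_abs_self _).trans ((hK.dist_le_mul _ _).trans ?_)
      gcongr
      refine h6.trans ?_
      gcongr
      rw [Real.norm_of_nonneg hst'.le] at h3
      simp only [Function.comp_apply] at h3
      rwa [← sub_sub]
    rw [slope_def_field, div_le_iff₀ hst']
    simp only [Function.comp_apply]
    unfold lagrangianAlong
    linarith
  have hl : Tendsto (fun ε : ℝ => lagrangianAlong H γ t + ε + c + K * C * ε) (𝓝[>] 0)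
      (𝓝 (lagrangianAlong H γ t + 0 + c + K * C * 0)) :=
    (Continuous.tendsto (by fun_prop) 0).mono_left nhdsWithin_le_nhds
  simp only [add_zero, mul_zero] at hl
  exact ge_of_tendsto hl (by filter_upwards [self_mem_nhdsWithin] with ε hε using key ε hε)

/-- Applied to a constant curve, the derivative inequality bounds the admissible levels below, so
the infimum defining the critical value is not a default value. -/
theorem IsLipschitzSubsolution.neg_lagrangian_zero_le {c : ℝ} {w : M → ℝ}
    (hw : IsLipschitzSubsolution H c w) (x : M) : -lagrangian H x 0 ≤ c := by
  have h := hw.deriv_comp_le hH (γ := fun _ => x) (t := 0) mdifferentiableAt_const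
    (differentiableAt_const (w x))
  have e1 : deriv (w ∘ fun _ : ℝ => x) 0 = 0 := deriv_const 0 (w x)
  have e2 : lagrangianAlong H (fun _ : ℝ => x) 0 = lagrangian H x 0 := by
    have : velocity n (fun _ : ℝ => x) 0 = 0 := by
      unfold velocity
      rw [mfderiv_const]
      rfl
    rw [lagrangianAlong, this]
  rw [e1, e2] at h
  linarith

theorem criticalValue_le [Nonempty M] {c : ℝ} {w : M → ℝ} (hw : IsLipschitzSubsolution H c w) :
    criticalValue H ≤ c := by
  refine csInf_le ⟨-lagrangian H (Classical.arbitrary M) 0, ?_⟩ ⟨w, hw⟩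
  rintro c' ⟨w', hw'⟩
  exact IsLipschitzSubsolution.neg_lagrangian_zero_le hH hw' _

/-- The zero function is a subsolution at any level bounding H(·,0), so the infimum ranges over a
nonempty set and can be approached. -/
theorem exists_isLipschitzSubsolution [CompactSpace M] {ε : ℝ} (hε : 0 < ε) :
    ∃ (c : ℝ) (w : M → ℝ), c < criticalValue H + ε ∧ IsLipschitzSubsolution H c w := by
  have hne : {c : ℝ | ∃ w : M → ℝ, IsLipschitzSubsolution H c w}.Nonempty := by
    obtain ⟨C, -, hC⟩ := exists_pullHamiltonian_le (F := ℝ) hH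
      (contMDiff_const (c := (0 : ℝ))) 0
    refine ⟨C, fun _ => 0, ⟨0, LipschitzWith.const _⟩, fun x₀ => ae_of_all _ fun y _ =>
      ⟨mdifferentiableAt_const, ?_⟩⟩
    have h1 := hC ((chartAt (EuclideanSpace ℝ (Fin n)) x₀).symm y) 0 (by simp)
    have h2 : differential n (fun _ : M => (0 : ℝ))
        ((chartAt (EuclideanSpace ℝ (Fin n)) x₀).symm y) = 0 := mfderiv_const
    rw [h2]
    simpa [pullHamiltonian] using h1
  obtain ⟨c, ⟨w, hw⟩, hc⟩ := exists_lt_of_csInf_lt hne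
    (show sInf {c : ℝ | ∃ w : M → ℝ, IsLipschitzSubsolution H c w} < criticalValue H + ε from
      lt_add_of_pos_right _ hε)
  exact ⟨c, w, hc, hw⟩

variable [CompactSpace M] {F : Type*} [NormedAddCommGroup F] [NormedSpace ℝ F]
  [FiniteDimensional ℝ F] {f : M → F} (hf : IsBiLipschitzImmersion n f)

include hf

theorem IsLipschitzSubsolution.ae_deriv_comp_le {c : ℝ} {w : M → ℝ}
    (hw : IsLipschitzSubsolution H c w) {γ : ℝ → M} {a b : ℝ} (hab : a ≤ b)
    (hγ : AbsolutelyContinuousOnInterval γ a b) :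
    ∀ᵐ t ∂volume.restrict (Ioc a b), deriv (w ∘ γ) t ≤ lagrangianAlong H γ t + c := by
  obtain ⟨K, hK⟩ := hw.1
  have hd : ∀ᵐ s ∂volume.restrict (Icc a b), DifferentiableAt ℝ (w ∘ γ) s := by
    rw [ae_restrict_iff' measurableSet_Icc]
    have := (hK.comp_absolutelyContinuousOnInterval hγ).ae_differentiableAt
    rwa [uIcc_of_le hab] at this
  rw [← restrict_Ioc_eq_restrict_Icc] at hd
  filter_upwards [hd, ae_mdifferentiableAt_of_absolutelyContinuous hf hab hγ] with s h1 h2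
  exact hw.deriv_comp_le hH h2.2 h1

/-- Subsolutions at levels close to the critical value have uniformly bounded oscillation. -/
theorem exists_isLipschitzSubsolution_sub_le [ConnectedSpace M] :
    ∃ D : ℝ, 0 ≤ D ∧ ∀ (c : ℝ) (w : M → ℝ), c ≤ criticalValue H + 1 →
      IsLipschitzSubsolution H c w → ∀ x y, w x - w y ≤ D := by
  obtain ⟨K, hK⟩ := exists_forall_lipschitzWith
    (u := fun w : {w : M → ℝ // ∃ c ≤ criticalValue H + 1, IsLipschitzSubsolution H c w} => w.1) (by
      intro x₀
      obtain ⟨ℓ, K, U, hU, h⟩ := exists_joining_curve hH hf x₀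
      refine ⟨⟨ℓ + |criticalValue H + 1|, by positivity⟩ * K, U, hU, ?_⟩
      rintro ⟨w, c, hc, hw⟩ x hx y hy
      obtain ⟨T, γ, hT0, hT, rfl, rfl, hγ, hL⟩ := h y hy x hx
      -- The function's own Lipschitz constant only provides absolute continuity; it does not enter
      -- the common bound.
      obtain ⟨K', hK'⟩ := hw.1
      have hac : AbsolutelyContinuousOnInterval (w ∘ γ) 0 T :=
        hK'.comp_absolutelyContinuousOnInterval hγ
      have h1 : w (γ T) - w (γ 0) ≤ ∫ _ in (0 : ℝ)..T, (ℓ + |criticalValue H + 1|) := by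
        have := hac.integral_deriv_eq_sub
        simp only [Function.comp_apply] at this
        rw [← this]
        refine intervalIntegral.integral_mono_ae_restrict hT0 hac.intervalIntegrable_deriv
          intervalIntegrable_const ?_
        have hae := hw.ae_deriv_comp_le hH hf hT0 hγ
        rw [← restrict_Ioo_eq_restrict_Ioc] at hae
        rw [← restrict_Ioo_eq_restrict_Icc]
        filter_upwards [hae, ae_restrict_mem measurableSet_Ioo] with s hs hs'
        have := hL s hs'
        have := le_abs_self (criticalValue H + 1)
        linarith
      rw [intervalIntegral.integral_const, sub_zero, smul_eq_mul] at h1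
      change w (γ T) - w (γ 0) ≤ (ℓ + |criticalValue H + 1|) * K * dist (γ T) (γ 0)
      rw [dist_comm]
      calc _ ≤ (ℓ + |criticalValue H + 1|) * T := by linarith
        _ ≤ (ℓ + |criticalValue H + 1|) * (K * dist (γ 0) (γ T)) := by gcongr
        _ = _ := by ring)
  refine ⟨K * Metric.diam (univ : Set M), by positivity, fun c w hc hw x y => ?_⟩
  refine (le_abs_self _).trans (((hK ⟨w, c, hc, hw⟩).dist_le_mul x y).trans ?_)
  gcongr
  exact Metric.dist_le_diam_of_mem isCompact_univ.isBounded (mem_univ _) (mem_univ _)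

/-- Along a minimizer, a subsolution at level close to c(H), normalized to be nonnegative with value
D at the starting point, shows that the action over [0, k] is at least -D up to a small error. -/
theorem exists_neg_le_valueFunction [ConnectedSpace M] :
    ∃ D : ℝ, 0 ≤ D ∧ ∀ lam : ℝ, 0 < lam → ∀ x, -D ≤ valueFunction H lam x := by
  obtain ⟨D, hD0, hD⟩ := exists_isLipschitzSubsolution_sub_le hH hf
  refine ⟨D, hD0, fun lam hlam x => ?_⟩
  obtain ⟨γ, hγ, hi, hA⟩ := exists_isForwardMinimizer hlam hH hf x
  have hV : discountedAction H lam γ = valueFunction H lam x := hA.csInf_eq.symm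
  rw [← hV]
  refine ge_of_tendsto (intervalIntegral_tendsto_integral_Ioi 0 hi
    (tendsto_natCast_atTop_atTop (R := ℝ))) (Filter.Eventually.of_forall fun k : ℕ => ?_)
  have hk0 : (0 : ℝ) ≤ k := k.cast_nonneg
  set I : ℝ := ∫ s in (0 : ℝ)..k, Real.exp (-lam * s) with hI
  have hii : IntervalIntegrable (runningCost H lam γ) volume 0 k :=
    (intervalIntegrable_iff_integrableOn_Ioc_of_le hk0).2 (hi.mono_set Ioc_subset_Ioi_self)
  have he : IntervalIntegrable (fun s : ℝ => Real.exp (-lam * s)) volume 0 k :=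
    Continuous.intervalIntegrable (by fun_prop) _ _
  have key : ∀ ε : ℝ, 0 < ε → ε ≤ 1 →
      -D ≤ (∫ s in (0 : ℝ)..k, runningCost H lam γ s) + ε * I := by
    intro ε hε hε1
    obtain ⟨c, w, hc, hw⟩ := exists_isLipschitzSubsolution hH hε
    have hDw := hD c w (by linarith) hw
    obtain ⟨K, hK⟩ := hw.1
    have hacγ := hγ.2 k hk0
    -- The oscillation bound makes this function nonnegative, so the discount term -λg and the final
    -- value can be dropped with the right sign.
    have hac : AbsolutelyContinuousOnInterval (fun s => w (γ s) + (D - w x)) 0 k := by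
      refine ((isometry_add_right (D - w x)).lipschitz.comp
        hK).comp_absolutelyContinuousOnInterval hacγ
    have hint : IntervalIntegrable
        (fun s => Real.exp (-lam * s) * (lagrangianAlong H γ s + criticalValue H + ε))
        volume 0 k := by
      refine (hii.add (he.const_mul ε)).congr ?_
      exact fun s _ => by simp only [runningCost_eq]; ring
    have h1 := exp_mul_sub_le_integral hk0 hac hint (by
      filter_upwards [hw.ae_deriv_comp_le hH hf hk0 hacγ] with s hs
      have e : deriv (fun s => w (γ s) + (D - w x)) s = deriv (w ∘ γ) s := deriv_add_const _
      rw [e]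
      have := mul_nonneg hlam.le (show 0 ≤ w (γ s) + (D - w x) by linarith [hDw x (γ s)])
      linarith)
    have h2 : ∫ s in (0 : ℝ)..k,
        Real.exp (-lam * s) * (lagrangianAlong H γ s + criticalValue H + ε) =
        (∫ s in (0 : ℝ)..k, runningCost H lam γ s) + ε * I := by
      rw [hI, ← intervalIntegral.integral_const_mul, ← intervalIntegral.integral_add hii
        (he.const_mul ε)]
      refine intervalIntegral.integral_congr fun s _ => ?_
      simp only [runningCost_eq]
      ring
    rw [h2, hγ.1] at h1
    have h3 := mul_nonneg (Real.exp_nonneg (-lam * k))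
      (show 0 ≤ w (γ k) + (D - w x) by linarith [hDw x (γ k)])
    linarith
  have hl : Tendsto (fun ε : ℝ => (∫ s in (0 : ℝ)..k, runningCost H lam γ s) + ε * I) (𝓝[>] 0)
      (𝓝 ((∫ s in (0 : ℝ)..k, runningCost H lam γ s) + 0 * I)) :=
    (Continuous.tendsto (by fun_prop) 0).mono_left nhdsWithin_le_nhds
  rw [zero_mul, add_zero] at hl
  refine ge_of_tendsto hl ?_
  filter_upwards [Ioo_mem_nhdsGT one_pos] with ε hε using key ε hε.1 hε.2.le

end Subsolution


/-! ### An exponential integral -/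

section Exponential

theorem integral_exp_mul_eq {lam : ℝ} (hlam : lam ≠ 0) (T : ℝ) :
    lam * ∫ s in (0 : ℝ)..T, Real.exp (-lam * s) = 1 - Real.exp (-lam * T) := by
  rw [intervalIntegral.integral_comp_mul_left _ (neg_ne_zero.2 hlam), integral_exp, smul_eq_mul]
  simp
  field_simp
  ring

end Exponential

/-! ### Rademacher's theorem on the manifold -/

section Rademacher

variable {n : ℕ} {M : Type*} [MetricSpace M] [ChartedSpace (EuclideanSpace ℝ (Fin n)) M]
  [IsManifold (𝓡 n) ∞ M]
  {F : Type*} [NormedAddCommGroup F] [NormedSpace ℝ F] [FiniteDimensional ℝ F]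
  {f : M → F} (hf : IsBiLipschitzImmersion n f)

include hf

/-- Inverse charts are locally Lipschitz. -/
theorem exists_lipschitzOnWith_extChartAt_symm {x₀ : M} {z : EuclideanSpace ℝ (Fin n)}
    (hz : z ∈ (extChartAt (𝓡 n) x₀).target) :
    ∃ K : ℝ≥0, ∃ U, IsOpen U ∧ z ∈ U ∧ LipschitzOnWith K (extChartAt (𝓡 n) x₀).symm U := by
  have h1 := contDiffAt_comp_extChartAt_symm (x₀ := x₀)
    (hf.contMDiff ((extChartAt (𝓡 n) x₀).symm z)) ((extChartAt (𝓡 n) x₀).map_target hz)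
  rw [(extChartAt (𝓡 n) x₀).right_inv hz] at h1
  obtain ⟨K, U, hU, hK⟩ := h1.exists_lipschitzOnWith
  obtain ⟨K', hK'⟩ := hf.antilipschitz
  obtain ⟨U', hU', hoU, hzU⟩ := mem_nhds_iff.1 hU
  refine ⟨K' * K, U', hoU, hzU, LipschitzOnWith.of_dist_le_mul fun x hx y hy => ?_⟩
  refine (hK'.le_mul_dist _ _).trans ?_
  push_cast
  rw [mul_assoc]
  gcongr
  exact hK.dist_le_mul x (hU' hx) y (hU' hy)

/-- Rademacher's theorem on a manifold. -/
theorem almostEverywhere_mdifferentiableAt {w : M → ℝ} {K : ℝ≥0} (hw : LipschitzWith K w) :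
    AlmostEverywhere n fun x => MDifferentiableAt (𝓡 n) 𝓘(ℝ, ℝ) w x := by
  intro x₀
  set S : Set (EuclideanSpace ℝ (Fin n)) := {y | y ∈ (extChartAt (𝓡 n) x₀).target ∧
    ¬ DifferentiableAt ℝ (w ∘ (extChartAt (𝓡 n) x₀).symm) y} with hS
  -- Being null is a local property, and locally the function read in the chart is Lipschitz.
  have hS0 : volume S = 0 := by
    refine measure_null_of_locally_null S fun z hz => ?_
    obtain ⟨K', U, hUo, hzU, hU⟩ := exists_lipschitzOnWith_extChartAt_symm hf hz.1
    have h1 := (hw.comp_lipschitzOnWith hU).ae_differentiableWithinAt_of_mem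
      (μ := (volume : Measure (EuclideanSpace ℝ (Fin n))))
    refine ⟨S ∩ U, Filter.inter_mem self_mem_nhdsWithin
      (nhdsWithin_le_nhds (hUo.mem_nhds hzU)), ?_⟩
    refine measure_mono_null (fun y hy => ?_) (ae_iff.1 h1)
    exact fun h2 => hy.1.2 ((h2 hy.2).differentiableAt (hUo.mem_nhds hy.2))
  filter_upwards [measure_eq_zero_iff_ae_notMem.1 hS0] with y hy hyt
  have hyt' : y ∈ (extChartAt (𝓡 n) x₀).target := by simpa using hyt
  have h1 : DifferentiableAt ℝ (w ∘ (extChartAt (𝓡 n) x₀).symm) y := by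
    by_contra hcon
    exact hy ⟨hyt', hcon⟩
  have h2 := mdifferentiableAt_iff_comp_extChartAt_symm (f := w)
    ((extChartAt (𝓡 n) x₀).map_target hyt')
  rw [(extChartAt (𝓡 n) x₀).right_inv hyt'] at h2
  exact h2.2 h1

end Rademacher

/-! ### Viscosity properties and the uniform bound on the value -/

section Viscosity

variable {n : ℕ} {M : Type*} [MetricSpace M] [ChartedSpace (EuclideanSpace ℝ (Fin n)) M]
  [IsManifold (𝓡 n) ∞ M] [CompactSpace M]
  {F : Type*} [NormedAddCommGroup F] [NormedSpace ℝ F] [FiniteDimensional ℝ F]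
  [RiemannianBundle (fun x : M => TangentSpace (𝓡 n) x)]
  {H : ∀ x : M, Cotangent n x → ℝ} (hH : IsTonelliHamiltonian H)
  {f : M → F} (hf : IsBiLipschitzImmersion n f)
  [IsContMDiffRiemannianBundle (𝓡 n) ∞ (EuclideanSpace ℝ (Fin n))
    (fun x : M => TangentSpace (𝓡 n) x)] [IsRiemannianManifold (𝓡 n) M]
  {lam : ℝ} (hlam : 0 < lam)

include hH hf hlam

/-- Dynamic programming along the chart line of velocity `v`, differentiated at time 0.
Differentiability of φ at `x` alone suffices, so the value function can serve as its own test
function. -/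
theorem mul_valueFunction_sub_le {φ : M → ℝ} {x : M}
    (hφ : MDifferentiableAt (𝓡 n) 𝓘(ℝ, ℝ) φ x)
    (hmax : IsLocalMax (fun y => valueFunction H lam y - φ y) x) (v : TangentSpace (𝓡 n) x) :
    lam * valueFunction H lam x - differential n φ x v ≤ lagrangian H x v + criticalValue H := by
  refine le_of_forall_pos_le_add fun ε hε => ?_
  set V := valueFunction H lam with hV
  set ℓ := lagrangian H x v + ε with hℓ
  obtain ⟨C, r, hr, hrt, hrL, hC⟩ := exists_ball_chart (n := n) x
    ((eventually_lagrangian_le_add hH x v hε).and hmax)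
  set z := extChartAt (𝓡 n) x x with hz
  set w := mdiff n (extChartAt (𝓡 n) x) x v with hw
  set γ := chartLine x z w with hγ
  have hγ0 : γ 0 = x := chartLine_extChartAt_zero (mem_extChartAt_source x) w
  have hφγ : HasDerivAt (φ ∘ γ) (differential n φ x v) 0 := by
    have h1 := (mdifferentiableAt_iff_comp_extChartAt_symm (mem_extChartAt_source x)).1 hφ
    have h2 : differential n φ x v =
        fderiv ℝ (φ ∘ (extChartAt (𝓡 n) x).symm) z w :=
      mdiff_eq_fderiv_chart hφ (mem_extChartAt_source x) v
    rw [h2]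
    have h3 : HasFDerivAt (φ ∘ (extChartAt (𝓡 n) x).symm)
      (fderiv ℝ (φ ∘ (extChartAt (𝓡 n) x).symm) z) (z + (0 : ℝ) • w) := by
      rw [zero_smul, add_zero]
      exact h1.hasFDerivAt
    exact h3.comp_hasDerivAt 0 (hasDerivAt_add_smul z w 0)
  -- Here V along the line has been replaced by the test function. The difference `g - G` vanishes
  -- at 0 and is nonpositive just after, so its derivative there is nonpositive.
  set g : ℝ → ℝ := fun h => V x - Real.exp (-lam * h) * (V x + (φ ∘ γ) h - φ x) with hg
  set G : ℝ → ℝ := fun h => ∫ s in (0 : ℝ)..h, Real.exp (-lam * s) * (ℓ + criticalValue H) with hG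
  have hg' : HasDerivAt g (lam * V x - differential n φ x v) 0 := by
    have he : HasDerivAt (fun s : ℝ => Real.exp (-lam * s)) (Real.exp (-lam * 0) * -lam) 0 := by
      simpa using ((hasDerivAt_id (0 : ℝ)).const_mul (-lam)).exp
    have := (he.mul ((hφγ.const_add (V x)).sub_const (φ x))).const_sub (V x)
    refine this.congr_deriv ?_
    simp [hγ0]
    ring
  have hG' : HasDerivAt G (ℓ + criticalValue H) 0 := by
    have hc : Continuous fun s : ℝ => Real.exp (-lam * s) * (ℓ + criticalValue H) := by fun_prop
    refine (hc.integral_hasStrictDerivAt 0 0).hasDerivAt.congr_deriv ?_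
    simp
  have hsub : ∀ᶠ h in 𝓝[>] (0 : ℝ), g h - G h ≤ 0 := by
    have hsmall : ∀ᶠ h in 𝓝[>] (0 : ℝ), z + h • w ∈ Metric.ball z r := by
      have hc : ContinuousAt (fun h : ℝ => z + h • w) 0 := by fun_prop
      exact (hc.eventually_mem (by simpa using Metric.ball_mem_nhds z hr)).filter_mono
        nhdsWithin_le_nhds
    filter_upwards [hsmall, self_mem_nhdsWithin] with h hh h0
    replace h0 : 0 < h := h0
    have hmem : ∀ s ∈ Icc 0 h, z + s • w ∈ Metric.ball z r := fun s hs =>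
      add_smul_mem_ball (Metric.mem_ball_self hr) hh hs
    have h1 := valueFunction_sub_le_of_lagrangianAlong_le hH hf hlam (γ := γ) (ℓ := ℓ) h0.le
      (absolutelyContinuousOnInterval_chartLine hC fun s hs =>
        hmem s (by rwa [uIcc_of_le h0.le] at hs)) (fun s hs => by
        have hm := hmem s ⟨hs.1.le, hs.2.le⟩
        exact (hrL _ hm).1 _ (mdiff_velocity_chartLine (hrt hm)))
    rw [hγ0] at h1
    have h2 : V (γ h) - φ (γ h) ≤ V x - φ x := (hrL _ hh).2
    have h3 : Real.exp (-lam * h) * V (γ h) ≤ Real.exp (-lam * h) * (V x + (φ ∘ γ) h - φ x) := by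
      gcongr
      simp only [Function.comp_apply]
      linarith
    simp only [hg, hG]
    linarith
  have hs := (hasDerivAt_iff_tendsto_slope.1 (hg'.sub hG')).mono_left
    (nhdsWithin_mono (s := Ioi 0) _ fun s hs => ne_of_gt hs)
  have h4 := le_of_tendsto (b := 0) hs (by
    filter_upwards [hsub, self_mem_nhdsWithin] with h h1 h2
    have e0 : g 0 - G 0 = 0 := by simp [hg, hG, hγ0]
    rw [slope_def_field]
    refine div_nonpos_of_nonpos_of_nonneg ?_ (by simpa using le_of_lt (mem_Ioi.1 h2))
    simp only [Pi.sub_apply, e0]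
    linarith)
  linarith

theorem add_symHamiltonian_le {φ : M → ℝ} {x : M}
    (hφ : MDifferentiableAt (𝓡 n) 𝓘(ℝ, ℝ) φ x)
    (hmax : IsLocalMax (fun y => valueFunction H lam y - φ y) x) :
    lam * valueFunction H lam x + symHamiltonian H x (differential n φ x) ≤ criticalValue H := by
  have h : symHamiltonian H x (differential n φ x) ≤
      criticalValue H - lam * valueFunction H lam x := by
    refine ciSup_le fun v => ?_
    have h1 := mul_valueFunction_sub_le hH hf hlam hφ hmax (-v)
    rw [map_neg] at h1
    unfold symLagrangian
    linarith
  linarith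

theorem le_add_symHamiltonian {φ : M → ℝ} {x : M}
    (hφ : ContMDiff (𝓡 n) 𝓘(ℝ, ℝ) 1 φ)
    (hmin : IsLocalMin (fun y => valueFunction H lam y - φ y) x) :
    criticalValue H ≤ lam * valueFunction H lam x + symHamiltonian H x (differential n φ x) := by
  rw [symHamiltonian_eq hH]
  refine le_of_forall_pos_le_add fun ε hε => ?_
  set V := valueFunction H lam with hV
  obtain ⟨K, hK⟩ := exists_lipschitzWith_of_contMDiff hφ
  obtain ⟨γ, hγm⟩ := exists_isForwardMinimizer hlam hH hf x
  have hγ := hγm.1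
  set h₀ : ℝ := H x (-differential n φ x) with hh₀
  have hcd : ContinuousAt (fun y => H y (-differential n φ y) + lam * (φ y - φ x)) x := by
    -- Pulling back minus the identity of ℝ by φ gives -dφ, so y ↦ H(y, -d_yφ) is continuous at `x`.
    have h1 := continuousAt_pullHamiltonian (F := ℝ) hH.continuous (hφ x) (-ContinuousLinearMap.id ℝ ℝ)
    have h2 : ContinuousAt (fun y => pullHamiltonian H φ y (-ContinuousLinearMap.id ℝ ℝ)) x :=
      ContinuousAt.comp (f := fun y => (y, -ContinuousLinearMap.id ℝ ℝ)) h1 (by fun_prop)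
    refine ContinuousAt.add h2 ?_
    exact continuousAt_const.mul (hK.continuous.continuousAt.sub continuousAt_const)
  have hev : ∀ᶠ y in 𝓝 x, H y (-differential n φ y) + lam * (φ y - φ x) < h₀ + ε ∧
      V x - φ x ≤ V y - φ y := by
    refine (hcd.eventually (gt_mem_nhds ?_)).and hmin
    simpa [hh₀] using hε
  have hcγ := continuousOn_of_absolutelyContinuousOnInterval (hγ.2 1 zero_le_one)
  rw [uIcc_of_le zero_le_one] at hcγ
  have h1 : Tendsto γ (𝓝[≥] 0) (𝓝 x) := by
    have := hcγ 0 (by simp)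
    rw [ContinuousWithinAt, hγ.1, nhdsWithin_Icc_eq_nhdsGE zero_lt_one] at this
    exact this
  obtain ⟨T, hT, hTs⟩ := mem_nhdsGE_iff_exists_Icc_subset.1 (h1.eventually hev)
  replace hT : 0 < T := hT
  have hacγ := hγ.2 T hT.le
  have hval := hγm.valueFunction_eq hlam hH hf hT.le
  have hii : IntervalIntegrable (runningCost H lam γ) volume 0 T :=
    (intervalIntegrable_iff_integrableOn_Ioc_of_le hT.le).2 (hγm.2.1.mono_set Ioc_subset_Ioi_self)
  have he : IntervalIntegrable (fun s : ℝ => Real.exp (-lam * s)) volume 0 T :=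
    Continuous.intervalIntegrable (by fun_prop) _ _
  set I : ℝ := ∫ s in (0 : ℝ)..T, Real.exp (-lam * s) with hI
  have hIpos : 0 < I := intervalIntegral.intervalIntegral_pos_of_pos he (fun s => Real.exp_pos _) hT
  have hlamI : lam * I = 1 - Real.exp (-lam * T) := by
    have h := integral_exp_mul_eq hlam.ne' T
    rw [← hI] at h
    exact h
  -- Fenchel's inequality with covector -dφ bounds the discounted derivative of this function along
  -- the minimizer. Working in integrated form avoids any velocity of the minimizer at time 0.
  have hac : AbsolutelyContinuousOnInterval (fun s => φ x - φ (γ s)) 0 T := by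
    refine ((IsometryEquiv.subLeft (φ x)).isometry.lipschitz.comp hK).comp_absolutelyContinuousOnInterval hacγ
  have hint : IntervalIntegrable (fun s => Real.exp (-lam * s) *
      (lagrangianAlong H γ s + criticalValue H + (h₀ + ε - criticalValue H))) volume 0 T := by
    refine (hii.add (he.const_mul (h₀ + ε - criticalValue H))).congr ?_
    exact fun s _ => by simp only [runningCost_eq]; ring
  have h2 := exp_mul_sub_le_integral hT.le hac hint (by
    filter_upwards [ae_mdifferentiableAt_of_absolutelyContinuous hf hT.le hacγ,
      ae_restrict_mem measurableSet_Ioc] with s hs hs'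
    have hm := (hφ (γ s)).mdifferentiableAt one_ne_zero
    have h3 := deriv_comp_eq_mdiff_velocity hm hs.2
    have h4 : HasDerivAt (fun s => φ x - φ (γ s)) (-(mdiff n φ (γ s) (velocity n γ s))) s :=
      h3.const_sub (φ x)
    have h5 := sub_le_lagrangian hH (γ s) (velocity n γ s) (-differential n φ (γ s))
    rw [neg_apply] at h5
    have h6 := (hTs ⟨hs'.1.le, hs'.2⟩).1
    rw [h4.deriv]
    unfold lagrangianAlong
    change -differential n φ (γ s) (velocity n γ s) - _ ≤ _
    linarith)
  have h7 : ∫ s in (0 : ℝ)..T, Real.exp (-lam * s) *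
      (lagrangianAlong H γ s + criticalValue H + (h₀ + ε - criticalValue H)) =
      (∫ s in (0 : ℝ)..T, runningCost H lam γ s) + (h₀ + ε - criticalValue H) * I := by
    rw [hI, ← intervalIntegral.integral_const_mul, ← intervalIntegral.integral_add hii
      (he.const_mul _)]
    refine intervalIntegral.integral_congr fun s _ => ?_
    simp only [runningCost_eq]
    ring
  rw [h7, hγ.1, sub_self, sub_zero] at h2
  have h8 := (hTs ⟨hT.le, le_rfl⟩).2
  have h9 : Real.exp (-lam * T) * (V x - φ x + φ (γ T)) ≤ Real.exp (-lam * T) * V (γ T) := by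
    gcongr
    linarith
  -- Calibration and the minimum condition cancel the values of φ, leaving 1 - e^{-λT} = λI times
  -- V(x).
  have h10 : 0 ≤ (lam * V x + h₀ + ε - criticalValue H) * I := by
    have : lam * V x * I = V x * (1 - Real.exp (-lam * T)) := by rw [← hlamI]; ring
    nlinarith
  have h11 := nonneg_of_mul_nonneg_left h10 hIpos
  linarith

/-- Otherwise the minimum of V is positive, and -V is a Lipschitz subsolution at level c(H) - λ min
V, against the definition of the critical value. -/
theorem exists_valueFunction_nonpos [ConnectedSpace M] :
    ∃ x, valueFunction H lam x ≤ 0 := by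
  obtain ⟨K, hK⟩ := exists_lipschitzWith_valueFunction hH hf
  obtain ⟨x, -, hx⟩ := isCompact_univ.exists_isMinOn univ_nonempty
    (hK lam hlam).continuous.continuousOn
  refine ⟨x, ?_⟩
  by_contra! hpos
  have hw : IsLipschitzSubsolution H (criticalValue H - lam * valueFunction H lam x)
      fun y => -valueFunction H lam y := by
    refine ⟨⟨K, (hK lam hlam).neg⟩, fun x₀ => ?_⟩
    filter_upwards [almostEverywhere_mdifferentiableAt hf (hK lam hlam) x₀] with y hy hyt
    have hd := hy hyt
    refine ⟨hd.neg, ?_⟩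
    -- At a point of differentiability V is tested by itself, V - V being constant.
    have h1 := add_symHamiltonian_le hH hf hlam hd
      (Filter.Eventually.of_forall fun z => by simp)
    rw [symHamiltonian_eq hH] at h1
    have h2 : differential n (fun y => -valueFunction H lam y)
        ((chartAt (EuclideanSpace ℝ (Fin n)) x₀).symm y) =
        -differential n (valueFunction H lam)
          ((chartAt (EuclideanSpace ℝ (Fin n)) x₀).symm y) := mfderiv_neg
    rw [h2]
    have h3 := mul_le_mul_of_nonneg_left (hx (mem_univ
      ((chartAt (EuclideanSpace ℝ (Fin n)) x₀).symm y))) hlam.le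
    linarith
  have h4 := criticalValue_le hH hw
  have := mul_pos hlam hpos
  linarith

omit hlam in
-- The upper bound spreads from a point where V ≤ 0 through the uniform Lipschitz constant and the
-- diameter.
theorem exists_abs_valueFunction_le [ConnectedSpace M] :
    ∃ C : ℝ, ∀ lam : ℝ, 0 < lam → ∀ x, |valueFunction H lam x| ≤ C := by
  obtain ⟨D, hD0, hD⟩ := exists_neg_le_valueFunction hH hf
  obtain ⟨K, hK⟩ := exists_lipschitzWith_valueFunction hH hf
  refine ⟨D + K * Metric.diam (univ : Set M), fun lam hlam x => abs_le.2 ⟨?_, ?_⟩⟩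
  · have h1 := hD lam hlam x
    have : 0 ≤ K * Metric.diam (univ : Set M) := by positivity
    linarith
  · obtain ⟨y, hy⟩ := exists_valueFunction_nonpos hH hf hlam
    have h1 := (le_abs_self _).trans ((hK lam hlam).dist_le_mul x y)
    have h2 : K * dist x y ≤ K * Metric.diam (univ : Set M) := by
      gcongr
      exact Metric.dist_le_diam_of_mem isCompact_univ.isBounded (mem_univ _) (mem_univ _)
    linarith

theorem isViscositySolution_valueFunction [ConnectedSpace M] :
    IsViscositySolution (symHamiltonian H) lam (criticalValue H) (valueFunction H lam) := by
  obtain ⟨K, hK⟩ := exists_lipschitzWith_valueFunction hH hf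
  exact ⟨(hK lam hlam).continuous,
    fun φ x hφ hmax => add_symHamiltonian_le hH hf hlam ((hφ x).mdifferentiableAt one_ne_zero) hmax,
    fun φ x hφ hmin => le_add_symHamiltonian hH hf hlam hφ hmin⟩

end Viscosity


/-! ### Comparison by doubling of variables -/

section Comparison

variable {n : ℕ} {M : Type*} [MetricSpace M] [ChartedSpace (EuclideanSpace ℝ (Fin n)) M]
  [IsManifold (𝓡 n) ∞ M] [CompactSpace M]
  {F : Type*} [NormedAddCommGroup F]

theorem differential_comp [NormedSpace ℝ F] {G : F → ℝ} {G' : F →L[ℝ] ℝ} {f : M → F} {x : M}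
    (hG : HasFDerivAt G G' (f x))
    (hf : MDifferentiableAt (𝓡 n) 𝓘(ℝ, F) f x) :
    differential n (G ∘ f) x = G'.comp (mdiff n f x) := by
  have h := mfderiv_comp (I := 𝓡 n) (I' := 𝓘(ℝ, F)) (I'' := 𝓘(ℝ, ℝ)) x
    hG.differentiableAt.mdifferentiableAt hf
  rw [mfderiv_eq_fderiv, hG.fderiv] at h
  exact h

variable [InnerProductSpace ℝ F]

theorem hasFDerivAt_norm_sub_sq_mul (p v : F) (a : ℝ) :
    HasFDerivAt (fun v : F => a * ‖v - p‖ ^ 2) ((2 * a) • innerSL ℝ (v - p)) v := by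
  have h := (((hasFDerivAt_id v).sub_const p).norm_sq).const_mul a
  refine h.congr_fderiv ?_
  ext w
  simp
  ring

variable [FiniteDimensional ℝ F] [RiemannianBundle (fun x : M => TangentSpace (𝓡 n) x)]
  {H : ∀ x : M, Cotangent n x → ℝ} (hH : IsTonelliHamiltonian H)
  {f : M → F} (hf : IsBiLipschitzImmersion n f) {lam c : ℝ} (hlam : 0 < lam)

include hH hf hlam

/-- Comparison between viscosity subsolutions and supersolutions, one of which is Lipschitz. -/
theorem IsViscositySolution.le_of_lipschitz {u w : M → ℝ}
    (hu : IsViscositySolution (symHamiltonian H) lam c u)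
    (hw : IsViscositySolution (symHamiltonian H) lam c w)
    (hlip : (∃ K : ℝ≥0, LipschitzWith K u) ∨ ∃ K : ℝ≥0, LipschitzWith K w) (z : M) :
    u z ≤ w z := by
  obtain ⟨K, hK⟩ : ∃ K : ℝ≥0, LipschitzWith K u ∨ LipschitzWith K w := by
    rcases hlip with ⟨K, h⟩ | ⟨K, h⟩
    exacts [⟨K, Or.inl h⟩, ⟨K, Or.inr h⟩]
  obtain ⟨K', hK'⟩ := hf.antilipschitz
  -- A bound on the penalization covector `q`, independent of `ε`; uniform continuity of the
  -- Hamiltonian is used only on this ball.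
  set R : ℝ := 2 * K * K' with hR
  have hR0 : 0 ≤ R := by positivity
  have : ProperSpace (F →L[ℝ] ℝ) := FiniteDimensional.proper ℝ _
  have hcH : Continuous fun z : M × (F →L[ℝ] ℝ) => pullHamiltonian H f z.1 z.2 :=
    continuous_iff_continuousAt.2 fun z =>
      continuousAt_pullHamiltonian hH.continuous (hf.contMDiff z.1) z.2
  have huc := ((isCompact_univ (X := M)).prod (isCompact_closedBall (0 : F →L[ℝ] ℝ)
    R)).uniformContinuousOn_of_continuous hcH.continuousOn
  refine le_of_forall_pos_le_add fun η hη => ?_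
  obtain ⟨δ, hδ, hδη⟩ := Metric.uniformContinuousOn_iff.1 huc (lam * η) (by positivity)
  -- Since d(x,y) ≤ K' R ε at the maximum point, this choice forces d(x,y) < δ.
  set ε : ℝ := δ / (2 * (K' * R + 1)) with hε
  have hε0 : 0 < ε := by positivity
  have hfc := hf.contMDiff.continuous
  -- The penalization uses the embedded distance: its square is C¹, so its partial functions are
  -- admissible tests.
  have hΦ : Continuous fun p : M × M => u p.1 - w p.2 - (2 * ε)⁻¹ * ‖f p.1 - f p.2‖ ^ 2 := by
    have h1 := hu.continuous
    have h2 := hw.continuous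
    fun_prop
  obtain ⟨⟨x, y⟩, -, hxy⟩ := (isCompact_univ (X := M × M)).exists_isMaxOn ⟨(z, z), mem_univ _⟩
    hΦ.continuousOn
  have hmax : ∀ x' y', u x' - w y' - (2 * ε)⁻¹ * ‖f x' - f y'‖ ^ 2 ≤
      u x - w y - (2 * ε)⁻¹ * ‖f x - f y‖ ^ 2 := fun x' y' => hxy (mem_univ (x', y'))
  set q : F →L[ℝ] ℝ := ε⁻¹ • innerSL ℝ (f x - f y) with hq
  have hqn : ‖q‖ = ε⁻¹ * ‖f x - f y‖ := by
    rw [hq, norm_smul, innerSL_apply_norm, Real.norm_of_nonneg (by positivity)]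
  have hd0 := norm_nonneg (f x - f y)
  have hqR : ‖q‖ ≤ R := by
    -- The maximum is compared with the diagonal point that leaves the non-Lipschitz function at its
    -- own argument.
    have h1 : (2 * ε)⁻¹ * ‖f x - f y‖ ^ 2 ≤ K * dist x y := by
      rcases hK with hK | hK
      · have h2 := hmax y y
        have h3 := (le_abs_self _).trans (hK.dist_le_mul x y)
        simp only [sub_self, norm_zero] at h2
        linarith
      · have h2 := hmax x x
        have h3 := (neg_le_abs _).trans (hK.dist_le_mul y x)
        rw [dist_comm y x] at h3
        simp only [sub_self, norm_zero] at h2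
        linarith
    have h4 : dist x y ≤ K' * ‖f x - f y‖ := by
      rw [← dist_eq_norm]
      exact hK'.le_mul_dist x y
    rw [hqn]
    rcases hd0.eq_or_lt with h5 | h5
    · rw [← h5, mul_zero]
      exact hR0
    · have h6 : (2 * ε)⁻¹ * ‖f x - f y‖ * ‖f x - f y‖ ≤ K * K' * ‖f x - f y‖ := by
        calc _ = (2 * ε)⁻¹ * ‖f x - f y‖ ^ 2 := by ring
          _ ≤ K * dist x y := h1
          _ ≤ K * (K' * ‖f x - f y‖) := by gcongr
          _ = _ := by ring
      have h7 := le_of_mul_le_mul_right h6 h5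
      calc _ = 2 * ((2 * ε)⁻¹ * ‖f x - f y‖) := by field_simp
        _ ≤ 2 * (K * K') := by gcongr
        _ = R := by rw [hR]; ring
  have hdist : dist x y < δ := by
    have h1 : ‖f x - f y‖ = ε * ‖q‖ := by rw [hqn]; field_simp
    calc dist x y ≤ K' * dist (f x) (f y) := hK'.le_mul_dist x y
      _ = K' * ‖q‖ * ε := by rw [dist_eq_norm, h1]; ring
      _ ≤ (K' * R + 1) * ε := by
        gcongr
        have : (K' : ℝ) * ‖q‖ ≤ K' * R := by gcongr
        linarith
      _ = δ / 2 := by rw [hε]; field_simp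
      _ < δ := half_lt_self hδ
  have hm : ∀ x, MDifferentiableAt (𝓡 n) 𝓘(ℝ, F) f x := fun x =>
    (hf.contMDiff x).mdifferentiableAt one_ne_zero
  have hsmooth : ∀ (p : F) (a : ℝ),
      ContMDiff (𝓡 n) 𝓘(ℝ, ℝ) 1 ((fun v : F => a * ‖v - p‖ ^ 2) ∘ f) := fun p a => by
    refine ContDiff.comp_contMDiff ?_ hf.contMDiff
    exact contDiff_const.mul ((contDiff_id.sub contDiff_const).norm_sq ℝ)
  have hsub : lam * u x + pullHamiltonian H f x (-q) ≤ c := by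
    have h1 := hu.subsolution _ x (hsmooth (f y) (2 * ε)⁻¹)
      (Filter.Eventually.of_forall fun x' => by
        have := hmax x' y
        simp only [Function.comp_apply]
        linarith)
    rw [symHamiltonian_eq hH, differential_comp (hasFDerivAt_norm_sub_sq_mul _ _ _) (hm x)] at h1
    have e : (2 * (2 * ε)⁻¹) • innerSL ℝ (f x - f y) = q := by
      rw [hq]
      congr 1
      field_simp
    rw [e] at h1
    exact h1
  -- Differentiating the penalization in the second variable produces the same `q`, so the two
  -- inequalities differ only in the base point of the Hamiltonian.
  have hsup : c ≤ lam * w y + pullHamiltonian H f y (-q) := by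
    have h1 := hw.supersolution _ y (hsmooth (f x) (-(2 * ε)⁻¹))
      (Filter.Eventually.of_forall fun y' => by
        have := hmax x y'
        simp only [Function.comp_apply]
        rw [norm_sub_rev (f y), norm_sub_rev (f y')]
        linarith)
    rw [symHamiltonian_eq hH, differential_comp (hasFDerivAt_norm_sub_sq_mul _ _ _) (hm y)] at h1
    have e : (2 * -(2 * ε)⁻¹) • innerSL ℝ (f y - f x) = q := by
      rw [hq, ← neg_sub (f x) (f y), map_neg, smul_neg, ← neg_smul]
      congr 1
      field_simp
    rw [e] at h1
    exact h1
  have hnq : -q ∈ Metric.closedBall (0 : F →L[ℝ] ℝ) R := by simpa using hqR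
  have h1 := hδη (y, -q) ⟨mem_univ _, hnq⟩ (x, -q) ⟨mem_univ _, hnq⟩ (by
    rw [Prod.dist_eq, dist_self, dist_comm]
    exact max_lt hdist hδ)
  have h2 := (le_abs_self _).trans h1.le
  simp only at h2
  have h3 : lam * (u x - w y) ≤ lam * η := by linarith
  have h4 := le_of_mul_le_mul_left h3 hlam
  have h5 := hmax z z
  simp only [sub_self, norm_zero] at h5
  have h6 : 0 ≤ (2 * ε)⁻¹ * ‖f x - f y‖ ^ 2 := by positivity
  linarith

end Comparison

end DiscountedHJ

/-! ### The theorem -/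

theorem mainTheorem3 {n : ℕ} {M : Type*} [MetricSpace M]
    [ChartedSpace (EuclideanSpace ℝ (Fin n)) M] [IsManifold (𝓡 n) ∞ M]
    [CompactSpace M] [ConnectedSpace M]
    [RiemannianBundle (fun x : M => TangentSpace (𝓡 n) x)]
    [IsContMDiffRiemannianBundle (𝓡 n) ∞ (EuclideanSpace ℝ (Fin n))
      (fun x : M => TangentSpace (𝓡 n) x)]
    [IsRiemannianManifold (𝓡 n) M]
    (H : ∀ x : M, DiscountedHJ.Cotangent n x → ℝ)
    (hcont : DiscountedHJ.ContinuousOnCotangentBundle H)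
    (hconv : ∀ x : M, ConvexOn ℝ Set.univ (H x))
    (hsuper : DiscountedHJ.IsSuperlinear H) :
    (∃ (K : ℝ≥0) (C : ℝ), ∀ lam : ℝ, 0 < lam → lam ≤ 1 →
      LipschitzWith K (DiscountedHJ.uPlus H lam) ∧ ∀ x : M, |DiscountedHJ.uPlus H lam x| ≤ C) ∧
    ∀ lam : ℝ, 0 < lam →
      (∀ x : M, ∃ γ : ℝ → M, DiscountedHJ.IsForwardMinimizer H lam x γ) ∧
      DiscountedHJ.IsDominated H lam (DiscountedHJ.uPlus H lam) ∧
      (∀ (x : M) (γ : ℝ → M), DiscountedHJ.IsForwardMinimizer H lam x γ →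
        DiscountedHJ.IsCalibrated H lam (DiscountedHJ.uPlus H lam) x γ) ∧
      DiscountedHJ.IsViscositySolution (DiscountedHJ.symHamiltonian H) lam
        (DiscountedHJ.criticalValue H) (fun x => - DiscountedHJ.uPlus H lam x) ∧
      ∀ w : M → ℝ, DiscountedHJ.IsViscositySolution (DiscountedHJ.symHamiltonian H) lam
        (DiscountedHJ.criticalValue H) w → w = fun x => - DiscountedHJ.uPlus H lam x := by
  have hH : DiscountedHJ.IsTonelliHamiltonian H := ⟨hcont, hconv, hsuper⟩
  obtain ⟨N, f, hf⟩ := DiscountedHJ.exists_isBiLipschitzImmersion n M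
  obtain ⟨K, hK⟩ := DiscountedHJ.exists_lipschitzWith_valueFunction hH hf
  obtain ⟨C, hC⟩ := DiscountedHJ.exists_abs_valueFunction_le hH hf
  refine ⟨⟨K, C, fun lam hlam _ => ⟨(hK lam hlam).neg, fun x => ?_⟩⟩, fun lam hlam => ?_⟩
  · rw [DiscountedHJ.uPlus, abs_neg]
    exact hC lam hlam x
  have hV : (fun x => -DiscountedHJ.uPlus H lam x) = DiscountedHJ.valueFunction H lam :=
    funext fun x => neg_neg _
  have hsol := DiscountedHJ.isViscositySolution_valueFunction hH hf hlam
  rw [hV]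
  refine ⟨DiscountedHJ.exists_isForwardMinimizer hlam hH hf,
    DiscountedHJ.isDominated_uPlus hlam hH hf,
    fun x γ hγ => hγ.isCalibrated hlam hH hf, hsol, fun w hw => funext fun x => le_antisymm ?_ ?_⟩
  -- Comparison needs only one Lipschitz function, and V is one, so it applies in both directions to
  -- a merely continuous solution.
  · exact hw.le_of_lipschitz hH hf hlam hsol (Or.inr ⟨K, hK lam hlam⟩) x
  · exact hsol.le_of_lipschitz hH hf hlam hw (Or.inl ⟨K, hK lam hlam⟩) x
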